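/- Let $\mathfrak n$ be a real two-step nilpotent Lie algebra with a basis $Z_1,\dots,Z_r,Y_1,\dots,Y_d,X_1,\dots,X_d$ ($d\ge 1$) such that the $Z_i$ span the center $\mathfrak z$, $[\mathfrak n,\mathfrak n]\subseteq\mathfrak z$, $[Y_i,Y_j]=[X_i,X_j]=0$ for all $i,j$, and for some linear functional $\ell$ on $\mathfrak n$ the stabilizer $\{u:\ell[u,v]=0\ \forall v\}$ equals $\mathfrak z$. Let $N=\exp\mathfrak n$ be the connected, simply connected Lie group of $\mathfrak n$, with Haar measure $dn=dz\,dy\,dx$ in the coordinates $n=\exp(\sum z_iZ_i)\exp(\sum y_iY_i)\exp(\sum x_iX_i)$, and let $L$ be the left regular representation on $L^2(N)$. For $\lambda\in\mathbb R^r\cong\mathfrak z^*$, extended by $0$ to the $Y_i$ and $X_i$, let $B(\lambda)=(-\lambda[X_i,Y_j])_{i,j}$, and let $V(\lambda)$ be the matrix of the form $(u,v)\mapsto\lambda[u,v]$ on $Y_1,\dots,Y_d,X_1,\dots,X_d$; put $\Sigma=\{\lambda:\det V(\lambda)\ne0\}$, where $\det V(\lambda)=(\det B(\lambda))^2$. For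 $\lambda\in\Sigma$ let $\pi_\lambda$ be the irreducible representation of $N$ on $L^2(\mathbb R^d)$ given, for $n$ with coordinates $(z,y,x)$, by $(\pi_\lambda(n)F)(t)=e^{2\pi i\langle\lambda,z\rangle}e^{2\pi i\langle t,B(\lambda)y\rangle}F(t-x)$. Let $\mathcal P:L^2(N)\to\int_\Sigma^\oplus L^2(\mathbb R^d)\otimes L^2(\mathbb R^d)\,d\mu(\lambda)$, $d\mu(\lambda)=|\det B(\lambda)|\,d\lambda$, be the Plancherel transform, i.e. the continuous extension of $f\mapsto\big(\int_N f(n)\pi_\lambda(n)\,dn\big)_\lambda$ from $L^1(N)\cap L^2(N)$, where $L^2(\mathbb R^d)\otimes L^2(\mathbb R^d)$ is the space of Hilbert--Schmidt operators on $L^2(\mathbb R^d)$, with $f\otimes u:\psi\mapsto\langle\psi,u\rangle f$. Let $\mathbf I\subseteq\Sigma$ be bounded and measurable, let $(P_\lambda)_{\lambda\in\mathbf I}$ be a measurable field of orthogonal projections of $L^2(\mathbb R^d)$, let $m(\lambda)=\operatorname{rank}P_\lambda\in\mathbb N\cup\{0,\infty\}$, and let $\mathcal K\subseteq L^2(N)$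 be the band-limited subspace with $$\mathcal P(\mathcal K)=\int_{\mathbf I}^\oplus L^2(\mathbb R^d)\otimes P_\lambda\big(L^2(\mathbb R^d)\big)\,d\mu(\lambda).$$ Let $a\in(0,\infty)^r$ and $q,b\in(0,\infty)^d$, and let $$\Gamma_{a,q,b}=\Big\{\prod_{j=1}^r\exp\big(\tfrac{m_j}{a_j}Z_j\big)\prod_{j=1}^d\exp\big(\tfrac{k_j}{q_j}Y_j\big)\prod_{j=1}^d\exp\big(\tfrac{n_j}{b_j}X_j\big):m_j,k_j,n_j\in\mathbb Z\Big\}.$$ Suppose that $\phi\in\mathcal K$ is a continuous wavelet, i.e. $\psi\mapsto\langle\psi,L(\cdot)\phi\rangle$ is an isometry of $\mathcal K$ into $L^2(N)$, and that $\{L(\gamma)\phi\}_{\gamma\in\Gamma_{a,q,b}}$ is a Parseval frame of $\mathcal K$. Then $$m(\lambda)\le\frac1{a_1\cdots a_r\,|\det B(\lambda)|}\quad\text{for almost every }\lambda\in\mathbf I,\qquad\text{and}\qquad\|\phi\|^2\le\int_{\mathbf I}b_1\cdots b_d\,q_1\cdots q_d\,d\lambda.$$ -/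

import Mathlib

open MeasureTheory Filter Topology
open scoped ENNReal Matrix ComplexConjugate

noncomputable section

namespace TwoStep

/-- A basis `Z₁, …, Z_r, Y₁, …, Y_d, X₁, …, X_d` of a real Lie algebra `𝔫` as in the class of
two-step nilpotent Lie algebras under consideration: `𝔫` is two-step, the `Z`'s span the center,
the `Z`'s and `Y`'s span a commutative ideal `𝔭`, the `X`'s span a commutative subalgebra `𝔪`,
and the stabilizer `𝔫(l) = {u | l [u, v] = 0 for all v}` of some (hence of a generic) linear
functional `l` is the center. -/
structure AdaptedBasis (𝔫 : Type*) [LieRing 𝔫] [LieAlgebra ℝ 𝔫] (r d : ℕ) where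
  basis : Module.Basis (Fin r ⊕ Fin d ⊕ Fin d) ℝ 𝔫
  two_step : ∀ u v : 𝔫, ⁅u, v⁆ ∈ LieAlgebra.center ℝ 𝔫
  span_Z : Submodule.span ℝ (Set.range fun i => basis (Sum.inl i)) =
    (LieAlgebra.center ℝ 𝔫).toSubmodule
  lie_Y_Y : ∀ i j, ⁅basis (Sum.inr (Sum.inl i)), basis (Sum.inr (Sum.inl j))⁆ = 0
  lie_X_X : ∀ i j, ⁅basis (Sum.inr (Sum.inr i)), basis (Sum.inr (Sum.inr j))⁆ = 0
  generic : ∃ l : Module.Dual ℝ 𝔫, ∀ u : 𝔫, (∀ v : 𝔫, l ⁅u, v⁆ = 0) →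
    u ∈ LieAlgebra.center ℝ 𝔫

universe u

variable {𝔫 : Type u} [LieRing 𝔫] [LieAlgebra ℝ 𝔫] {r d : ℕ}

namespace AdaptedBasis

/-- `z₁ Z₁ + ⋯ + z_r Z_r`. -/
def Z (e : AdaptedBasis 𝔫 r d) (z : Fin r → ℝ) : 𝔫 := ∑ i, z i • e.basis (Sum.inl i)

/-- `y₁ Y₁ + ⋯ + y_d Y_d`. -/
def Y (e : AdaptedBasis 𝔫 r d) (y : Fin d → ℝ) : 𝔫 := ∑ i, y i • e.basis (Sum.inr (Sum.inl i))

/-- `x₁ X₁ + ⋯ + x_d X_d`. -/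
def X (e : AdaptedBasis 𝔫 r d) (x : Fin d → ℝ) : 𝔫 := ∑ i, x i • e.basis (Sum.inr (Sum.inr i))

/-- The linear functional `(l₁, …, l_r, 0, …, 0)` on `𝔫`, in coordinates with respect to the
dual basis. -/
def functional (e : AdaptedBasis 𝔫 r d) (l : Fin r → ℝ) (u : 𝔫) : ℝ :=
  ∑ i, l i * e.basis.repr u (Sum.inl i)

/-- The matrix `B(l)` with entries `-l [X_i, Y_j]`. -/
def B (e : AdaptedBasis 𝔫 r d) (l : Fin r → ℝ) : Matrix (Fin d) (Fin d) ℝ :=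
  Matrix.of fun i j =>
    -e.functional l ⁅e.basis (Sum.inr (Sum.inr i)), e.basis (Sum.inr (Sum.inl j))⁆

/-- The skew-symmetric matrix `V(l)` of the form `(u, v) ↦ l [u, v]` on the non-central basis
vectors `Y₁, …, Y_d, X₁, …, X_d`. -/
def V (e : AdaptedBasis 𝔫 r d) (l : Fin r → ℝ) :
    Matrix (Fin d ⊕ Fin d) (Fin d ⊕ Fin d) ℝ :=
  Matrix.of fun i j => e.functional l ⁅e.basis (Sum.inr i), e.basis (Sum.inr j)⁆

/-- The cross-section `Σ` of the generic coadjoint orbits, as a subset of `𝔷(𝔫)* = ℝ^r`. -/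
def crossSection (e : AdaptedBasis 𝔫 r d) : Set (Fin r → ℝ) := {l | (e.V l).det ≠ 0}

end AdaptedBasis

/-- The connected, simply connected Lie group `N = exp 𝔫` of the two-step nilpotent Lie algebra
`𝔫`: the exponential map is a bijection, and the product is given by the
Baker-Campbell-Hausdorff formula `exp u * exp v = exp (u + v + [u, v] / 2)`. -/
@[ext] structure NilGroup (e : AdaptedBasis 𝔫 r d) where
  exp ::
  log : 𝔫

namespace NilGroup

variable {e : AdaptedBasis 𝔫 r d}

instance : Mul (NilGroup e) := ⟨fun g h => exp (g.log + h.log + (1 / 2 : ℝ) • ⁅g.log, h.log⁆)⟩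
instance : One (NilGroup e) := ⟨exp 0⟩
instance : Inv (NilGroup e) := ⟨fun g => exp (-g.log)⟩

theorem log_mul (g h : NilGroup e) :
    (g * h).log = g.log + h.log + (1 / 2 : ℝ) • ⁅g.log, h.log⁆ := rfl
theorem log_one : (1 : NilGroup e).log = 0 := rfl
theorem log_inv (g : NilGroup e) : (g⁻¹).log = -g.log := rfl

theorem central_lie {c : 𝔫} (hc : c ∈ LieAlgebra.center ℝ 𝔫) (u : 𝔫) : ⁅u, c⁆ = 0 :=
  (LieModule.mem_maxTrivSubmodule ℝ 𝔫 𝔫 c).1 hc u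

theorem lie_central {c : 𝔫} (hc : c ∈ LieAlgebra.center ℝ 𝔫) (u : 𝔫) : ⁅c, u⁆ = 0 := by
  rw [← lie_skew, central_lie hc, neg_zero]

theorem lie_lie_right (e : AdaptedBasis 𝔫 r d) (u v w : 𝔫) : ⁅u, ⁅v, w⁆⁆ = 0 :=
  central_lie (e.two_step v w) u

theorem lie_lie_left (e : AdaptedBasis 𝔫 r d) (u v w : 𝔫) : ⁅⁅u, v⁆, w⁆ = 0 :=
  lie_central (e.two_step u v) w

instance : Group (NilGroup e) :=
  Group.ofLeftAxioms
    (fun a b c => by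
      ext
      simp only [log_mul, lie_add, add_lie, lie_smul, smul_lie, lie_lie_right e, lie_lie_left e,
        smul_zero, add_zero, smul_add]
      abel)
    (fun a => by ext; simp [log_mul, log_one])
    (fun a => by ext; simp [log_mul, log_one, log_inv])

theorem repr_central (e : AdaptedBasis 𝔫 r d) {c : 𝔫} (hc : c ∈ LieAlgebra.center ℝ 𝔫)
    (j : Fin d ⊕ Fin d) : e.basis.repr c (Sum.inr j) = 0 := by
  have h : Submodule.span ℝ (Set.range fun i => e.basis (Sum.inl i)) ≤
      LinearMap.ker (e.basis.coord (Sum.inr j)) := by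
    rw [Submodule.span_le]
    rintro _ ⟨i, rfl⟩
    simp
  rw [e.span_Z] at h
  simpa using h hc

theorem Z_central (e : AdaptedBasis 𝔫 r d) (z : Fin r → ℝ) :
    e.Z z ∈ LieAlgebra.center ℝ 𝔫 := by
  have h : e.Z z ∈ Submodule.span ℝ (Set.range fun i => e.basis (Sum.inl i)) :=
    Submodule.sum_mem _ fun i _ => Submodule.smul_mem _ _ (Submodule.subset_span ⟨i, rfl⟩)
  rw [e.span_Z] at h
  exact h

theorem lie_Y_Y (e : AdaptedBasis 𝔫 r d) (y y' : Fin d → ℝ) : ⁅e.Y y, e.Y y'⁆ = 0 := by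
  simp [AdaptedBasis.Y, sum_lie, lie_sum, e.lie_Y_Y]

theorem lie_X_X (e : AdaptedBasis 𝔫 r d) (x x' : Fin d → ℝ) : ⁅e.X x, e.X x'⁆ = 0 := by
  simp [AdaptedBasis.X, sum_lie, lie_sum, e.lie_X_X]

theorem Z_add (e : AdaptedBasis 𝔫 r d) (z z' : Fin r → ℝ) : e.Z (z + z') = e.Z z + e.Z z' := by
  simp [AdaptedBasis.Z, add_smul, Finset.sum_add_distrib]

theorem Y_add (e : AdaptedBasis 𝔫 r d) (y y' : Fin d → ℝ) : e.Y (y + y') = e.Y y + e.Y y' := by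
  simp [AdaptedBasis.Y, add_smul, Finset.sum_add_distrib]

theorem X_add (e : AdaptedBasis 𝔫 r d) (x x' : Fin d → ℝ) : e.X (x + x') = e.X x + e.X x' := by
  simp [AdaptedBasis.X, add_smul, Finset.sum_add_distrib]

theorem Y_zero (e : AdaptedBasis 𝔫 r d) : e.Y 0 = 0 := by simp [AdaptedBasis.Y]

theorem X_zero (e : AdaptedBasis 𝔫 r d) : e.X 0 = 0 := by simp [AdaptedBasis.X]

theorem eq_Z_add_Y_add_X (e : AdaptedBasis 𝔫 r d) (u : 𝔫) :
    u = e.Z (fun i => e.basis.repr u (Sum.inl i))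
      + e.Y (fun i => e.basis.repr u (Sum.inr (Sum.inl i)))
      + e.X (fun i => e.basis.repr u (Sum.inr (Sum.inr i))) := by
  have h := e.basis.sum_repr u
  rw [Fintype.sum_sum_type, Fintype.sum_sum_type, ← add_assoc] at h
  exact h.symm

theorem repr_Z_add_Y_add_X (e : AdaptedBasis 𝔫 r d) (z : Fin r → ℝ) (y x : Fin d → ℝ) :
    e.basis.repr (e.Z z + e.Y y + e.X x) =
      Finsupp.equivFunOnFinite.symm (Sum.elim z (Sum.elim y x)) := by
  ext (i | i | i) <;>
    simp [AdaptedBasis.Z, AdaptedBasis.Y, AdaptedBasis.X, Finsupp.single_apply]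

/-- Coordinates on `N`: the element `exp (∑ z_i Z_i) * exp (∑ y_i Y_i) * exp (∑ x_i X_i)`. -/
def ofCoords (e : AdaptedBasis 𝔫 r d) (p : (Fin r → ℝ) × (Fin d → ℝ) × (Fin d → ℝ)) :
    NilGroup e :=
  exp (e.Z p.1) * exp (e.Y p.2.1) * exp (e.X p.2.2)

/-- The coordinates `(z, y, x)` of `exp (∑ z_i Z_i) * exp (∑ y_i Y_i) * exp (∑ x_i X_i)`. -/
def coords (g : NilGroup e) : (Fin r → ℝ) × (Fin d → ℝ) × (Fin d → ℝ) :=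
  let y : Fin d → ℝ := fun i => e.basis.repr g.log (Sum.inr (Sum.inl i))
  let x : Fin d → ℝ := fun i => e.basis.repr g.log (Sum.inr (Sum.inr i))
  (fun i => e.basis.repr (g.log - (1 / 2 : ℝ) • ⁅e.Y y, e.X x⁆) (Sum.inl i), y, x)

theorem log_ofCoords (e : AdaptedBasis 𝔫 r d)
    (p : (Fin r → ℝ) × (Fin d → ℝ) × (Fin d → ℝ)) :
    (ofCoords e p).log =
      e.Z p.1 + e.Y p.2.1 + e.X p.2.2 + (1 / 2 : ℝ) • ⁅e.Y p.2.1, e.X p.2.2⁆ := by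
  simp [ofCoords, log_mul, lie_central (Z_central e p.1)]

/-- The vector of structure constants `[∑ x_i X_i, ∑ y_j Y_j] = ∑ c_i Z_i`. -/
def bracketXY (e : AdaptedBasis 𝔫 r d) (x y : Fin d → ℝ) : Fin r → ℝ :=
  fun i => e.basis.repr ⁅e.X x, e.Y y⁆ (Sum.inl i)

theorem Z_bracketXY (e : AdaptedBasis 𝔫 r d) (x y : Fin d → ℝ) :
    e.Z (bracketXY e x y) = ⁅e.X x, e.Y y⁆ := by
  conv_rhs => rw [eq_Z_add_Y_add_X e ⁅e.X x, e.Y y⁆]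
  simp only [repr_central e (e.two_step _ _)]
  have h0 : (fun _ => 0 : Fin d → ℝ) = 0 := rfl
  simp only [h0, Y_zero, X_zero, add_zero]
  rfl

theorem coords_ofCoords (p : (Fin r → ℝ) × (Fin d → ℝ) × (Fin d → ℝ)) :
    coords (ofCoords e p) = p := by
  have hr : ∀ j, e.basis.repr (ofCoords e p).log (Sum.inr j) = Sum.elim p.2.1 p.2.2 j := by
    intro j
    rw [log_ofCoords, map_add, repr_Z_add_Y_add_X]
    simp [repr_central e (e.two_step _ _)]
  have h1 : (fun i => e.basis.repr (ofCoords e p).log (Sum.inr (Sum.inl i))) = p.2.1 := by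
    ext i; simp [hr]
  have h2 : (fun i => e.basis.repr (ofCoords e p).log (Sum.inr (Sum.inr i))) = p.2.2 := by
    ext i; simp [hr]
  simp only [coords, h1, h2]
  refine Prod.ext ?_ rfl
  ext i
  rw [log_ofCoords, add_sub_cancel_right, repr_Z_add_Y_add_X]
  simp

theorem ofCoords_coords (g : NilGroup e) : ofCoords e (coords g) = g := by
  ext
  rw [log_ofCoords]
  set w := (1 / 2 : ℝ) • ⁅e.Y (coords g).2.1, e.X (coords g).2.2⁆ with hw
  have h := eq_Z_add_Y_add_X e (g.log - w)
  have hr : ∀ j, e.basis.repr (g.log - w) (Sum.inr j) = e.basis.repr g.log (Sum.inr j) := by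
    intro j
    rw [hw, map_sub, map_smul]
    simp [repr_central e (e.two_step _ _)]
  simp only [hr] at h
  exact (sub_eq_iff_eq_add.1 h).symm

/-- The coordinates of the second kind as a bijection onto `N`. -/
def coordsEquiv (e : AdaptedBasis 𝔫 r d) :
    NilGroup e ≃ (Fin r → ℝ) × (Fin d → ℝ) × (Fin d → ℝ) where
  toFun := coords
  invFun := ofCoords e
  left_inv := ofCoords_coords
  right_inv := coords_ofCoords

theorem ofCoords_mul (e : AdaptedBasis 𝔫 r d)
    (p p' : (Fin r → ℝ) × (Fin d → ℝ) × (Fin d → ℝ)) :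
    ofCoords e p * ofCoords e p' =
      ofCoords e (p.1 + p'.1 + bracketXY e p.2.2 p'.2.1, p.2.1 + p'.2.1, p.2.2 + p'.2.2) := by
  ext
  simp only [log_mul, log_ofCoords, Z_add, Y_add, X_add, Z_bracketXY, lie_add, add_lie, lie_smul,
    smul_lie, lie_lie_right e, lie_lie_left e, lie_central (Z_central e _),
    central_lie (Z_central e _), lie_Y_Y, lie_X_X, smul_zero, add_zero, zero_add, smul_add]
  rw [← lie_skew (e.Y p'.2.1) (e.X p.2.2)]
  module

/-- The Borel structure of `N`, transported from the coordinates. -/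
instance : MeasurableSpace (NilGroup e) := MeasurableSpace.comap coords inferInstance

/-- The coordinates of the second kind as an isomorphism of Borel spaces. -/
def coordsMeasurableEquiv (e : AdaptedBasis 𝔫 r d) :
    NilGroup e ≃ᵐ (Fin r → ℝ) × (Fin d → ℝ) × (Fin d → ℝ) where
  toEquiv := coordsEquiv e
  measurable_toFun := comap_measurable _
  measurable_invFun := by
    rintro _ ⟨s, hs, rfl⟩
    have h : (coordsEquiv e).symm ⁻¹' (coords ⁻¹' s) = s := by
      ext p
      simp [coordsEquiv, coords_ofCoords]
    rw [h]
    exact hs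

/-- The canonical Haar measure `dn = dz dy dx` of `N`. -/
def haar (e : AdaptedBasis 𝔫 r d) : Measure (NilGroup e) :=
  Measure.map (ofCoords e) volume

theorem measurable_bracketXY (e : AdaptedBasis 𝔫 r d) (x : Fin d → ℝ) :
    Measurable (bracketXY e x) := by
  refine measurable_pi_lambda _ fun i => ?_
  simp only [bracketXY, AdaptedBasis.Y, lie_sum, lie_smul, map_sum, map_smul, Finsupp.coe_finsetSum,
    Finset.sum_apply, Finsupp.smul_apply]
  fun_prop

/-- The measure `dz dy dx` is invariant under left translations. -/
theorem measurePreserving_mul_left (g : NilGroup e) :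
    MeasurePreserving (fun n => g * n) (haar e) (haar e) := by
  have hc : MeasurePreserving (ofCoords e) volume (haar e) :=
    ⟨(coordsMeasurableEquiv e).symm.measurable, rfl⟩
  have hc' : MeasurePreserving (coords (e := e)) (haar e) volume :=
    MeasurePreserving.symm (coordsMeasurableEquiv e).symm hc
  set p := coords g with hp
  have hskew : MeasurePreserving
      (fun w : ((Fin d → ℝ) × (Fin d → ℝ)) × (Fin r → ℝ) =>
        (p.2 + w.1, p.1 + w.2 + bracketXY e p.2.2 w.1.1))
      (volume.prod volume) (volume.prod volume) := by
    have hadd : MeasurePreserving (fun w : (Fin d → ℝ) × (Fin d → ℝ) => p.2 + w)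
        volume volume :=
      (measurePreserving_add_left volume p.2.1).prod (measurePreserving_add_left volume p.2.2)
    refine hadd.skew_product
      (g := fun w z => p.1 + z + bracketXY e p.2.2 w.1) ?_ ?_
    · exact (measurable_const.add measurable_snd).add
        ((measurable_bracketXY e p.2.2).comp (measurable_fst.comp measurable_fst))
    · refine Eventually.of_forall fun w => ?_
      exact ((measurePreserving_add_right volume (bracketXY e p.2.2 w.1)).comp
        (measurePreserving_add_left volume p.1)).map_eq
  have hsw := Measure.measurePreserving_swap
    (μ := (volume : Measure ((Fin d → ℝ) × (Fin d → ℝ)))) (ν := (volume : Measure (Fin r → ℝ)))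
  have hsw' := Measure.measurePreserving_swap
    (μ := (volume : Measure (Fin r → ℝ))) (ν := (volume : Measure ((Fin d → ℝ) × (Fin d → ℝ))))
  have h := hc.comp ((hsw.comp (hskew.comp hsw')).comp hc')
  convert h using 1
  funext n
  conv_lhs => rw [← ofCoords_coords g, ← ofCoords_coords n, ofCoords_mul]
  rfl

end NilGroup

/-- The Hilbert space `L²(N)`. -/
abbrev L2N (e : AdaptedBasis 𝔫 r d) : Type u := Lp ℂ 2 (NilGroup.haar e)

/-- The Hilbert space `L²(ℝ^d)`. -/
abbrev L2 (d : ℕ) : Type := Lp ℂ 2 (volume : Measure (Fin d → ℝ))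

/-- The left regular representation, `(L(g) f)(n) = f(g⁻¹ n)`. -/
def leftRegular (e : AdaptedBasis 𝔫 r d) (g : NilGroup e) (f : L2N e) : L2N e :=
  Lp.compMeasurePreserving (fun n => g⁻¹ * n) (NilGroup.measurePreserving_mul_left g⁻¹) f

/-- The phase of the unitary operator `π_l(n)`, where `n` has coordinates `p = (z, y, x)`. -/
def piPhase (e : AdaptedBasis 𝔫 r d) (l : Fin r → ℝ)
    (p : (Fin r → ℝ) × (Fin d → ℝ) × (Fin d → ℝ)) (t : Fin d → ℝ) : ℂ :=
  Complex.exp (((2 * Real.pi * (l ⬝ᵥ p.1 + t ⬝ᵥ (e.B l *ᵥ p.2.1)) : ℝ) : ℂ) * Complex.I)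

theorem memLp_pi (e : AdaptedBasis 𝔫 r d) (l : Fin r → ℝ)
    (p : (Fin r → ℝ) × (Fin d → ℝ) × (Fin d → ℝ)) (F : L2 d) :
    MemLp (fun t => piPhase e l p t * F (t - p.2.2)) 2 volume := by
  have h : MemLp (fun t => F (t - p.2.2)) 2 volume :=
    (Lp.memLp F).comp_measurePreserving (measurePreserving_sub_right volume p.2.2)
  refine h.of_le (AEStronglyMeasurable.mul ?_ h.1) (Eventually.of_forall fun t => ?_)
  · have hcont : Continuous (piPhase e l p) := by
      unfold piPhase
      fun_prop
    exact hcont.aestronglyMeasurable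
  · rw [norm_mul, piPhase, Complex.norm_exp_ofReal_mul_I, one_mul]

/-- The irreducible unitary representation `π_l` of `N` on `L²(ℝ^d)`: for
`n = exp (∑ z_i Z_i) * exp (∑ y_i Y_i) * exp (∑ x_i X_i)`,
`(π_l(n) F)(t) = exp (2πi ⟨l, z⟩) exp (2πi ⟨t, B(l) y⟩) F(t - x)`. -/
def piRep (e : AdaptedBasis 𝔫 r d) (l : Fin r → ℝ) (n : NilGroup e) (F : L2 d) : L2 d :=
  (memLp_pi e l n.coords F).toLp _

/-- The Plancherel measure `dμ(l) = |det B(l)| dl`. -/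
def plancherelMeasure (e : AdaptedBasis 𝔫 r d) : Measure (Fin r → ℝ) :=
  volume.withDensity fun l => ENNReal.ofReal |(e.B l).det|

/-- The direct integral `∫^⊕ L²(ℝ^d) ⊗ L²(ℝ^d) dμ(l)`. An element of `L²(ℝ^d) ⊗ L²(ℝ^d)`, that is, a
Hilbert-Schmidt operator on `L²(ℝ^d)`, is given by its integral kernel `k(t, s)` in
`L²(ℝ^d × ℝ^d)`; the kernel of the rank one operator `f ⊗ u : ψ ↦ ⟨ψ, u⟩ f` is
`f(t) * conj u(s)`, and the Hilbert-Schmidt norm is the `L²` norm of the kernel. The measure `μ`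
gives no mass to the complement of `Σ`, where `det B(l) = 0`. -/
abbrev L2Dual (e : AdaptedBasis 𝔫 r d) : Type :=
  Lp ℂ 2 ((plancherelMeasure e).prod
    (volume : Measure ((Fin d → ℝ) × (Fin d → ℝ))))

/-- `G` is the group Fourier transform of `f`: for almost every `l` the operator
`∫ f(n) π_l(n) dn` on `L²(ℝ^d)` (a weak operator integral) has the integral kernel `G(l, ·, ·)`. -/
def IsFourierTransform (e : AdaptedBasis 𝔫 r d) (f : L2N e) (G : L2Dual e) : Prop :=
  ∀ᵐ l ∂plancherelMeasure e, ∀ ψ χ : L2 d,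
    ∫ p : (Fin d → ℝ) × (Fin d → ℝ), conj (χ p.1) * G (l, p) * ψ p.2 =
      ∫ n, f n * inner ℂ χ (piRep e l n ψ) ∂NilGroup.haar e

/-- The graph of the Fourier transform on `L¹(N) ∩ L²(N)`. -/
def fourierGraph (e : AdaptedBasis 𝔫 r d) : Set (L2N e × L2Dual e) :=
  {p | Integrable p.1 (NilGroup.haar e) ∧ IsFourierTransform e p.1 p.2}

/-- The Plancherel transform: the extension by continuity of the Fourier transform from
`L¹(N) ∩ L²(N)` to `L²(N)`, i.e. `𝒫 f` is the limit of the Fourier transforms `G` of functions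
`g ∈ L¹(N) ∩ L²(N)` as `g` tends to `f` in `L²(N)`. -/
def plancherel (e : AdaptedBasis 𝔫 r d) (f : L2N e) : L2Dual e :=
  limUnder (comap Prod.fst (𝓝 f) ⊓ 𝓟 (fourierGraph e)) Prod.snd

/-- The subspace `∫_I^⊕ L²(ℝ^d) ⊗ P_l(L²(ℝ^d)) dμ(l)` of the direct integral: the fields that
vanish outside of `I` and take their values in `L²(ℝ^d) ⊗ P_l(L²(ℝ^d))` on `I`. -/
def directIntegral (e : AdaptedBasis 𝔫 r d) (I : Set (Fin r → ℝ))
    (P : (Fin r → ℝ) → L2 d →L[ℂ] L2 d) : Set (L2Dual e) :=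
  {G | ∀ᵐ l ∂plancherelMeasure e,
    (l ∈ I → ∀ᵐ t : Fin d → ℝ, ∃ u ∈ Set.range (P l), ∀ᵐ s : Fin d → ℝ,
      G (l, t, s) = conj (u s)) ∧
    (l ∉ I → ∀ᵐ t : Fin d → ℝ, ∀ᵐ s : Fin d → ℝ, G (l, t, s) = 0)}

/-- `P` is a measurable field of orthogonal projections of `L²(ℝ^d)` over `I`. -/
structure IsProjectionField (I : Set (Fin r → ℝ)) (P : (Fin r → ℝ) → L2 d →L[ℂ] L2 d) :
    Prop where
  isStarProjection : ∀ l ∈ I, IsStarProjection (P l)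
  measurable : ∀ u v : L2 d, Measurable fun l : I => inner ℂ u (P l v)

/-- The multiplicity function `m(l) = rank P_l`, with values in `ℕ ∪ {∞}`. -/
def multiplicity (P : (Fin r → ℝ) → L2 d →L[ℂ] L2 d) (l : Fin r → ℝ) : ℕ∞ :=
  Cardinal.toENat (LinearMap.rank (P l : L2 d →ₗ[ℂ] L2 d))

/-- `φ ∈ K` is a continuous wavelet (admissible vector) for the left regular representation
restricted to `K`: the map `ψ ↦ (n ↦ ⟨ψ, L(n) φ⟩)` is an isometry of `K` into `L²(N)`. -/
def IsContinuousWavelet (e : AdaptedBasis 𝔫 r d) (K : Submodule ℂ (L2N e)) (φ : L2N e) : Prop :=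
  φ ∈ K ∧ ∀ ψ ∈ K,
    ∫⁻ n, ‖inner ℂ (leftRegular e n φ) ψ‖ₑ ^ 2 ∂NilGroup.haar e = ‖ψ‖ₑ ^ 2

/-- The family `v` is a Parseval frame of the subspace `K`. -/
def IsParsevalFrame {H ι : Type*} [NormedAddCommGroup H] [InnerProductSpace ℂ H]
    (K : Submodule ℂ H) (v : ι → H) : Prop :=
  (∀ i, v i ∈ K) ∧ ∀ ψ ∈ K, HasSum (fun i => ‖inner ℂ (v i) ψ‖ ^ 2) (‖ψ‖ ^ 2)

/-- The quasi-lattice `Γ_{a,q,b}` of all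
`∏ exp ((m_j / a_j) Z_j) * ∏ exp ((k_j / q_j) Y_j) * ∏ exp ((n_j / b_j) X_j)` with integers
`m_j`, `k_j`, `n_j`. -/
def quasiLattice (e : AdaptedBasis 𝔫 r d) (a : Fin r → ℝ) (q b : Fin d → ℝ) :
    Set (NilGroup e) :=
  Set.range fun i : (Fin r → ℤ) × (Fin d → ℤ) × (Fin d → ℤ) =>
    NilGroup.ofCoords e
      (fun j => i.1 j / a j, fun j => i.2.1 j / q j, fun j => i.2.2 j / b j)

end TwoStep

end

noncomputable section

namespace TwoStep

universe u

/-! Write `Φ` for the Plancherel transform of `φ`, a field of integral kernels, and let `w(l) = |det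
B(l)| ‖Φ(l)‖²` be its fiber weight, with the Hilbert-Schmidt norm. Both conclusions come from
squeezing `w` between the discrete and the continuous reproducing formula.

Upper bound (`ae_fiberWeight_le`). Applying the Parseval identity to central translates of `ψ ∈ K`,
discarding all lattice points except the central ones, and integrating over a central box gives `∫
|⟨ψ, L(z)φ⟩|² dz ≤ ‖ψ‖² / ∏ a_j`. For `ψ` with transform `1_E Φ`, the coefficient is the Euclidean
Fourier transform of `1_E w`, so Plancherel yields `∫_E w² ≤ (∏ a_j)⁻¹ ∫_E w` for bounded `E` on
which `w` is bounded. Hence `w ≤ (∏ a_j)⁻¹` almost everywhere.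

Lower bound (`ae_multiplicity_le_fiberNormSq`). The wavelet isometry is tested on `ψ` with transform
`1_E(l) (1_Q ⊗ P_l v)`, `Q` the unit cube. For fixed `x` the coefficient of `φ` is a Fourier
transform in `(z, y)`, and `lintegral_enorm_inner_leftRegular_le` bounds its square integral on the
dual side. Localizing in `l` gives `‖P_l v‖ ≤ ‖Φ(l) P_l v‖`; Bessel's inequality over orthonormal
vectors in the range of `P_l` then gives `m(l) ≤ ‖Φ(l)‖²`. Multiplying by `|det B(l)|` and using the
upper bound proves the first claim.

Norm bound. Right translates of a coordinate box by `Γ` tile `N`, although `Γ` need not be a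
subgroup. Integrating the Parseval identity over the box and comparing with the wavelet isometry
forces the box to have volume one unless `φ = 0` (`volume_box_mul_enorm_sq`), so `(∏ a_j)⁻¹ = ∏ b_j
∏ q_j`. Since `w` vanishes almost everywhere off `I`, `‖φ‖² = ∫_I w ≤ |I| ∏ b_j ∏ q_j`.

All of this needs a concrete Plancherel transform: the kernel of `∫ g(n) π_l(n) dn` at `(t, s)` is
the partial Fourier transform of `g` in `(z, y)` at `(l, t B(l))`, with `x = t - s`. The density
`|det B(l)|` is the Jacobian of `t ↦ t B(l)`, so the isometry reduces to the Euclidean one, and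
`plancherel_eq` identifies the limit definition with its continuous extension. -/

theorem eLpNorm_two_sq {α E : Type*} [MeasurableSpace α] [NormedAddCommGroup E] (μ : Measure α)
    (f : α → E) : eLpNorm f 2 μ ^ 2 = ∫⁻ x, ‖f x‖ₑ ^ 2 ∂μ := by
  have h := eLpNorm_nnreal_pow_eq_lintegral (f := f) (p := 2) (μ := μ) two_ne_zero
  simpa using h

/-! ### The L² Fourier transform and the Fourier integral -/

section Fourier

open scoped FourierTransform SchwartzMap ContDiff

variable {V : Type*} [NormedAddCommGroup V] [InnerProductSpace ℝ V] [FiniteDimensional ℝ V]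
  [MeasurableSpace V] [BorelSpace V]

/-- Both sides define the same distribution: paired with a smooth compactly supported function, each
moves the Fourier transform onto the test function, one by the definition on tempered distributions
and the other by Fubini. -/
theorem fourier_toLp_ae_eq {f : V → ℂ} (hf : Integrable f) (hf2 : MemLp f 2) :
    (𝓕 (hf2.toLp f) : Lp (α := V) ℂ 2) =ᵐ[volume] 𝓕 f := by
  have hcont : Continuous (𝓕 f) := VectorFourier.fourierIntegral_continuous
    Real.continuous_fourierChar (by exact continuous_inner) hf
  refine ae_eq_of_integral_contDiff_smul_eq
    ((Lp.memLp _).locallyIntegrable (by norm_num)) hcont.locallyIntegrable ?_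
  intro g g_smooth g_cpt
  have hg₁ : HasCompactSupport (Complex.ofRealCLM ∘ g) := g_cpt.comp_left rfl
  have hg₂ : ContDiff ℝ ∞ (Complex.ofRealCLM ∘ g) := by fun_prop
  set G : 𝓢(V, ℂ) := hg₁.toSchwartzMap hg₂ with hG
  have hGg : ∀ x, G x = (g x : ℂ) := fun x => rfl
  have key := congrArg (fun T => T G) (Lp.fourier_toTemperedDistribution_eq (hf2.toLp f))
  simp only [TemperedDistribution.fourier_apply, Lp.toTemperedDistribution_apply] at key
  have h1 : ∫ x, (𝓕 G) x • (hf2.toLp f) x = ∫ x, (𝓕 (G : V → ℂ)) x • f x := by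
    refine integral_congr_ae ?_
    filter_upwards [hf2.coeFn_toLp] with x hx
    rw [hx, SchwartzMap.fourier_coe]
  have h2 : ∫ x, (𝓕 (G : V → ℂ)) x • f x = ∫ x, G x • 𝓕 f x := by
    have := VectorFourier.integral_fourierIntegral_smul_eq_flip (L := innerₗ V) (μ := volume)
      (ν := volume) Real.continuous_fourierChar continuous_inner G.integrable hf
    rw [flip_innerₗ] at this
    exact this
  have h3 : ∀ u : V → ℂ, ∫ x, g x • u x = ∫ x, G x • u x := fun u => by
    simp [hGg]
  rw [h3, h3, ← h2, ← h1, key]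

theorem lintegral_enorm_sq_fourier {f : V → ℂ} (hf : Integrable f) (hf2 : MemLp f 2) :
    ∫⁻ w, ‖𝓕 f w‖ₑ ^ 2 = ∫⁻ v, ‖f v‖ₑ ^ 2 := by
  have h := Lp.norm_fourier_eq (E := V) (F := ℂ) (hf2.toLp f)
  rw [Lp.norm_def, Lp.norm_def, ENNReal.toReal_eq_toReal_iff' (Lp.eLpNorm_ne_top _)
    (Lp.eLpNorm_ne_top _), eLpNorm_congr_ae (fourier_toLp_ae_eq hf hf2),
    eLpNorm_congr_ae hf2.coeFn_toLp] at h
  rw [← eLpNorm_two_sq, ← eLpNorm_two_sq, h]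

end Fourier

/-! ### Plancherel identities in real coordinates -/

/-- The character `exp (2πi x)` of the real line. -/
def expi (x : ℝ) : ℂ := Complex.exp (((2 * Real.pi * x : ℝ) : ℂ) * Complex.I)

theorem norm_expi (x : ℝ) : ‖expi x‖ = 1 := Complex.norm_exp_ofReal_mul_I _

theorem expi_add (x y : ℝ) : expi (x + y) = expi x * expi y := by
  rw [expi, expi, expi, ← Complex.exp_add]
  congr 1
  push_cast
  ring

theorem conj_expi (x : ℝ) : conj (expi x) = expi (-x) := by
  rw [expi, expi, ← Complex.exp_conj, map_mul, Complex.conj_ofReal, Complex.conj_I]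
  congr 1
  push_cast
  ring

@[fun_prop] theorem continuous_expi : Continuous expi := by unfold expi; fun_prop

@[fun_prop] theorem measurable_expi : Measurable expi := continuous_expi.measurable

theorem lintegral_enorm_sq_fourier_pi {ι : Type*} [Fintype ι] {h : (ι → ℝ) → ℂ}
    (h1 : Integrable h) (h2 : MemLp h 2) :
    ∫⁻ w : ι → ℝ, ‖∫ v : ι → ℝ, expi (w ⬝ᵥ v) * h v‖ₑ ^ 2 = ∫⁻ v, ‖h v‖ₑ ^ 2 := by
  have hm : MeasurePreserving (@WithLp.ofLp 2 (ι → ℝ)) :=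
    PiLp.volume_preserving_ofLp ι
  have hemb : MeasurableEmbedding (@WithLp.ofLp 2 (ι → ℝ)) :=
    (MeasurableEquiv.toLp 2 (ι → ℝ)).symm.measurableEmbedding
  have key := lintegral_enorm_sq_fourier (hm.integrable_comp_of_integrable h1)
    (h2.comp_measurePreserving hm)
  simp only [Function.comp_apply] at key
  rw [hm.lintegral_comp_emb hemb (fun v => ‖h v‖ₑ ^ 2)] at key
  -- The kernel of `𝓕` carries the opposite sign from `expi (w ⬝ᵥ v)`; reflecting `w` makes them
  -- agree.
  rw [← key, ← hm.lintegral_comp_emb hemb, ← lintegral_neg_eq_self]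
  refine lintegral_congr fun w => ?_
  rw [Real.fourier_eq', ← hm.integral_comp hemb]
  congr 3
  ext v
  simp only [expi, smul_eq_mul, Function.comp_apply, PiLp.inner_apply, WithLp.ofLp_neg,
    dotProduct, real_inner_eq_re_inner]
  congr 3
  simp [mul_comm]

theorem lintegral_enorm_sq_fourier_pi_neg {ι : Type*} [Fintype ι] {h : (ι → ℝ) → ℂ}
    (h1 : Integrable h) (h2 : MemLp h 2) :
    ∫⁻ w : ι → ℝ, ‖∫ v : ι → ℝ, expi (-(w ⬝ᵥ v)) * h v‖ₑ ^ 2 = ∫⁻ v, ‖h v‖ₑ ^ 2 := by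
  rw [← lintegral_enorm_sq_fourier_pi h1 h2]
  conv_rhs => rw [← lintegral_neg_eq_self]
  simp [neg_dotProduct]

/-- Coordinates on a product of two Euclidean spaces. -/
theorem lintegral_enorm_sq_fourier_prod {m n : ℕ} {h : (Fin m → ℝ) × (Fin n → ℝ) → ℂ}
    (h1 : Integrable h) (h2 : MemLp h 2) :
    ∫⁻ w : (Fin m → ℝ) × (Fin n → ℝ),
      ‖∫ v : (Fin m → ℝ) × (Fin n → ℝ), expi (w.1 ⬝ᵥ v.1 + w.2 ⬝ᵥ v.2) * h v‖ₑ ^ 2 =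
      ∫⁻ v, ‖h v‖ₑ ^ 2 := by
  have hm := volume_measurePreserving_sumPiEquivProdPi (fun _ : Fin m ⊕ Fin n => ℝ)
  have hemb := (MeasurableEquiv.sumPiEquivProdPi
    (fun _ : Fin m ⊕ Fin n => ℝ)).measurableEmbedding
  have key := lintegral_enorm_sq_fourier_pi (hm.integrable_comp_of_integrable h1)
    (h2.comp_measurePreserving hm)
  simp only [Function.comp_apply] at key
  rw [hm.lintegral_comp_emb hemb (fun v => ‖h v‖ₑ ^ 2)] at key
  rw [← key, ← hm.lintegral_comp_emb hemb]
  refine lintegral_congr fun w => ?_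
  rw [← hm.integral_comp hemb]
  congr 3
  ext v
  congr 2
  simp [dotProduct, Fintype.sum_sum_type, MeasurableEquiv.sumPiEquivProdPi]

/-- The Plancherel identity as an inequality, without square-integrability. -/
theorem lintegral_enorm_sq_fourier_prod_neg_le {m n : ℕ} {h : (Fin m → ℝ) × (Fin n → ℝ) → ℂ}
    (h1 : Integrable h) :
    ∫⁻ w : (Fin m → ℝ) × (Fin n → ℝ),
      ‖∫ v : (Fin m → ℝ) × (Fin n → ℝ), expi (-(w.1 ⬝ᵥ v.1 + w.2 ⬝ᵥ v.2)) * h v‖ₑ ^ 2 ≤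
      ∫⁻ v, ‖h v‖ₑ ^ 2 := by
  -- Only integrability is known. If the right side is infinite nothing is claimed; otherwise the
  -- function is in `L²` and equality holds.
  by_cases h2 : ∫⁻ v, ‖h v‖ₑ ^ 2 = ∞
  · rw [h2]
    exact le_top
  have h2' : MemLp h 2 := by
    refine ⟨h1.1, ?_⟩
    rw [← eLpNorm_two_sq] at h2
    rw [lt_top_iff_ne_top]
    rintro h3
    rw [h3] at h2
    simp at h2
  rw [← lintegral_enorm_sq_fourier_prod h1 h2']
  refine le_of_eq ?_
  have : (volume : Measure ((Fin m → ℝ) × (Fin n → ℝ))).IsNegInvariant :=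
    ⟨((Measure.measurePreserving_neg volume).prod (Measure.measurePreserving_neg volume)).map_eq⟩
  conv_rhs => rw [← lintegral_neg_eq_self]
  simp [neg_dotProduct, neg_add_rev, add_comm]

/-! ### Integration over tilings -/

section Tilings

theorem lintegral_eq_tsum_of_tiling {α ι : Type*} [MeasurableSpace α] [Countable ι]
    {μ : Measure α} {R : ι → α → α} {S : ι → Set α} {D : Set α}
    (hS : ∀ i, MeasurableSet (S i)) (hdisj : Pairwise (Function.onFun Disjoint S))
    (hcover : ⋃ i, S i = Set.univ) (hR : ∀ i, MeasurePreserving (R i) μ μ)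
    (hD : ∀ i, R i ⁻¹' S i = D) {F : α → ℝ≥0∞} (hF : Measurable F) :
    ∫⁻ x, F x ∂μ = ∑' i, ∫⁻ x in D, F (R i x) ∂μ := by
  rw [← setLIntegral_univ, ← hcover, lintegral_iUnion hS hdisj]
  refine tsum_congr fun i => ?_
  rw [← hD i, (hR i).setLIntegral_comp_preimage (hS i) hF]

/-- The half-open box `∏ [0, 1 / c_j)`. -/
def box {n : ℕ} (c : Fin n → ℝ) : Set (Fin n → ℝ) := {x | ∀ j, ⌊c j * x j⌋ = 0}

theorem measurableSet_floor_eq {α : Type*} [MeasurableSpace α] {n : ℕ} {f : α → Fin n → ℝ}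
    (hf : Measurable f) (c : Fin n → ℝ) (m : Fin n → ℤ) :
    MeasurableSet {x | ∀ j, ⌊c j * f x j⌋ = m j} := by
  rw [Set.ofPred_forall]
  refine MeasurableSet.iInter fun j => ?_
  exact (Int.measurable_floor.comp (((measurable_pi_apply j).comp hf).const_mul (c j)))
    (measurableSet_singleton (m j))

theorem measurableSet_box {n : ℕ} (c : Fin n → ℝ) : MeasurableSet (box c) :=
  measurableSet_floor_eq measurable_id c 0

theorem volume_box {n : ℕ} {c : Fin n → ℝ} (hc : ∀ j, 0 < c j) :
    volume (box c) = ENNReal.ofReal (∏ j, c j)⁻¹ := by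
  have h : box c = Set.pi Set.univ fun j => Set.Ico 0 (c j)⁻¹ := by
    ext x
    simp only [box, Set.mem_ofPred_eq, Set.mem_pi, Set.mem_univ, true_imp_iff, Set.mem_Ico,
      Int.floor_eq_zero_iff]
    refine forall_congr' fun j => and_congr ?_ ?_
    · exact mul_nonneg_iff_of_pos_left (hc j)
    · rw [← one_div, lt_div_iff₀' (hc j)]
  rw [h, Real.volume_pi_Ico, ← ENNReal.ofReal_prod_of_nonneg, ← Finset.prod_inv_distrib]
  · simp
  · intro j _
    simpa using (hc j).le

theorem floor_mul_add_div {c : ℝ} (hc : 0 < c) (x : ℝ) (m : ℤ) :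
    ⌊c * (x + m / c)⌋ = m ↔ ⌊c * x⌋ = 0 := by
  rw [mul_add, mul_div_cancel₀ _ hc.ne', Int.floor_add_intCast]
  omega

theorem lintegral_eq_tsum_box {n : ℕ} {c : Fin n → ℝ} (hc : ∀ j, 0 < c j)
    {F : (Fin n → ℝ) → ℝ≥0∞} (hF : Measurable F) :
    ∫⁻ x, F x = ∑' m : Fin n → ℤ, ∫⁻ x in box c, F (x + fun j => m j / c j) := by
  refine lintegral_eq_tsum_of_tiling (S := fun m : Fin n → ℤ => {x | ∀ j, ⌊c j * x j⌋ = m j})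
    (fun m => measurableSet_floor_eq measurable_id c m) ?_ ?_
    (fun m => measurePreserving_add_right volume _) (fun m => ?_) hF
  · intro m m' hne
    refine Set.disjoint_left.2 fun x hx hx' => hne ?_
    ext j
    rw [← hx j, hx' j]
  · exact Set.eq_univ_of_forall fun x => Set.mem_iUnion.2 ⟨fun j => ⌊c j * x j⌋, fun j => rfl⟩
  · ext x
    simp only [Set.mem_preimage, Set.mem_ofPred_eq, box, Pi.add_apply, floor_mul_add_div (hc _)]

end Tilings

variable {𝔫 : Type u} [LieRing 𝔫] [LieAlgebra ℝ 𝔫] {r d : ℕ}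

/-! ### Structure constants, generic nondegeneracy and the tiling by the quasi-lattice -/

section Brackets

variable (e : AdaptedBasis 𝔫 r d)

theorem functional_eq_dotProduct (l : Fin r → ℝ) (u : 𝔫) :
    e.functional l u = l ⬝ᵥ fun i => e.basis.repr u (Sum.inl i) := rfl

theorem dotProduct_bracketXY (l : Fin r → ℝ) (x y : Fin d → ℝ) :
    l ⬝ᵥ NilGroup.bracketXY e x y = -(x ⬝ᵥ (e.B l *ᵥ y)) := by
  have hB : ∀ i j, (e.B l) i j = -e.functional l
    ⁅e.basis (Sum.inr (Sum.inr i)), e.basis (Sum.inr (Sum.inl j))⁆ := fun i j => rfl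
  have hs : NilGroup.bracketXY e x y = fun k => ∑ i, ∑ j, x i * y j *
      e.basis.repr ⁅e.basis (Sum.inr (Sum.inr i)), e.basis (Sum.inr (Sum.inl j))⁆ (Sum.inl k) := by
    ext k
    simp [NilGroup.bracketXY, AdaptedBasis.X, AdaptedBasis.Y, sum_lie, lie_sum,
      Finsupp.finsetSum_apply, Finset.mul_sum, mul_assoc, mul_left_comm]
    rw [Finset.sum_comm]
  rw [hs]
  simp only [dotProduct, Matrix.mulVec, hB, AdaptedBasis.functional, Finset.mul_sum,
    neg_mul, Finset.sum_neg_distrib, mul_neg, neg_neg, Finset.sum_mul]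
  rw [Finset.sum_comm]
  refine Finset.sum_congr rfl fun i _ => ?_
  rw [Finset.sum_comm]
  refine Finset.sum_congr rfl fun j _ => Finset.sum_congr rfl fun k _ => ?_
  ring

/-- Restrict the generic functional to the center. A kernel vector `y` of its matrix would make `Y
y` lie in the stabilizer, hence in the center, where all `Y`-coordinates vanish. -/
theorem exists_det_B_ne_zero : ∃ l, (e.B l).det ≠ 0 := by
  obtain ⟨L, hL⟩ := e.generic
  refine ⟨fun i => L (e.basis (Sum.inl i)), fun hdet => ?_⟩
  obtain ⟨y, hy0, hy⟩ := Matrix.exists_mulVec_eq_zero_iff.2 hdet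
  have hcen : e.Y y ∈ LieAlgebra.center ℝ 𝔫 := by
    refine hL _ fun v => ?_
    rw [NilGroup.eq_Z_add_Y_add_X e v]
    set x : Fin d → ℝ := fun i => e.basis.repr v (Sum.inr (Sum.inr i))
    rw [lie_add, lie_add, NilGroup.central_lie (NilGroup.Z_central e _), NilGroup.lie_Y_Y,
      zero_add, zero_add, ← lie_skew, map_neg, ← NilGroup.Z_bracketXY, neg_eq_zero]
    have h := dotProduct_bracketXY e (fun i => L (e.basis (Sum.inl i))) x y
    rw [hy, dotProduct_zero, neg_zero] at h
    rw [← h]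
    simp [AdaptedBasis.Z, dotProduct, mul_comm]
  refine hy0 ?_
  ext j
  have h := NilGroup.repr_central e hcen (Sum.inl j)
  simpa [AdaptedBasis.Y, Finsupp.single_apply] using h

theorem B_add_smul (l l' : Fin r → ℝ) (s : ℝ) : e.B (l + s • l') = s • e.B l' + e.B l := by
  ext i j
  simp only [AdaptedBasis.B, Matrix.of_apply, Matrix.add_apply, Matrix.smul_apply,
    functional_eq_dotProduct, add_dotProduct, smul_dotProduct, smul_eq_mul]
  ring

@[fun_prop] theorem continuous_B : Continuous e.B := by
  refine continuous_matrix fun i j => ?_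
  simp only [AdaptedBasis.B, Matrix.of_apply, functional_eq_dotProduct]
  fun_prop

@[fun_prop] theorem continuous_det_B : Continuous fun l => (e.B l).det :=
  (continuous_B e).matrix_det

open Polynomial in
-- Along every line in the direction of a nondegenerate `l₀`, the determinant is a polynomial in the
-- parameter whose coefficient of degree `d` is `det B(l₀) ≠ 0`. It has finitely many zeros on each
-- such line, and Fubini in that direction finishes.
theorem ae_det_B_ne_zero : ∀ᵐ l, (e.B l).det ≠ 0 := by
  obtain ⟨l₀, h₀⟩ := exists_det_B_ne_zero e
  have hms : MeasurableSet {l | (e.B l).det ≠ 0} :=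
    (isOpen_ne.preimage (continuous_det_B e)).measurableSet
  refine ae_mem_of_ae_add_linearMap_mem (s := {l | (e.B l).det ≠ 0})
    (LinearMap.toSpanSingleton ℝ _ l₀) volume volume hms fun l => ?_
  set p : ℝ[X] := ((X : ℝ[X]) • (e.B l₀).map C + (e.B l).map C).det with hp
  have hp0 : p ≠ 0 := by
    intro h
    have h1 := Polynomial.coeff_det_X_add_C_card (e.B l₀) (e.B l)
    rw [← hp, h] at h1
    exact h₀ (by simpa using h1.symm)
  have hev : ∀ s, p.eval s = (e.B (l + s • l₀)).det := by
    intro s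
    rw [hp, ← Polynomial.coe_evalRingHom, RingHom.map_det, B_add_smul]
    congr 1
    ext i j
    simp only [RingHom.mapMatrix_apply, Matrix.map_apply, Matrix.add_apply, Matrix.smul_apply,
      smul_eq_mul, map_add, Polynomial.eval_mul, Polynomial.coe_evalRingHom, Polynomial.eval_X,
      Polynomial.eval_C]
  have hfin : ((p.roots.toFinset : Set ℝ))ᶜ ∈ ae (volume : Measure ℝ) :=
    compl_mem_ae_iff.2 ((Finset.finite_toSet _).measure_zero _)
  filter_upwards [hfin] with s hs
  change (e.B (l + s • l₀)).det ≠ 0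
  rw [← hev]
  simpa [hp0] using hs

theorem continuous_bracketXY : Continuous fun p : (Fin d → ℝ) × (Fin d → ℝ) =>
    NilGroup.bracketXY e p.1 p.2 := by
  refine continuous_pi fun i => ?_
  simp only [NilGroup.bracketXY, AdaptedBasis.X, AdaptedBasis.Y, sum_lie, lie_sum, lie_smul,
    smul_lie, map_sum, map_smul, Finsupp.coe_finsetSum, Finset.sum_apply, Finsupp.smul_apply]
  fun_prop

@[fun_prop] theorem measurable_bracketXY_comp {α : Type*} [MeasurableSpace α]
    {f g : α → Fin d → ℝ} (hf : Measurable f) (hg : Measurable g) :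
    Measurable fun a => NilGroup.bracketXY e (f a) (g a) :=
  (continuous_bracketXY e).measurable.comp (hf.prodMk hg)

/-- Right multiplication in coordinates. -/
def coordMul (p p' : (Fin r → ℝ) × (Fin d → ℝ) × (Fin d → ℝ)) :
    (Fin r → ℝ) × (Fin d → ℝ) × (Fin d → ℝ) :=
  (p.1 + p'.1 + NilGroup.bracketXY e p.2.2 p'.2.1, p.2.1 + p'.2.1, p.2.2 + p'.2.2)

theorem measurePreserving_coordMul_right (p' : (Fin r → ℝ) × (Fin d → ℝ) × (Fin d → ℝ)) :
    MeasurePreserving fun p => coordMul e p p' := by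
  have hskew : MeasurePreserving
      (fun w : ((Fin d → ℝ) × (Fin d → ℝ)) × (Fin r → ℝ) =>
        (w.1 + p'.2, w.2 + p'.1 + NilGroup.bracketXY e w.1.2 p'.2.1))
      (volume.prod volume) (volume.prod volume) := by
    have hadd : MeasurePreserving (fun w : (Fin d → ℝ) × (Fin d → ℝ) => w + p'.2)
        volume volume :=
      (measurePreserving_add_right volume p'.2.1).prod (measurePreserving_add_right volume p'.2.2)
    refine hadd.skew_product
      (g := fun w z => z + p'.1 + NilGroup.bracketXY e w.2 p'.2.1) (by fun_prop) ?_
    refine Eventually.of_forall fun w => ?_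
    exact ((measurePreserving_add_right volume (NilGroup.bracketXY e w.2 p'.2.1)).comp
      (measurePreserving_add_right volume p'.1)).map_eq
  exact (Measure.measurePreserving_swap (μ := (volume : Measure ((Fin d → ℝ) × (Fin d → ℝ))))
    (ν := (volume : Measure (Fin r → ℝ)))).comp (hskew.comp (Measure.measurePreserving_swap
    (μ := (volume : Measure (Fin r → ℝ)))
    (ν := (volume : Measure ((Fin d → ℝ) × (Fin d → ℝ))))))

/-- The coordinates of the points of a quasi-lattice. -/
def latticePoint (a : Fin r → ℝ) (q b : Fin d → ℝ)
    (i : (Fin r → ℤ) × (Fin d → ℤ) × (Fin d → ℤ)) : (Fin r → ℝ) × (Fin d → ℝ) × (Fin d → ℝ) :=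
  (fun j => i.1 j / a j, fun j => i.2.1 j / q j, fun j => i.2.2 j / b j)

/-- The tiles are the right translates of the box by lattice points. The floors of the `y` and `x`
coordinates determine `k` and `n`; subtracting the bracket created by that product then exposes `m`
as a floor in the central coordinate. No group property of the quasi-lattice is needed. -/
theorem lintegral_eq_tsum_latticePoint {a : Fin r → ℝ} {q b : Fin d → ℝ} (ha : ∀ j, 0 < a j)
    (hq : ∀ j, 0 < q j) (hb : ∀ j, 0 < b j)
    {F : (Fin r → ℝ) × (Fin d → ℝ) × (Fin d → ℝ) → ℝ≥0∞} (hF : Measurable F) :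
    ∫⁻ p, F p = ∑' i, ∫⁻ p in box a ×ˢ box q ×ˢ box b, F (coordMul e p (latticePoint a q b i)) := by
  let y : (Fin d → ℤ) → Fin d → ℝ := fun k j => k j / q j
  let x : (Fin d → ℤ) → Fin d → ℝ := fun k j => k j / b j
  refine lintegral_eq_tsum_of_tiling
    (S := fun i : (Fin r → ℤ) × (Fin d → ℤ) × (Fin d → ℤ) =>
      {p | ∀ j, ⌊a j * (p.1 - NilGroup.bracketXY e (p.2.2 - x i.2.2) (y i.2.1)) j⌋ = i.1 j} ∩
      ({p | ∀ j, ⌊q j * p.2.1 j⌋ = i.2.1 j} ∩ {p | ∀ j, ⌊b j * p.2.2 j⌋ = i.2.2 j}))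
    (fun i => ?_) ?_ ?_ (fun i => measurePreserving_coordMul_right e _) (fun i => ?_) hF
  · refine (measurableSet_floor_eq (by fun_prop) a _).inter
      ((measurableSet_floor_eq (by fun_prop) q _).inter (measurableSet_floor_eq (by fun_prop) b _))
  · rintro i i' hne
    refine Set.disjoint_left.2 fun p hp hp' => hne ?_
    obtain ⟨hz, hy, hx⟩ := hp
    obtain ⟨hz', hy', hx'⟩ := hp'
    have h1 : i.2.1 = i'.2.1 := by ext j; rw [← hy j, hy' j]
    have h2 : i.2.2 = i'.2.2 := by ext j; rw [← hx j, hx' j]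
    refine Prod.ext ?_ (Prod.ext h1 h2)
    ext j
    rw [← hz j, ← hz' j, h1, h2]
  · refine Set.eq_univ_of_forall fun p => Set.mem_iUnion.2
      ⟨⟨fun j => ⌊a j * (p.1 - NilGroup.bracketXY e (p.2.2 - x fun j => ⌊b j * p.2.2 j⌋)
        (y fun j => ⌊q j * p.2.1 j⌋)) j⌋, fun j => ⌊q j * p.2.1 j⌋, fun j => ⌊b j * p.2.2 j⌋⟩,
        fun j => rfl, fun j => rfl, fun j => rfl⟩
  · ext p
    have hz : (coordMul e p (latticePoint a q b i)).1 - NilGroup.bracketXY e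
        ((coordMul e p (latticePoint a q b i)).2.2 - x i.2.2) (y i.2.1) =
        p.1 + fun j => i.1 j / a j := by
      simp [coordMul, latticePoint, x, y]
    simp only [Set.mem_preimage, Set.mem_inter_iff, Set.mem_ofPred_eq, Set.mem_prod, box, hz]
    simp only [coordMul, latticePoint, Pi.add_apply, floor_mul_add_div (ha _),
      floor_mul_add_div (hq _), floor_mul_add_div (hb _)]

end Brackets

/-- The parameter space of coordinates on `N`, which is also the space on which the integral
kernels of fields of Hilbert-Schmidt operators live. -/
abbrev Coords (r d : ℕ) : Type := (Fin r → ℝ) × (Fin d → ℝ) × (Fin d → ℝ)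

/-! ### Straightening the Plancherel measure -/

section KernelCoordinates

variable (e : AdaptedBasis 𝔫 r d)

instance : SFinite (plancherelMeasure e) := by unfold plancherelMeasure; infer_instance

theorem measurable_vecMul_B : Measurable fun p : (Fin r → ℝ) × (Fin d → ℝ) => p.2 ᵥ* e.B p.1 :=
  (continuous_snd.matrix_vecMul ((continuous_B e).comp continuous_fst)).measurable

theorem lintegral_plancherelMeasure {F : (Fin r → ℝ) → ℝ≥0∞} (hF : Measurable F) :
    ∫⁻ l, F l ∂plancherelMeasure e = ∫⁻ l, ENNReal.ofReal |(e.B l).det| * F l := by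
  rw [plancherelMeasure, lintegral_withDensity_eq_lintegral_mul _
    (continuous_det_B e).measurable.abs.ennreal_ofReal hF]
  rfl

theorem lintegral_comp_vecMul {M : Matrix (Fin d) (Fin d) ℝ} (hM : M.det ≠ 0)
    {F : (Fin d → ℝ) → ℝ≥0∞} (hF : Measurable F) :
    ENNReal.ofReal |M.det| * ∫⁻ t, F (t ᵥ* M) = ∫⁻ t, F t := by
  have hT : Mᵀ.det ≠ 0 := by rwa [Matrix.det_transpose]
  have h := Real.map_matrix_volume_pi_eq_smul_volume_pi hT
  have hm : Measurable (Matrix.toLin' Mᵀ) :=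
    (Matrix.toLin' Mᵀ).continuous_of_finiteDimensional.measurable
  have h2 := lintegral_map (μ := volume) hF hm
  rw [h, lintegral_smul_measure] at h2
  simp only [Matrix.toLin'_apply, Matrix.mulVec_transpose, Matrix.det_transpose] at h2
  rw [← h2, smul_eq_mul, ← mul_assoc, ← ENNReal.ofReal_mul (abs_nonneg _), ← abs_mul,
    mul_inv_cancel₀ hM, abs_one, ENNReal.ofReal_one, one_mul]

/-- The density `|det B(l)|` of the Plancherel measure is exactly the Jacobian of `t ↦ t B(l)`,
which is invertible for almost every `l`. -/
theorem measurePreserving_vecMul_B :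
    MeasurePreserving (fun p : (Fin r → ℝ) × (Fin d → ℝ) => (p.1, p.2 ᵥ* e.B p.1))
      ((plancherelMeasure e).prod volume) volume := by
  have hm : Measurable (fun p : (Fin r → ℝ) × (Fin d → ℝ) => (p.1, p.2 ᵥ* e.B p.1)) :=
    measurable_fst.prodMk (measurable_vecMul_B e)
  refine ⟨hm, Measure.ext_of_lintegral _ fun F hF => ?_⟩
  rw [lintegral_map hF hm]
  refine (lintegral_prod _ (hF.comp hm).aemeasurable).trans ?_
  refine Eq.trans ?_ (lintegral_prod _ hF.aemeasurable).symm
  refine (lintegral_plancherelMeasure e (hF.comp hm).lintegral_prod_right').trans ?_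
  refine lintegral_congr_ae ?_
  filter_upwards [ae_det_B_ne_zero e] with l hl
  exact lintegral_comp_vecMul hl (F := fun t => F (l, t)) (by fun_prop)

/-- The change of variables `(l, t, s) ↦ ((l, t B(l)), t - s)`. -/
def kernelCoords (p : Coords r d) : ((Fin r → ℝ) × (Fin d → ℝ)) × (Fin d → ℝ) :=
  ((p.1, p.2.1 ᵥ* e.B p.1), p.2.1 - p.2.2)

theorem measurePreserving_prod_sub_right :
    MeasurePreserving (fun p : (Fin d → ℝ) × (Fin d → ℝ) => (p.1, p.1 - p.2)) := by
  refine (MeasurePreserving.id volume).skew_product (g := fun t s => t - s) (by fun_prop) ?_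
  exact Eventually.of_forall fun t => (Measure.measurePreserving_sub_left volume t).map_eq

/-- In these coordinates the measure on kernels is Lebesgue measure, so Euclidean Plancherel becomes
Plancherel on `N`. -/
theorem measurePreserving_kernelCoords :
    MeasurePreserving (kernelCoords e) ((plancherelMeasure e).prod volume) volume := by
  have h1 : MeasurePreserving (Prod.map id fun p : (Fin d → ℝ) × (Fin d → ℝ) => (p.1, p.1 - p.2))
      ((plancherelMeasure e).prod volume) ((plancherelMeasure e).prod (volume.prod volume)) :=
    (MeasurePreserving.id _).prod measurePreserving_prod_sub_right
  have h2 := MeasurePreserving.symm _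
    (measurePreserving_prodAssoc (plancherelMeasure e) (volume : Measure (Fin d → ℝ))
      (volume : Measure (Fin d → ℝ)))
  have h3 := (measurePreserving_vecMul_B e).prod (MeasurePreserving.id (volume : Measure (Fin d → ℝ)))
  exact h3.comp (h2.comp h1)

end KernelCoordinates

/-! ### The partial Fourier transform in the central and `y` variables -/

section PartialFourier

/-- The partial Fourier transform in the variables `(z, y)`. -/
def partialFourier (g : Coords r d → ℂ) (p : ((Fin r → ℝ) × (Fin d → ℝ)) × (Fin d → ℝ)) : ℂ :=
  ∫ v : (Fin r → ℝ) × (Fin d → ℝ), expi (p.1.1 ⬝ᵥ v.1 + p.1.2 ⬝ᵥ v.2) * g (v.1, v.2, p.2)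

/-- Reordering of coordinates. -/
theorem measurePreserving_assoc : MeasurePreserving
    (fun p : ((Fin r → ℝ) × (Fin d → ℝ)) × (Fin d → ℝ) => ((p.1.1, p.1.2, p.2) : Coords r d)) :=
  volume_preserving_prodAssoc

theorem measurableEmbedding_assoc : MeasurableEmbedding
    (fun p : ((Fin r → ℝ) × (Fin d → ℝ)) × (Fin d → ℝ) => ((p.1.1, p.1.2, p.2) : Coords r d)) :=
  MeasurableEquiv.prodAssoc.measurableEmbedding

theorem ae_slice {g : Coords r d → Prop} (h : ∀ᵐ p, g p) :
    ∀ᵐ x : Fin d → ℝ, ∀ᵐ v : (Fin r → ℝ) × (Fin d → ℝ), g (v.1, v.2, x) := by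
  have h1 := (measurePreserving_assoc (r := r) (d := d)).quasiMeasurePreserving.ae h
  have h2 := (Measure.measurePreserving_swap (μ := (volume : Measure (Fin d → ℝ)))
    (ν := (volume : Measure ((Fin r → ℝ) × (Fin d → ℝ))))).quasiMeasurePreserving.ae h1
  exact Measure.ae_ae_of_ae_prod h2

/-- For almost every `x` the slices agree almost everywhere, so the integrals agree at every
frequency; the exceptional set depends on `x` alone. -/
theorem partialFourier_congr_ae {g g' : Coords r d → ℂ} (h : g =ᵐ[volume] g') :
    partialFourier g =ᵐ[volume] partialFourier g' := by
  have h1 : ∀ᵐ x : Fin d → ℝ, ∀ w : (Fin r → ℝ) × (Fin d → ℝ),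
      partialFourier g (w, x) = partialFourier g' (w, x) := by
    filter_upwards [ae_slice h] with x hx w
    refine integral_congr_ae ?_
    filter_upwards [hx] with v hv
    simp only [hv]
  have h2 := (Measure.quasiMeasurePreserving_snd
    (μ := (volume : Measure ((Fin r → ℝ) × (Fin d → ℝ))))
    (ν := (volume : Measure (Fin d → ℝ)))).ae h1
  filter_upwards [h2] with p hp
  exact hp p.1

theorem stronglyMeasurable_partialFourier {g : Coords r d → ℂ} (hg : StronglyMeasurable g) :
    StronglyMeasurable (partialFourier g) := by
  refine StronglyMeasurable.integral_prod_right ?_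
  refine StronglyMeasurable.mul (Measurable.stronglyMeasurable ?_) (hg.comp_measurable (by fun_prop))
  have : Continuous fun p : (((Fin r → ℝ) × (Fin d → ℝ)) × (Fin d → ℝ)) ×
      ((Fin r → ℝ) × (Fin d → ℝ)) => expi (p.1.1.1 ⬝ᵥ p.2.1 + p.1.1.2 ⬝ᵥ p.2.2) := by fun_prop
  exact this.measurable

theorem aestronglyMeasurable_partialFourier {g : Coords r d → ℂ}
    (hg : AEStronglyMeasurable g volume) : AEStronglyMeasurable (partialFourier g) volume :=
  ⟨_, stronglyMeasurable_partialFourier hg.stronglyMeasurable_mk,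
    partialFourier_congr_ae hg.ae_eq_mk⟩

theorem lintegral_slices {F : Coords r d → ℝ≥0∞} (hF : AEMeasurable F volume) :
    ∫⁻ x : Fin d → ℝ, ∫⁻ v : (Fin r → ℝ) × (Fin d → ℝ), F (v.1, v.2, x) = ∫⁻ p, F p := by
  have hm := measurePreserving_assoc (r := r) (d := d)
  rw [← hm.lintegral_comp_emb measurableEmbedding_assoc]
  exact (lintegral_prod_symm _ (hF.comp_quasiMeasurePreserving hm.quasiMeasurePreserving)).symm

theorem ae_integrable_slice {g : Coords r d → ℂ} (h : Integrable g) :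
    ∀ᵐ x : Fin d → ℝ, Integrable fun v : (Fin r → ℝ) × (Fin d → ℝ) => g (v.1, v.2, x) := by
  have h1 := ((measurePreserving_assoc (r := r) (d := d)).integrable_comp_emb
    measurableEmbedding_assoc).2 h
  exact Integrable.prod_left_ae h1

theorem ae_memLp_slice {g : Coords r d → ℂ} (h : MemLp g 2) :
    ∀ᵐ x : Fin d → ℝ, MemLp (fun v : (Fin r → ℝ) × (Fin d → ℝ) => g (v.1, v.2, x)) 2 := by
  have h1 : Integrable fun p => ‖g p‖ ^ 2 := h.integrable_norm_pow two_ne_zero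
  have h2 : AEStronglyMeasurable (fun p : (Fin d → ℝ) × ((Fin r → ℝ) × (Fin d → ℝ)) =>
      g (p.2.1, p.2.2, p.1)) (volume.prod volume) :=
    (h.1.comp_measurePreserving (measurePreserving_assoc (r := r) (d := d))).comp_measurePreserving
      (Measure.measurePreserving_swap (μ := (volume : Measure (Fin d → ℝ)))
      (ν := (volume : Measure ((Fin r → ℝ) × (Fin d → ℝ)))))
  have h3 := ((measurePreserving_assoc (r := r) (d := d)).integrable_comp_emb
    measurableEmbedding_assoc).2 h1
  filter_upwards [Integrable.prod_left_ae h3, h2.prodMk_left] with x hx hx'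
  exact (memLp_two_iff_integrable_sq_norm hx').2 hx

theorem lintegral_enorm_sq_partialFourier {g : Coords r d → ℂ} (h1 : Integrable g)
    (h2 : MemLp g 2) : ∫⁻ p, ‖partialFourier g p‖ₑ ^ 2 = ∫⁻ p, ‖g p‖ₑ ^ 2 := by
  have hm : AEMeasurable (fun p => ‖partialFourier g p‖ₑ ^ 2)
      ((volume : Measure ((Fin r → ℝ) × (Fin d → ℝ))).prod (volume : Measure (Fin d → ℝ))) :=
    (aestronglyMeasurable_partialFourier h1.1).enorm.pow_const 2
  have h3 := lintegral_prod_symm _ hm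
  have h4 := lintegral_slices (F := fun p => ‖g p‖ₑ ^ 2) (h1.1.enorm.pow_const 2)
  rw [← h4]
  refine Eq.trans h3 (lintegral_congr_ae ?_)
  filter_upwards [ae_integrable_slice h1, ae_memLp_slice h2] with x hx hx'
  simp only [partialFourier]
  exact lintegral_enorm_sq_fourier_prod hx hx'

end PartialFourier

/-! ### Integral kernels of the group Fourier transform -/

section FourierKernel

variable (e : AdaptedBasis 𝔫 r d)

/-- The integral kernels of the operators `∫ g(n) π_l(n) dn`, where `g` is given in coordinates. -/
def fourierKernel (g : Coords r d → ℂ) (p : Coords r d) : ℂ :=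
  partialFourier g (kernelCoords e p)

theorem fourierKernel_apply (g : Coords r d → ℂ) (l : Fin r → ℝ) (t s : Fin d → ℝ) :
    fourierKernel e g (l, t, s) = ∫ v : (Fin r → ℝ) × (Fin d → ℝ),
      expi (l ⬝ᵥ v.1 + t ⬝ᵥ (e.B l *ᵥ v.2)) * g (v.1, v.2, t - s) := by
  simp [fourierKernel, kernelCoords, partialFourier, Matrix.dotProduct_mulVec]

theorem fourierKernel_congr_ae {g g' : Coords r d → ℂ} (h : g =ᵐ[volume] g') :
    fourierKernel e g =ᵐ[(plancherelMeasure e).prod volume] fourierKernel e g' :=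
  (measurePreserving_kernelCoords e).quasiMeasurePreserving.ae (partialFourier_congr_ae h)

theorem aestronglyMeasurable_fourierKernel {g : Coords r d → ℂ}
    (hg : AEStronglyMeasurable g volume) :
    AEStronglyMeasurable (fourierKernel e g) ((plancherelMeasure e).prod volume) :=
  (aestronglyMeasurable_partialFourier hg).comp_measurePreserving (measurePreserving_kernelCoords e)

theorem lintegral_enorm_sq_fourierKernel {g : Coords r d → ℂ} (h1 : Integrable g)
    (h2 : MemLp g 2) :
    ∫⁻ p, ‖fourierKernel e g p‖ₑ ^ 2 ∂(plancherelMeasure e).prod volume = ∫⁻ p, ‖g p‖ₑ ^ 2 := by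
  rw [← lintegral_enorm_sq_partialFourier h1 h2]
  have h := ((aestronglyMeasurable_partialFourier h1.1).enorm.pow_const 2)
  rw [← (measurePreserving_kernelCoords e).map_eq] at h
  rw [← (measurePreserving_kernelCoords e).map_eq, lintegral_map' h
    (measurePreserving_kernelCoords e).measurable.aemeasurable]
  rfl

theorem eLpNorm_fourierKernel {g : Coords r d → ℂ} (h1 : Integrable g) (h2 : MemLp g 2) :
    eLpNorm (fourierKernel e g) 2 ((plancherelMeasure e).prod volume) = eLpNorm g 2 volume := by
  have h := lintegral_enorm_sq_fourierKernel e h1 h2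
  rw [← eLpNorm_two_sq, ← eLpNorm_two_sq] at h
  exact (ENNReal.pow_right_strictMono two_ne_zero).injective h

theorem memLp_fourierKernel {g : Coords r d → ℂ} (h1 : Integrable g) (h2 : MemLp g 2) :
    MemLp (fourierKernel e g) 2 ((plancherelMeasure e).prod volume) :=
  ⟨aestronglyMeasurable_fourierKernel e h1.1, by rw [eLpNorm_fourierKernel e h1 h2]; exact h2.2⟩

end FourierKernel

/-! ### The weak operator integral and its kernel -/

section WeakIntegral

variable (e : AdaptedBasis 𝔫 r d)

theorem inner_L2_eq_integral {α : Type*} [MeasurableSpace α] {μ : Measure α} (u v : Lp ℂ 2 μ) :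
    inner ℂ u v = ∫ x, conj (u x) * v x ∂μ := by
  rw [L2.inner_def]
  refine integral_congr_ae (Eventually.of_forall fun x => ?_)
  simp [mul_comm]

theorem piPhase_eq (l : Fin r → ℝ) (p : Coords r d) (t : Fin d → ℝ) :
    piPhase e l p t = expi (l ⬝ᵥ p.1 + t ⬝ᵥ (e.B l *ᵥ p.2.1)) := rfl

theorem inner_piRep (l : Fin r → ℝ) (p : Coords r d) (χ ψ : L2 d) :
    inner ℂ χ (piRep e l (NilGroup.ofCoords e p) ψ) =
      ∫ t, conj (χ t) * (expi (l ⬝ᵥ p.1 + t ⬝ᵥ (e.B l *ᵥ p.2.1)) * ψ (t - p.2.2)) := by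
  rw [inner_L2_eq_integral]
  refine integral_congr_ae ?_
  filter_upwards [(memLp_pi e l (NilGroup.ofCoords e p).coords ψ).coeFn_toLp] with t ht
  rw [piRep, ht, NilGroup.coords_ofCoords, piPhase_eq]

theorem measurePreserving_regroup : MeasurePreserving
    (fun p : ((Fin d → ℝ) × (Fin d → ℝ)) × ((Fin r → ℝ) × (Fin d → ℝ)) =>
      ((p.1.1, (p.2.1, p.2.2, p.1.2)) : (Fin d → ℝ) × Coords r d))
    (volume.prod volume) (volume.prod volume) := by
  have h1 := measurePreserving_prodAssoc (volume : Measure (Fin d → ℝ))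
    (volume : Measure (Fin d → ℝ)) (volume : Measure ((Fin r → ℝ) × (Fin d → ℝ)))
  have h2 := (MeasurePreserving.id (volume : Measure (Fin d → ℝ))).prod
    ((measurePreserving_assoc (r := r) (d := d)).comp
      (Measure.measurePreserving_swap (μ := (volume : Measure (Fin d → ℝ)))
      (ν := (volume : Measure ((Fin r → ℝ) × (Fin d → ℝ))))))
  exact h2.comp h1

theorem measurableEmbedding_regroup : MeasurableEmbedding
    (fun p : ((Fin d → ℝ) × (Fin d → ℝ)) × ((Fin r → ℝ) × (Fin d → ℝ)) =>
      ((p.1.1, (p.2.1, p.2.2, p.1.2)) : (Fin d → ℝ) × Coords r d)) :=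
  (MeasurableEquiv.prodAssoc.trans (MeasurableEquiv.prodCongr (MeasurableEquiv.refl _)
    (MeasurableEquiv.prodComm.trans MeasurableEquiv.prodAssoc))).measurableEmbedding

theorem measurableEmbedding_prod_sub_right :
    MeasurableEmbedding (fun p : (Fin d → ℝ) × (Fin d → ℝ) => (p.1, p.1 - p.2)) :=
  (MeasurableEquiv.ofInvolutive (fun p : (Fin d → ℝ) × (Fin d → ℝ) => (p.1, p.1 - p.2))
    (fun p => by simp) (by fun_prop)).measurableEmbedding

/-- The bound does not depend on `x`; this uniformity lets an integrable `g` dominate the integrand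
in the Fubini argument for the weak operator integral. -/
theorem integrable_mul_translate (χ ψ : L2 d) (x : Fin d → ℝ) :
    Integrable (fun t => ‖χ t‖ * ‖ψ (t - x)‖) ∧
      ∫ t, ‖χ t‖ * ‖ψ (t - x)‖ ≤ (∫ t, ‖χ t‖ ^ 2) + ∫ t, ‖ψ t‖ ^ 2 := by
  have h1 : Integrable fun t => ‖χ t‖ ^ 2 := (Lp.memLp χ).integrable_norm_pow two_ne_zero
  have h2 : Integrable fun t => ‖ψ t‖ ^ 2 := (Lp.memLp ψ).integrable_norm_pow two_ne_zero
  have h3 : Integrable fun t => ‖ψ (t - x)‖ ^ 2 := h2.comp_sub_right x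
  have hle : ∀ t, ‖χ t‖ * ‖ψ (t - x)‖ ≤ ‖χ t‖ ^ 2 + ‖ψ (t - x)‖ ^ 2 := fun t => by
    nlinarith [sq_nonneg (‖χ t‖ - ‖ψ (t - x)‖), sq_nonneg ‖χ t‖, sq_nonneg ‖ψ (t - x)‖]
  have hi : Integrable (fun t => ‖χ t‖ * ‖ψ (t - x)‖) := by
    refine (h1.add h3).mono' ?_ (Eventually.of_forall fun t => ?_)
    · exact (Lp.stronglyMeasurable χ).norm.aestronglyMeasurable.mul
        ((Lp.stronglyMeasurable ψ).norm.comp_measurable (by fun_prop)).aestronglyMeasurable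
    · rw [Real.norm_of_nonneg (by positivity)]
      exact hle t
  refine ⟨hi, (integral_mono hi (h1.add h3) hle).trans (le_of_eq ?_)⟩
  have h4 : ∫ t, ‖ψ (t - x)‖ ^ 2 = ∫ t, ‖ψ t‖ ^ 2 :=
    integral_sub_right_eq_self (fun t => ‖ψ t‖ ^ 2) x
  rw [← h4]
  exact integral_add h1 h3

theorem integrable_weak_integrand {g : Coords r d → ℂ} (hg : Integrable g) (l : Fin r → ℝ)
    (χ ψ : L2 d) : Integrable (fun w : (Fin d → ℝ) × Coords r d =>
      conj (χ w.1) * (expi (l ⬝ᵥ w.2.1 + w.1 ⬝ᵥ (e.B l *ᵥ w.2.2.1)) * g w.2) *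
        ψ (w.1 - w.2.2.2)) (volume.prod volume) := by
  have hcont : Continuous fun w : (Fin d → ℝ) × Coords r d =>
      expi (l ⬝ᵥ w.2.1 + w.1 ⬝ᵥ (e.B l *ᵥ w.2.2.1)) := by fun_prop
  have hmeas : AEStronglyMeasurable (fun w : (Fin d → ℝ) × Coords r d =>
      conj (χ w.1) * (expi (l ⬝ᵥ w.2.1 + w.1 ⬝ᵥ (e.B l *ᵥ w.2.2.1)) * g w.2) *
        ψ (w.1 - w.2.2.2)) (volume.prod volume) := by
    refine AEStronglyMeasurable.mul (AEStronglyMeasurable.mul ?_ (AEStronglyMeasurable.mul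
      hcont.aestronglyMeasurable hg.1.comp_snd)) ?_
    · exact (Complex.continuous_conj.comp_stronglyMeasurable
        ((Lp.stronglyMeasurable χ).comp_measurable measurable_fst)).aestronglyMeasurable
    · exact ((Lp.stronglyMeasurable ψ).comp_measurable (by fun_prop)).aestronglyMeasurable
  have hnorm : ∀ (t : Fin d → ℝ) (p : Coords r d),
      ‖conj (χ t) * (expi (l ⬝ᵥ p.1 + t ⬝ᵥ (e.B l *ᵥ p.2.1)) * g p) * ψ (t - p.2.2)‖ =
        ‖g p‖ * (‖χ t‖ * ‖ψ (t - p.2.2)‖) := fun t p => by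
    simp only [norm_mul, norm_expi, one_mul, RCLike.norm_conj]
    ring
  rw [integrable_prod_iff' hmeas]
  constructor
  · filter_upwards [hmeas.prodMk_right] with p hp
    refine ((integrable_mul_translate χ ψ p.2.2).1.const_mul ‖g p‖).mono' hp
      (Eventually.of_forall fun t => (hnorm t p).le)
  · refine (hg.norm.mul_const ((∫ t, ‖χ t‖ ^ 2) + ∫ t, ‖ψ t‖ ^ 2)).mono'
      hmeas.norm.prod_swap.integral_prod_right' (Eventually.of_forall fun p => ?_)
    simp only [hnorm, integral_const_mul]
    rw [Real.norm_of_nonneg (mul_nonneg (norm_nonneg _)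
      (integral_nonneg fun t => by positivity))]
    exact mul_le_mul_of_nonneg_left (integrable_mul_translate χ ψ p.2.2).2 (norm_nonneg _)

/-- Fubini together with the substitution `s = t - x`. The identity holds for every `l`, not just
almost every one. -/
theorem integral_fourierKernel {g : Coords r d → ℂ} (hg : Integrable g) (l : Fin r → ℝ)
    (χ ψ : L2 d) :
    ∫ p : (Fin d → ℝ) × (Fin d → ℝ), conj (χ p.1) * fourierKernel e g (l, p) * ψ p.2 =
      ∫ p, g p * inner ℂ χ (piRep e l (NilGroup.ofCoords e p) ψ) := by
  have hW := integrable_weak_integrand e hg l χ ψ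
  set W := fun w : (Fin d → ℝ) × Coords r d =>
      conj (χ w.1) * (expi (l ⬝ᵥ w.2.1 + w.1 ⬝ᵥ (e.B l *ᵥ w.2.2.1)) * g w.2) *
        ψ (w.1 - w.2.2.2) with hWdef
  have hW2 := (measurePreserving_regroup.integrable_comp_emb measurableEmbedding_regroup).2 hW
  have h1 : ∫ p, g p * inner ℂ χ (piRep e l (NilGroup.ofCoords e p) ψ) =
      ∫ w, W w ∂(volume.prod volume) := by
    rw [integral_prod_symm _ hW]
    refine integral_congr_ae (Eventually.of_forall fun p => ?_)
    simp only [inner_piRep, ← integral_const_mul, hWdef]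
    congr 1
    ext t
    ring
  have h2 : ∫ w, W w ∂(volume.prod volume) =
      ∫ p : (Fin d → ℝ) × (Fin d → ℝ), ∫ v : (Fin r → ℝ) × (Fin d → ℝ),
        W (p.1, (v.1, v.2, p.2)) := by
    rw [← measurePreserving_regroup.integral_comp measurableEmbedding_regroup]
    exact integral_prod _ hW2
  rw [h1, h2, ← measurePreserving_prod_sub_right.integral_comp measurableEmbedding_prod_sub_right]
  refine integral_congr_ae (Eventually.of_forall fun p => ?_)
  obtain ⟨t, s⟩ := p
  simp only [hWdef, fourierKernel_apply, sub_sub_cancel]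
  rw [← integral_const_mul, ← integral_mul_const]

end WeakIntegral

/-! ### A kernel is determined by its matrix coefficients -/

section Uniqueness

/-- Indicators of finite-measure sets as `ψ` and `χ` give equal integrals over rectangles.
Rectangles form a generating π-system, and the restriction to squares of finite measure makes the
`L²` kernels integrable, so Dynkin's argument applies on each square. -/
theorem ae_eq_of_forall_integral_rankOne {α : Type*} [MeasurableSpace α] {μ : Measure α}
    [SigmaFinite μ] {H₁ H₂ : α × α → ℂ} (h₁ : MemLp H₁ 2 (μ.prod μ)) (h₂ : MemLp H₂ 2 (μ.prod μ))
    (h : ∀ ψ χ : Lp ℂ 2 μ, ∫ p, conj (χ p.1) * H₁ p * ψ p.2 ∂μ.prod μ =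
      ∫ p, conj (χ p.1) * H₂ p * ψ p.2 ∂μ.prod μ) : H₁ =ᵐ[μ.prod μ] H₂ := by
  let D : ℕ → Set α := spanningSets μ
  have hDm : ∀ n, MeasurableSet (D n) := measurableSet_spanningSets μ
  have hDf : ∀ n, μ (D n) < ∞ := measure_spanningSets_lt_top μ
  have hrect : ∀ n, ∀ A B : Set α, MeasurableSet A → MeasurableSet B →
      ∫ p in (A ×ˢ B) ∩ (D n ×ˢ D n), H₁ p ∂μ.prod μ =
      ∫ p in (A ×ˢ B) ∩ (D n ×ˢ D n), H₂ p ∂μ.prod μ := by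
    intro n A B hA hB
    have hA' : MeasurableSet (A ∩ D n) := hA.inter (hDm n)
    have hB' : MeasurableSet (B ∩ D n) := hB.inter (hDm n)
    have hAf : μ (A ∩ D n) ≠ ∞ := (measure_lt_top_of_subset Set.inter_subset_right (hDf n).ne).ne
    have hBf : μ (B ∩ D n) ≠ ∞ := (measure_lt_top_of_subset Set.inter_subset_right (hDf n).ne).ne
    have key : ∀ H : α × α → ℂ, ∫ p in (A ×ˢ B) ∩ (D n ×ˢ D n), H p ∂μ.prod μ =
        ∫ p, conj (indicatorConstLp 2 hA' hAf (1 : ℂ) p.1) * H p *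
          (indicatorConstLp 2 hB' hBf (1 : ℂ) p.2) ∂μ.prod μ := by
      intro H
      rw [Set.prod_inter_prod, ← integral_indicator (hA'.prod hB')]
      refine integral_congr_ae ?_
      have e1 := (Measure.quasiMeasurePreserving_fst (μ := μ) (ν := μ)).ae
        (indicatorConstLp_coeFn (p := 2) (hs := hA') (hμs := hAf) (c := (1 : ℂ)))
      have e2 := (Measure.quasiMeasurePreserving_snd (μ := μ) (ν := μ)).ae
        (indicatorConstLp_coeFn (p := 2) (hs := hB') (hμs := hBf) (c := (1 : ℂ)))
      filter_upwards [e1, e2] with p hp1 hp2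
      rw [hp1, hp2]
      by_cases h1 : p.1 ∈ A ∩ D n <;> by_cases h2 : p.2 ∈ B ∩ D n <;>
        simp [Set.indicator, h1, h2, Set.mem_prod]
    rw [key, key, h]
  have hfin : ∀ n, IsFiniteMeasure ((μ.prod μ).restrict (D n ×ˢ D n)) := fun n =>
    ⟨by rw [Measure.restrict_apply_univ, Measure.prod_prod]
        exact ENNReal.mul_lt_top (hDf n) (hDf n)⟩
  have hint : ∀ n, ∀ H : α × α → ℂ, MemLp H 2 (μ.prod μ) →
      Integrable H ((μ.prod μ).restrict (D n ×ˢ D n)) := fun n H hH =>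
    have := hfin n
    (hH.restrict _).integrable (by norm_num)
  have hall : ∀ n, ∀ s : Set (α × α), MeasurableSet s →
      ∫ p in s, H₁ p ∂(μ.prod μ).restrict (D n ×ˢ D n) =
      ∫ p in s, H₂ p ∂(μ.prod μ).restrict (D n ×ˢ D n) := by
    intro n s hs
    have i1 := hint n H₁ h₁
    have i2 := hint n H₂ h₂
    have hu : ∫ p, H₁ p ∂(μ.prod μ).restrict (D n ×ˢ D n) =
        ∫ p, H₂ p ∂(μ.prod μ).restrict (D n ×ˢ D n) := by
      simpa using hrect n Set.univ Set.univ .univ .univ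
    induction s, hs using MeasurableSpace.induction_on_inter generateFrom_prod.symm
      isPiSystem_prod with
    | empty => simp
    | basic s hs =>
      obtain ⟨A, hA, B, hB, rfl⟩ := hs
      have := hrect n A B hA hB
      rwa [← Measure.restrict_restrict (hA.prod hB)] at this
    | compl s hs ih =>
      have c1 := integral_add_compl hs i1
      have c2 := integral_add_compl hs i2
      rw [ih] at c1
      have := c1.trans (hu.trans c2.symm)
      exact add_left_cancel this
    | iUnion f hd hm ih =>
      rw [integral_iUnion hm hd i1.integrableOn, integral_iUnion hm hd i2.integrableOn]
      exact tsum_congr ih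
  have hn : ∀ n, ∀ᵐ p ∂(μ.prod μ), p ∈ D n ×ˢ D n → H₁ p = H₂ p := fun n =>
    (ae_restrict_iff' ((hDm n).prod (hDm n))).1
      (Integrable.ae_eq_of_forall_setIntegral_eq _ _ (hint n _ h₁) (hint n _ h₂)
        fun s hs _ => hall n s hs)
  filter_upwards [ae_all_iff.2 hn] with p hp
  have hmono : Monotone D := monotone_spanningSets μ
  obtain ⟨n, hn1⟩ := Set.mem_iUnion.1 ((iUnion_spanningSets μ).symm ▸ Set.mem_univ p.1)
  obtain ⟨m, hm1⟩ := Set.mem_iUnion.1 ((iUnion_spanningSets μ).symm ▸ Set.mem_univ p.2)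
  exact hp (max n m) ⟨hmono (le_max_left n m) hn1, hmono (le_max_right n m) hm1⟩

/-- Passing from iterated to joint almost everywhere equality needs a measurable equality set,
supplied by strongly measurable representatives. -/
theorem ae_eq_of_ae_ae_eq {α β E : Type*} [MeasurableSpace α] [MeasurableSpace β]
    [NormedAddCommGroup E] {μ : Measure α} {ν : Measure β} [SFinite μ] [SFinite ν]
    {F G : α × β → E} (hF : AEStronglyMeasurable F (μ.prod ν))
    (hG : AEStronglyMeasurable G (μ.prod ν))
    (h : ∀ᵐ a ∂μ, ∀ᵐ b ∂ν, F (a, b) = G (a, b)) : F =ᵐ[μ.prod ν] G := by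
  refine hF.ae_eq_mk.trans (EventuallyEq.trans ?_ hG.ae_eq_mk.symm)
  refine (Measure.ae_prod_iff_ae_ae ?_).2 ?_
  · exact hF.stronglyMeasurable_mk.measurableSet_eq_fun hG.stronglyMeasurable_mk
  · filter_upwards [h, Measure.ae_ae_of_ae_prod hF.ae_eq_mk,
      Measure.ae_ae_of_ae_prod hG.ae_eq_mk] with a h1 h2 h3
    filter_upwards [h1, h2, h3] with b h1 h2 h3
    rw [← h2, h1, h3]

theorem ae_memLp_two_of_prod {α β : Type*} [MeasurableSpace α] [MeasurableSpace β]
    {μ : Measure α} {ν : Measure β} [SFinite μ] [SFinite ν]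
    {F : α × β → ℂ} (hF : MemLp F 2 (μ.prod ν)) : ∀ᵐ a ∂μ, MemLp (fun b => F (a, b)) 2 ν := by
  have h1 : Integrable (fun p => ‖F p‖ ^ 2) (μ.prod ν) := hF.integrable_norm_pow two_ne_zero
  filter_upwards [h1.prod_right_ae, hF.1.prodMk_left] with a ha ha'
  exact (memLp_two_iff_integrable_sq_norm ha').2 ha

end Uniqueness

/-! ### Construction of the Plancherel isometry -/

section PlancherelTransform

variable (e : AdaptedBasis 𝔫 r d)

theorem measurePreserving_ofCoords :
    MeasurePreserving (NilGroup.ofCoords e) volume (NilGroup.haar e) :=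
  ⟨(NilGroup.coordsMeasurableEquiv e).symm.measurable, rfl⟩

theorem measurableEmbedding_ofCoords : MeasurableEmbedding (NilGroup.ofCoords e) :=
  (NilGroup.coordsMeasurableEquiv e).symm.measurableEmbedding

/-- A function on `N` in coordinates. -/
def inCoords (f : NilGroup e → ℂ) : Coords r d → ℂ := fun p => f (NilGroup.ofCoords e p)

theorem inCoords_congr_ae {f g : NilGroup e → ℂ} (h : f =ᵐ[NilGroup.haar e] g) :
    inCoords e f =ᵐ[volume] inCoords e g :=
  (measurePreserving_ofCoords e).quasiMeasurePreserving.ae h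

theorem integrable_inCoords {f : NilGroup e → ℂ} (h : Integrable f (NilGroup.haar e)) :
    Integrable (inCoords e f) :=
  (measurePreserving_ofCoords e).integrable_comp_of_integrable h

theorem memLp_inCoords (f : L2N e) : MemLp (inCoords e f) 2 :=
  (Lp.memLp f).comp_measurePreserving (measurePreserving_ofCoords e)

theorem isFourierTransform_iff (f : L2N e) (hf : Integrable f (NilGroup.haar e)) (G : L2Dual e) :
    IsFourierTransform e f G ↔
      G =ᵐ[(plancherelMeasure e).prod volume] fourierKernel e (inCoords e f) := by
  have hk := memLp_fourierKernel e (integrable_inCoords e hf) (memLp_inCoords e f)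
  have hint : ∀ l (ψ χ : L2 d), ∫ n, f n * inner ℂ χ (piRep e l n ψ) ∂NilGroup.haar e =
      ∫ p : (Fin d → ℝ) × (Fin d → ℝ),
        conj (χ p.1) * fourierKernel e (inCoords e f) (l, p) * ψ p.2 := by
    intro l ψ χ
    rw [integral_fourierKernel e (integrable_inCoords e hf),
      ← (measurePreserving_ofCoords e).integral_comp (measurableEmbedding_ofCoords e)]
    rfl
  constructor
  · intro h
    refine ae_eq_of_ae_ae_eq (Lp.aestronglyMeasurable G) hk.1 ?_
    filter_upwards [h, ae_memLp_two_of_prod (Lp.memLp G), ae_memLp_two_of_prod hk] with l hl h1 h2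
    refine ae_eq_of_forall_integral_rankOne h1 h2 fun ψ χ => ?_
    have := hl ψ χ
    rw [hint] at this
    exact this
  · intro h
    filter_upwards [Measure.ae_ae_of_ae_prod h] with l hl ψ χ
    rw [hint]
    refine integral_congr_ae ?_
    filter_upwards [hl] with p hp
    rw [hp]

theorem fourierKernel_add {g g' : Coords r d → ℂ} (h : Integrable g) (h' : Integrable g') :
    fourierKernel e (g + g') =ᵐ[(plancherelMeasure e).prod volume]
      fourierKernel e g + fourierKernel e g' := by
  have h1 : ∀ᵐ x : Fin d → ℝ, ∀ w : (Fin r → ℝ) × (Fin d → ℝ),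
      partialFourier (g + g') (w, x) = partialFourier g (w, x) + partialFourier g' (w, x) := by
    have hb : ∀ (w : (Fin r → ℝ) × (Fin d → ℝ)) {u : (Fin r → ℝ) × (Fin d → ℝ) → ℂ},
        Integrable u → Integrable fun v => expi (w.1 ⬝ᵥ v.1 + w.2 ⬝ᵥ v.2) * u v := by
      intro w u hu
      have hc : Continuous fun v : (Fin r → ℝ) × (Fin d → ℝ) =>
        expi (w.1 ⬝ᵥ v.1 + w.2 ⬝ᵥ v.2) := by fun_prop
      exact hu.bdd_mul hc.aestronglyMeasurable (Eventually.of_forall fun v => (norm_expi _).le)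
    filter_upwards [ae_integrable_slice h, ae_integrable_slice h'] with x hx hx' w
    simp only [partialFourier, Pi.add_apply, mul_add]
    exact integral_add (hb w hx) (hb w hx')
  have h2 := (Measure.quasiMeasurePreserving_snd
    (μ := (volume : Measure ((Fin r → ℝ) × (Fin d → ℝ))))
    (ν := (volume : Measure (Fin d → ℝ)))).ae h1
  have h3 := (measurePreserving_kernelCoords e).quasiMeasurePreserving.ae h2
  filter_upwards [h3] with p hp
  exact hp _

theorem fourierKernel_smul (c : ℂ) (g : Coords r d → ℂ) :
    fourierKernel e (c • g) = c • fourierKernel e g := by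
  ext p
  simp only [fourierKernel, partialFourier, Pi.smul_apply, smul_eq_mul, ← integral_const_mul]
  congr 1
  ext v
  ring

/-- The subspace `L¹(N) ∩ L²(N)` of `L²(N)`. -/
def integrableSubmodule : Submodule ℂ (L2N e) where
  carrier := {f | Integrable f (NilGroup.haar e)}
  add_mem' {f g} hf hg := (integrable_congr (Lp.coeFn_add f g)).2 (hf.add hg)
  zero_mem' := (integrable_congr (Lp.coeFn_zero ℂ 2 (NilGroup.haar e))).2 (integrable_zero _ _ _)
  smul_mem' c f hf := (integrable_congr (Lp.coeFn_smul c f)).2 (hf.smul c)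

/-- The Fourier transform on `L¹(N) ∩ L²(N)`. -/
def fourierLp (f : integrableSubmodule e) : L2Dual e :=
  (memLp_fourierKernel e (integrable_inCoords e f.2) (memLp_inCoords e f.1)).toLp _

theorem fourierLp_coeFn (f : integrableSubmodule e) :
    fourierLp e f =ᵐ[(plancherelMeasure e).prod volume] fourierKernel e (inCoords e f.1) :=
  MemLp.coeFn_toLp _

theorem norm_fourierLp (f : integrableSubmodule e) : ‖fourierLp e f‖ = ‖f‖ := by
  rw [fourierLp, Lp.norm_toLp, eLpNorm_fourierKernel e (integrable_inCoords e f.2)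
    (memLp_inCoords e f.1)]
  exact congrArg ENNReal.toReal (eLpNorm_comp_measurePreserving (Lp.aestronglyMeasurable f.1)
    (measurePreserving_ofCoords e))

/-- The Fourier transform on `L¹(N) ∩ L²(N)` as a linear map. -/
def fourierLinear : integrableSubmodule e →ₗ[ℂ] L2Dual e where
  toFun := fourierLp e
  map_add' f g := by
    refine Lp.ext ((fourierLp_coeFn e (f + g)).trans (EventuallyEq.trans ?_
      (Lp.coeFn_add _ _).symm))
    refine (fourierKernel_congr_ae e (inCoords_congr_ae e (Lp.coeFn_add f.1 g.1))).trans ?_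
    refine (fourierKernel_add e (integrable_inCoords e f.2) (integrable_inCoords e g.2)).trans ?_
    exact ((fourierLp_coeFn e f).add (fourierLp_coeFn e g)).symm
  map_smul' c f := by
    refine Lp.ext ((fourierLp_coeFn e (c • f)).trans (EventuallyEq.trans ?_
      (Lp.coeFn_smul _ _).symm))
    refine (fourierKernel_congr_ae e (inCoords_congr_ae e (Lp.coeFn_smul c f.1))).trans ?_
    refine (EventuallyEq.of_eq (fourierKernel_smul e c (inCoords e f.1))).trans ?_
    exact ((fourierLp_coeFn e f).const_smul c).symm

theorem dense_integrableSubmodule : DenseRange (integrableSubmodule e).subtype := by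
  have h : Dense (integrableSubmodule e : Set (L2N e)) := by
    refine (Lp.simpleFunc.dense (E := ℂ) (p := 2) (μ := NilGroup.haar e)
      ENNReal.ofNat_ne_top).mono fun f hf => ?_
    have h1 := Lp.simpleFunc.memLp (⟨f, hf⟩ : Lp.simpleFunc ℂ 2 (NilGroup.haar e))
    rw [SimpleFunc.memLp_iff_integrable two_ne_zero ENNReal.ofNat_ne_top] at h1
    exact (integrable_congr (Lp.simpleFunc.toSimpleFunc_eq_toFun _)).1 h1
  rwa [DenseRange, Submodule.coe_subtype, Subtype.range_coe]

/-- The Plancherel transform as a linear map. -/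
def plancherelCLM : L2N e →L[ℂ] L2Dual e :=
  (fourierLinear e).extendOfNorm (integrableSubmodule e).subtype

theorem plancherelCLM_apply (f : integrableSubmodule e) :
    plancherelCLM e f.1 = fourierLp e f :=
  LinearMap.extendOfNorm_eq (dense_integrableSubmodule e)
    ⟨1, fun f => by rw [one_mul]; exact (norm_fourierLp e f).le⟩ f

theorem norm_plancherelCLM (f : L2N e) : ‖plancherelCLM e f‖ = ‖f‖ := by
  refine (dense_integrableSubmodule e).induction_on
    (p := fun f => ‖plancherelCLM e f‖ = ‖f‖) f
    (isClosed_eq (by fun_prop) (by fun_prop)) fun f => ?_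
  exact (congrArg norm (plancherelCLM_apply e f)).trans (norm_fourierLp e f)

/-- On the Fourier graph the second component is the continuous extension evaluated at the first.
Continuity gives the limit along the defining filter. -/
theorem plancherel_eq (f : L2N e) : plancherel e f = plancherelCLM e f := by
  have hgraph : ∀ p ∈ fourierGraph e, p.2 = plancherelCLM e p.1 := by
    rintro ⟨f, G⟩ ⟨hf, hG⟩
    have h1 := (isFourierTransform_iff e f hf G).1 hG
    exact (Lp.ext (h1.trans (fourierLp_coeFn e ⟨f, hf⟩).symm)).trans
      (plancherelCLM_apply e ⟨f, hf⟩).symm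
  -- Density of `L¹ ∩ L²` makes the filter nontrivial; otherwise `limUnder` would not be determined.
  have hne : (comap Prod.fst (𝓝 f) ⊓ 𝓟 (fourierGraph e)).NeBot := by
    rw [inf_principal_neBot_iff]
    rintro U ⟨V, hV, hVU⟩
    obtain ⟨g, hgV, g', rfl⟩ := mem_closure_iff_nhds.1 ((dense_integrableSubmodule e) f) V hV
    refine ⟨(g'.1, fourierLp e g'), hVU hgV, g'.2, ?_⟩
    exact (isFourierTransform_iff e _ g'.2 _).2 (fourierLp_coeFn e g')
  refine Tendsto.limUnder_eq ?_
  have h1 : Tendsto (fun p : L2N e × L2Dual e => plancherelCLM e p.1)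
      (comap Prod.fst (𝓝 f) ⊓ 𝓟 (fourierGraph e)) (𝓝 (plancherelCLM e f)) :=
    ((plancherelCLM e).continuous.tendsto f).comp (tendsto_comap.mono_left inf_le_left)
  refine h1.congr' ?_
  filter_upwards [mem_inf_of_right (mem_principal_self _)] with p hp
  exact (hgraph p hp).symm

end PlancherelTransform

/-! ### Left translation on the Fourier side -/

section Intertwining

variable (e : AdaptedBasis 𝔫 r d)

/-- Left translation by the element with coordinates `c` on the variables `(z, y)`. -/
def shearEquiv (c : Coords r d) :
    (Fin r → ℝ) × (Fin d → ℝ) ≃ᵐ (Fin r → ℝ) × (Fin d → ℝ) where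
  toFun v := (c.1 + v.1 + NilGroup.bracketXY e c.2.2 v.2, c.2.1 + v.2)
  invFun v := (v.1 - NilGroup.bracketXY e c.2.2 (v.2 - c.2.1) - c.1, v.2 - c.2.1)
  left_inv v := by ext <;> simp
  right_inv v := by ext <;> simp
  measurable_toFun := by simp only [Equiv.coe_fn_mk]; fun_prop
  measurable_invFun := by simp only [Equiv.coe_fn_symm_mk]; fun_prop

theorem shearEquiv_apply (c : Coords r d) (v : (Fin r → ℝ) × (Fin d → ℝ)) :
    shearEquiv e c v = (c.1 + v.1 + NilGroup.bracketXY e c.2.2 v.2, c.2.1 + v.2) := rfl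

theorem measurePreserving_shearEquiv (c : Coords r d) : MeasurePreserving (shearEquiv e c) := by
  have hskew : MeasurePreserving
      (fun w : (Fin d → ℝ) × (Fin r → ℝ) =>
        (c.2.1 + w.1, c.1 + w.2 + NilGroup.bracketXY e c.2.2 w.1))
      (volume.prod volume) (volume.prod volume) := by
    refine (measurePreserving_add_left volume c.2.1).skew_product
      (g := fun w z => c.1 + z + NilGroup.bracketXY e c.2.2 w) (by fun_prop) ?_
    refine Eventually.of_forall fun w => ?_
    exact ((measurePreserving_add_right volume (NilGroup.bracketXY e c.2.2 w)).comp
      (measurePreserving_add_left volume c.1)).map_eq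
  exact (Measure.measurePreserving_swap (μ := (volume : Measure (Fin d → ℝ)))
    (ν := (volume : Measure (Fin r → ℝ)))).comp (hskew.comp (Measure.measurePreserving_swap
    (μ := (volume : Measure (Fin r → ℝ))) (ν := (volume : Measure (Fin d → ℝ)))))

/-- The phase of `π_l(n)` on integral kernels. -/
def dualPhase (c p : Coords r d) : ℂ := expi (p.1 ⬝ᵥ c.1 + p.2.1 ⬝ᵥ (e.B p.1 *ᵥ c.2.1))

theorem norm_dualPhase (c p : Coords r d) : ‖dualPhase e c p‖ = 1 := norm_expi _

theorem continuous_dualPhase (c : Coords r d) : Continuous (dualPhase e c) := by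
  have h : Continuous fun p : Coords r d => e.B p.1 *ᵥ c.2.1 :=
    ((continuous_B e).comp continuous_fst).matrix_mulVec continuous_const
  unfold dualPhase
  fun_prop

/-- Translation of integral kernels in the first variable. -/
def dualShift (x : Fin d → ℝ) (p : Coords r d) : Coords r d := (p.1, p.2.1 - x, p.2.2)

theorem measurePreserving_dualShift (x : Fin d → ℝ) :
    MeasurePreserving (dualShift (r := r) x) ((plancherelMeasure e).prod volume)
      ((plancherelMeasure e).prod volume) :=
  (MeasurePreserving.id _).prod
    ((measurePreserving_sub_right volume x).prod (MeasurePreserving.id volume))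

theorem fourierKernel_translate (f : NilGroup e → ℂ) (g : NilGroup e) (p : Coords r d) :
    fourierKernel e (inCoords e fun n => f (g⁻¹ * n)) p =
      dualPhase e g.coords p * fourierKernel e (inCoords e f) (dualShift g.coords.2.2 p) := by
  obtain ⟨l, t, s⟩ := p
  set c := g.coords with hc
  have hg : g = NilGroup.ofCoords e c := (NilGroup.ofCoords_coords g).symm
  simp only [dualShift, dualPhase]
  -- At fixed `x = t - s`, left translation acts on `(z, y)` as a measure-preserving shear. Its
  -- bracket term contributes `-(x₀ ⬝ᵥ B(l) y)`, with `x₀` the translating `x`-coordinate, and so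
  -- replaces `t` by `t - x₀` in the phase.
  rw [fourierKernel_apply, fourierKernel_apply, ← integral_const_mul,
    ← (measurePreserving_shearEquiv e c).integral_comp (shearEquiv e c).measurableEmbedding]
  congr 1
  ext v
  rw [shearEquiv_apply, ← mul_assoc, ← expi_add]
  refine congrArg₂ (· * ·) (congrArg expi ?_) ?_
  · simp only [dotProduct_add, dotProduct_bracketXY, Matrix.mulVec_add, sub_dotProduct]
    ring
  · simp only [inCoords]
    congr 1
    rw [inv_mul_eq_iff_eq_mul, hg, NilGroup.ofCoords_mul,
      show c.2.2 + (t - c.2.2 - s) = t - s by abel]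

theorem memLp_dualAction (c : Coords r d) (G : L2Dual e) :
    MemLp (fun p => dualPhase e c p * G (dualShift c.2.2 p)) 2
      ((plancherelMeasure e).prod volume) := by
  have h := (Lp.memLp G).comp_measurePreserving (measurePreserving_dualShift e c.2.2)
  refine h.of_le ((continuous_dualPhase e c).aestronglyMeasurable.mul h.1) (Eventually.of_forall fun p => le_of_eq ?_)
  simp only [norm_mul, norm_dualPhase, one_mul, Function.comp_apply]

/-- The action of the element with coordinates `c` on fields of integral kernels. -/
def dualAction (c : Coords r d) (G : L2Dual e) : L2Dual e := (memLp_dualAction e c G).toLp _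

theorem dualAction_coeFn (c : Coords r d) (G : L2Dual e) :
    dualAction e c G =ᵐ[(plancherelMeasure e).prod volume]
      fun p => dualPhase e c p * G (dualShift c.2.2 p) := MemLp.coeFn_toLp _

theorem isometry_dualAction (c : Coords r d) : Isometry (dualAction e c) := by
  refine Isometry.of_dist_eq fun G G' => ?_
  have h : dualAction e c G - dualAction e c G' =ᵐ[(plancherelMeasure e).prod volume]
      fun p => dualPhase e c p * (G - G') (dualShift c.2.2 p) := by
    refine (Lp.coeFn_sub _ _).trans ?_
    filter_upwards [dualAction_coeFn e c G, dualAction_coeFn e c G',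
      (measurePreserving_dualShift e c.2.2).quasiMeasurePreserving.ae (Lp.coeFn_sub G G')]
      with p h1 h2 h3
    rw [Pi.sub_apply, h1, h2, h3, Pi.sub_apply, mul_sub]
  rw [dist_eq_norm, dist_eq_norm, Lp.norm_def, Lp.norm_def, eLpNorm_congr_ae h,
    ← eLpNorm_comp_measurePreserving (Lp.aestronglyMeasurable (G - G'))
      (measurePreserving_dualShift e c.2.2)]
  congr 1
  refine eLpNorm_congr_norm_ae (Eventually.of_forall fun p => ?_)
  simp only [norm_mul, norm_dualPhase, one_mul, Function.comp_apply]

theorem leftRegular_coeFn (g : NilGroup e) (f : L2N e) :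
    leftRegular e g f =ᵐ[NilGroup.haar e] fun n => f (g⁻¹ * n) :=
  Lp.coeFn_compMeasurePreserving f (NilGroup.measurePreserving_mul_left g⁻¹)

theorem isometry_leftRegular (g : NilGroup e) : Isometry (leftRegular e g) :=
  Lp.isometry_compMeasurePreserving (NilGroup.measurePreserving_mul_left g⁻¹)

theorem plancherelCLM_leftRegular (g : NilGroup e) (f : L2N e) :
    plancherelCLM e (leftRegular e g f) = dualAction e g.coords (plancherelCLM e f) := by
  refine (dense_integrableSubmodule e).induction_on
    (p := fun f => plancherelCLM e (leftRegular e g f) =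
      dualAction e g.coords (plancherelCLM e f)) f
    (isClosed_eq ((plancherelCLM e).continuous.comp (isometry_leftRegular e g).continuous)
      ((isometry_dualAction e _).continuous.comp (plancherelCLM e).continuous)) fun f => ?_
  have hL : Integrable (leftRegular e g f.1) (NilGroup.haar e) :=
    (integrable_congr (leftRegular_coeFn e g f.1)).2
      ((NilGroup.measurePreserving_mul_left g⁻¹).integrable_comp_of_integrable f.2)
  have h1 := plancherelCLM_apply e ⟨_, hL⟩
  have h2 := plancherelCLM_apply e f
  refine h1.trans ?_
  refine Eq.trans ?_ (congrArg (dualAction e g.coords) h2).symm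
  refine Lp.ext ((fourierLp_coeFn e ⟨_, hL⟩).trans (EventuallyEq.trans ?_
    (dualAction_coeFn e _ _).symm))
  refine (fourierKernel_congr_ae e (inCoords_congr_ae e (leftRegular_coeFn e g f.1))).trans ?_
  filter_upwards [(measurePreserving_dualShift e g.coords.2.2).quasiMeasurePreserving.ae
    (fourierLp_coeFn e f)] with p hp
  rw [fourierKernel_translate, hp]

theorem plancherelCLM_leftRegular_coeFn (g : NilGroup e) (f : L2N e) :
    plancherelCLM e (leftRegular e g f) =ᵐ[(plancherelMeasure e).prod volume]
      fun p => dualPhase e g.coords p * plancherelCLM e f (dualShift g.coords.2.2 p) := by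
  rw [plancherelCLM_leftRegular]
  exact dualAction_coeFn e _ _

theorem inner_plancherelCLM (f g : L2N e) :
    inner ℂ (plancherelCLM e f) (plancherelCLM e g) = inner ℂ f g :=
  LinearIsometry.inner_map_map
    (⟨(plancherelCLM e).toLinearMap, norm_plancherelCLM e⟩ : L2N e →ₗᵢ[ℂ] L2Dual e) f g

end Intertwining

/-! ### Coefficients of the regular representation and invariance of the band-limited space -/

section LeftRegular

variable (e : AdaptedBasis 𝔫 r d)

theorem inner_leftRegular_leftRegular (g : NilGroup e) (f h : L2N e) :
    inner ℂ (leftRegular e g f) (leftRegular e g h) = inner ℂ f h :=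
  LinearIsometry.inner_map_map (Lp.compMeasurePreservingₗᵢ ℂ (fun n => g⁻¹ * n)
    (NilGroup.measurePreserving_mul_left g⁻¹) : L2N e →ₗᵢ[ℂ] L2N e) f h

theorem norm_leftRegular (g : NilGroup e) (f : L2N e) : ‖leftRegular e g f‖ = ‖f‖ :=
  Lp.norm_compMeasurePreserving f (NilGroup.measurePreserving_mul_left g⁻¹)

theorem leftRegular_mul (g h : NilGroup e) (f : L2N e) :
    leftRegular e (g * h) f = leftRegular e g (leftRegular e h f) := by
  refine Lp.ext ?_
  filter_upwards [leftRegular_coeFn e (g * h) f, leftRegular_coeFn e g (leftRegular e h f),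
    (NilGroup.measurePreserving_mul_left g⁻¹).quasiMeasurePreserving.ae (leftRegular_coeFn e h f)]
    with n h1 h2 h3
  rw [h1, h2, h3, mul_inv_rev, mul_assoc]

theorem leftRegular_one (f : L2N e) : leftRegular e 1 f = f := by
  refine Lp.ext ?_
  filter_upwards [leftRegular_coeFn e 1 f] with n h1
  rw [h1, inv_one, one_mul]

theorem inner_leftRegular_mul (g h : NilGroup e) (f f' : L2N e) :
    inner ℂ (leftRegular e (g * h) f) f' =
      inner ℂ (leftRegular e h f) (leftRegular e g⁻¹ f') := by
  rw [leftRegular_mul, ← inner_leftRegular_leftRegular e g⁻¹, ← leftRegular_mul,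
    inv_mul_cancel, leftRegular_one]

theorem inner_leftRegular_eq_integral (c : Coords r d) (f f' : L2N e) :
    inner ℂ (leftRegular e (NilGroup.ofCoords e c) f) f' =
      ∫ w, conj (dualPhase e c w * plancherelCLM e f (dualShift c.2.2 w)) *
        plancherelCLM e f' w ∂(plancherelMeasure e).prod volume := by
  rw [← inner_plancherelCLM, inner_L2_eq_integral]
  refine integral_congr_ae ?_
  filter_upwards [plancherelCLM_leftRegular_coeFn e (NilGroup.ofCoords e c) f] with w hw
  rw [hw, NilGroup.coords_ofCoords]

theorem continuous_dualPhase_uncurry : Continuous fun w : Coords r d × Coords r d =>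
    dualPhase e w.1 w.2 := by
  have h : Continuous fun w : Coords r d × Coords r d => e.B w.2.1 *ᵥ w.1.2.1 :=
    ((continuous_B e).comp (continuous_fst.comp continuous_snd)).matrix_mulVec
      (continuous_fst.comp (continuous_snd.comp continuous_fst))
  unfold dualPhase
  fun_prop

/-- Written on the Fourier side the coefficient is a parameter integral with jointly measurable
integrand, so strong continuity of the representation is not required. -/
theorem stronglyMeasurable_inner_leftRegular (f f' : L2N e) :
    StronglyMeasurable fun c => inner ℂ (leftRegular e (NilGroup.ofCoords e c) f) f' := by
  simp only [inner_leftRegular_eq_integral]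
  refine StronglyMeasurable.integral_prod_right
    (StronglyMeasurable.mul (Complex.continuous_conj.comp_stronglyMeasurable
      (StronglyMeasurable.mul (continuous_dualPhase_uncurry e).stronglyMeasurable
        ((Lp.stronglyMeasurable _).comp_measurable ?_)))
      ((Lp.stronglyMeasurable _).comp_measurable measurable_snd))
  unfold dualShift
  fun_prop

theorem measurable_enorm_inner_leftRegular (f f' : L2N e) : Measurable fun c : Coords r d =>
    ‖(inner ℂ (leftRegular e (NilGroup.ofCoords e c) f) f' : ℂ)‖ₑ ^ 2 :=
  (stronglyMeasurable_inner_leftRegular e f f').enorm.pow_const 2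

theorem plancherelCLM_injective : Function.Injective (plancherelCLM e) := by
  intro f g h
  have := norm_plancherelCLM e (f - g)
  rw [map_sub, h, sub_self, norm_zero] at this
  exact sub_eq_zero.1 (norm_eq_zero.1 this.symm)

theorem mem_iff_of_image_eq {K : Submodule ℂ (L2N e)} {S : Set (L2Dual e)}
    (hK : plancherel e '' (K : Set (L2N e)) = S) (f : L2N e) :
    f ∈ K ↔ plancherelCLM e f ∈ S := by
  have h : plancherel e = plancherelCLM e := funext (plancherel_eq e)
  rw [← hK, h, (plancherelCLM_injective e).mem_set_image]
  rfl

theorem exists_mem_of_image_eq {K : Submodule ℂ (L2N e)} {S : Set (L2Dual e)}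
    (hK : plancherel e '' (K : Set (L2N e)) = S) {G : L2Dual e} (hG : G ∈ S) :
    ∃ f ∈ K, plancherelCLM e f = G := by
  rw [← hK] at hG
  obtain ⟨f, hf, rfl⟩ := hG
  exact ⟨f, hf, (plancherel_eq e f).symm⟩

variable {I : Set (Fin r → ℝ)} {P : (Fin r → ℝ) → L2 d →L[ℂ] L2 d}

/-- Membership may be checked on any representative, with no measurability demanded of it. -/
theorem mem_directIntegral_of_ae_eq {G : L2Dual e} {F : Coords r d → ℂ}
    (h : G =ᵐ[(plancherelMeasure e).prod volume] F)
    (hF : ∀ᵐ l ∂plancherelMeasure e,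
      (l ∈ I → ∀ᵐ t : Fin d → ℝ, ∃ u ∈ Set.range (P l), ∀ᵐ s : Fin d → ℝ,
        F (l, t, s) = conj (u s)) ∧
      (l ∉ I → ∀ᵐ t : Fin d → ℝ, ∀ᵐ s : Fin d → ℝ, F (l, t, s) = 0)) :
    G ∈ directIntegral e I P := by
  change ∀ᵐ l ∂plancherelMeasure e, _
  filter_upwards [hF, Measure.ae_ae_of_ae_prod h] with l hl hl'
  have h2 := Measure.ae_ae_of_ae_prod hl'
  constructor
  · intro hI
    filter_upwards [hl.1 hI, h2] with t ⟨u, hu, hu'⟩ ht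
    refine ⟨u, hu, ?_⟩
    filter_upwards [hu', ht] with s hs hs'
    rw [hs', hs]
  · intro hI
    filter_upwards [hl.2 hI, h2] with t ht ht'
    filter_upwards [ht, ht'] with s hs hs'
    rw [hs', hs]

theorem dualAction_mem_directIntegral (c : Coords r d) {G : L2Dual e}
    (hG : G ∈ directIntegral e I P) : dualAction e c G ∈ directIntegral e I P := by
  refine mem_directIntegral_of_ae_eq e (dualAction_coeFn e c G) ?_
  filter_upwards [hG] with l hl
  have hq := (measurePreserving_sub_right (volume : Measure (Fin d → ℝ)) c.2.2).quasiMeasurePreserving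
  constructor
  · intro hI
    filter_upwards [hq.ae (hl.1 hI)] with t ⟨u, ⟨v, hv⟩, hu'⟩
    -- The phase and the shift affect only `t`, while the range condition concerns `s`. The scalar
    -- is conjugated because the slice is the conjugate of a vector in the range of `P l`.
    set k : ℂ := conj (expi (l ⬝ᵥ c.1 + t ⬝ᵥ (e.B l *ᵥ c.2.1)))
    refine ⟨k • u, ⟨k • v, by rw [map_smul, hv]⟩, ?_⟩
    filter_upwards [hu', Lp.coeFn_smul k u] with s hs hs'
    rw [hs', Pi.smul_apply, smul_eq_mul, map_mul, Complex.conj_conj, ← hs]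
    rfl
  · intro hI
    filter_upwards [hq.ae (hl.2 hI)] with t ht
    filter_upwards [ht] with s hs
    simp only [dualShift, hs, mul_zero]

theorem leftRegular_mem {K : Submodule ℂ (L2N e)}
    (hK : plancherel e '' (K : Set (L2N e)) = directIntegral e I P) (g : NilGroup e)
    {f : L2N e} (hf : f ∈ K) : leftRegular e g f ∈ K := by
  rw [mem_iff_of_image_eq e hK] at hf ⊢
  rw [plancherelCLM_leftRegular]
  exact dualAction_mem_directIntegral e _ hf

theorem indicator_mem_directIntegral {G : L2Dual e} (hG : G ∈ directIntegral e I P)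
    {E : Set (Fin r → ℝ)} {G' : L2Dual e}
    (h : G' =ᵐ[(plancherelMeasure e).prod volume] (Prod.fst ⁻¹' E).indicator G) :
    G' ∈ directIntegral e I P := by
  classical
  refine mem_directIntegral_of_ae_eq e h ?_
  filter_upwards [hG] with l hl
  by_cases hE : l ∈ E
  · simpa [Set.indicator, hE] using hl
  · refine ⟨fun _ => Eventually.of_forall fun t => ⟨0, ⟨0, map_zero _⟩, ?_⟩, fun _ => ?_⟩
    · filter_upwards [Lp.coeFn_zero ℂ 2 (volume : Measure (Fin d → ℝ))] with s hs
      rw [hs]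
      simp [Set.indicator, hE]
    · simp [Set.indicator, hE]

end LeftRegular

/-! ### Consequences of the Parseval identity -/

section Frames

variable (e : AdaptedBasis 𝔫 r d) {a : Fin r → ℝ} {q b : Fin d → ℝ}
  {K : Submodule ℂ (L2N e)} {φ : L2N e}

theorem ofCoords_injective : Function.Injective (NilGroup.ofCoords e) :=
  (NilGroup.coordsEquiv e).symm.injective

theorem latticePoint_injective (ha : ∀ j, 0 < a j) (hq : ∀ j, 0 < q j) (hb : ∀ j, 0 < b j) :
    Function.Injective (latticePoint a q b) := by
  have hdiv : ∀ {n : ℕ} {c : Fin n → ℝ} {m m' : Fin n → ℤ}, (∀ j, 0 < c j) →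
      ((fun j => (m j : ℝ) / c j) = fun j => (m' j : ℝ) / c j) → m = m' := by
    intro n c m m' hc h
    ext j
    have := congrFun h j
    exact_mod_cast (div_left_inj' (hc j).ne').1 this
  intro i i' h
  simp only [latticePoint, Prod.mk.injEq] at h
  exact Prod.ext (hdiv ha h.1) (Prod.ext (hdiv hq h.2.1) (hdiv hb h.2.2))

/-- The frame is indexed by the set of lattice points; injectivity of the parametrization turns its
sum into one over integer tuples without repetition. -/
theorem tsum_enorm_inner_latticePoint (ha : ∀ j, 0 < a j) (hq : ∀ j, 0 < q j) (hb : ∀ j, 0 < b j)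
    (hframe : IsParsevalFrame K (fun γ : quasiLattice e a q b => leftRegular e γ.1 φ))
    {ψ : L2N e} (hψ : ψ ∈ K) :
    ∑' i, ‖(inner ℂ (leftRegular e (NilGroup.ofCoords e (latticePoint a q b i)) φ) ψ : ℂ)‖ₑ ^ 2 =
      ‖ψ‖ₑ ^ 2 := by
  have h := hframe.2 ψ hψ
  have hinj : Function.Injective fun i => NilGroup.ofCoords e (latticePoint a q b i) :=
    (ofCoords_injective e).comp (latticePoint_injective ha hq hb)
  have h2 := (Equiv.ofInjective _ hinj).hasSum_iff.2 h
  have h3 := ENNReal.ofReal_tsum_of_nonneg (fun i => sq_nonneg _) h2.summable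
  have h4 := h3.symm.trans (congrArg ENNReal.ofReal h2.tsum_eq)
  rw [← ofReal_norm, ← ENNReal.ofReal_pow (norm_nonneg _), ← h4]
  refine tsum_congr fun i => ?_
  rw [← ofReal_norm, ← ENNReal.ofReal_pow (norm_nonneg _)]
  rfl

theorem lintegral_enorm_inner_leftRegular (ψ : L2N e) :
    ∫⁻ n, ‖(inner ℂ (leftRegular e n φ) ψ : ℂ)‖ₑ ^ 2 ∂NilGroup.haar e =
      ∫⁻ c, ‖(inner ℂ (leftRegular e (NilGroup.ofCoords e c) φ) ψ : ℂ)‖ₑ ^ 2 :=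
  ((measurePreserving_ofCoords e).lintegral_comp_emb (measurableEmbedding_ofCoords e) _).symm

variable {I : Set (Fin r → ℝ)} {P : (Fin r → ℝ) → L2 d →L[ℂ] L2 d}

/-- The fundamental domain of the quasi-lattice has volume one. -/
theorem volume_box_mul_enorm_sq (ha : ∀ j, 0 < a j) (hq : ∀ j, 0 < q j) (hb : ∀ j, 0 < b j)
    (hK : plancherel e '' (K : Set (L2N e)) = directIntegral e I P)
    (hφ : IsContinuousWavelet e K φ)
    (hframe : IsParsevalFrame K (fun γ : quasiLattice e a q b => leftRegular e γ.1 φ))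
    {ψ : L2N e} (hψ : ψ ∈ K) :
    ‖ψ‖ₑ ^ 2 = ‖ψ‖ₑ ^ 2 * ENNReal.ofReal ((∏ j, a j)⁻¹ * ((∏ j, q j)⁻¹ * (∏ j, b j)⁻¹)) := by
  have hmeas := measurable_enorm_inner_leftRegular e φ ψ
  refine (hφ.2 ψ hψ).symm.trans ?_
  rw [lintegral_enorm_inner_leftRegular, lintegral_eq_tsum_latticePoint e ha hq hb hmeas,
    ← lintegral_tsum]
  -- Moving the left factor `c` onto `ψ` leaves the full Parseval sum of a translate of `ψ`, which
  -- stays in `K` with the same norm. The integrand over the box is therefore constant.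
  · have h1 : ∀ c : Coords r d, ∑' i, ‖(inner ℂ (leftRegular e (NilGroup.ofCoords e
        (coordMul e c (latticePoint a q b i))) φ) ψ : ℂ)‖ₑ ^ 2 = ‖ψ‖ₑ ^ 2 := by
      intro c
      have h2 := tsum_enorm_inner_latticePoint e ha hq hb hframe
        (leftRegular_mem e hK (NilGroup.ofCoords e c)⁻¹ hψ)
      rw [← ofReal_norm, norm_leftRegular, ofReal_norm] at h2
      rw [← h2]
      refine tsum_congr fun i => ?_
      rw [← inner_leftRegular_mul, NilGroup.ofCoords_mul]
      rfl
    have hvol : volume (box a ×ˢ box q ×ˢ box b) =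
        ENNReal.ofReal ((∏ j, a j)⁻¹ * ((∏ j, q j)⁻¹ * (∏ j, b j)⁻¹)) := by
      have hn : ∀ {n : ℕ} {c : Fin n → ℝ}, (∀ j, 0 < c j) → 0 ≤ (∏ j, c j)⁻¹ := fun hc =>
        inv_nonneg.2 (Finset.prod_nonneg fun j _ => (hc j).le)
      rw [Measure.volume_eq_prod, Measure.prod_prod, Measure.volume_eq_prod, Measure.prod_prod,
        volume_box ha, volume_box hq, volume_box hb, ENNReal.ofReal_mul (hn ha),
        ENNReal.ofReal_mul (hn hq)]
    simp only [h1, setLIntegral_const, hvol]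
  · intro i
    exact (hmeas.comp (measurePreserving_coordMul_right e _).measurable).aemeasurable

/-- Tile the center by the box of `a`. Over each point of the box, the central lattice points
contribute a partial sum of the Parseval sum of a translate of `ψ`; hence an inequality. -/
theorem lintegral_central_le (ha : ∀ j, 0 < a j) (hq : ∀ j, 0 < q j) (hb : ∀ j, 0 < b j)
    (hK : plancherel e '' (K : Set (L2N e)) = directIntegral e I P)
    (hframe : IsParsevalFrame K (fun γ : quasiLattice e a q b => leftRegular e γ.1 φ))
    {ψ : L2N e} (hψ : ψ ∈ K) :
    ∫⁻ z : Fin r → ℝ, ‖(inner ℂ (leftRegular e (NilGroup.ofCoords e (z, 0, 0)) φ) ψ : ℂ)‖ₑ ^ 2 ≤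
      ‖ψ‖ₑ ^ 2 * ENNReal.ofReal (∏ j, a j)⁻¹ := by
  have hmeas : Measurable fun z : Fin r → ℝ =>
      ‖(inner ℂ (leftRegular e (NilGroup.ofCoords e (z, 0, 0)) φ) ψ : ℂ)‖ₑ ^ 2 :=
    (measurable_enorm_inner_leftRegular e φ ψ).comp (by fun_prop)
  rw [lintegral_eq_tsum_box ha hmeas, ← lintegral_tsum]
  · rw [← volume_box ha, ← setLIntegral_const]
    refine lintegral_mono fun z => ?_
    have h2 := tsum_enorm_inner_latticePoint e ha hq hb hframe
      (leftRegular_mem e hK (NilGroup.ofCoords e (z, 0, 0))⁻¹ hψ)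
    rw [← ofReal_norm, norm_leftRegular, ofReal_norm] at h2
    rw [← h2]
    have hinj : Function.Injective fun m : Fin r → ℤ =>
        ((m, 0, 0) : (Fin r → ℤ) × (Fin d → ℤ) × (Fin d → ℤ)) := fun m m' h => by
      simpa using h
    refine le_trans (le_of_eq (tsum_congr fun m => ?_))
      (ENNReal.tsum_comp_le_tsum_of_injective hinj _)
    rw [← inner_leftRegular_mul, NilGroup.ofCoords_mul]
    congr 5
    refine Prod.ext ?_ (Prod.ext ?_ ?_)
    · ext j
      simp [latticePoint, NilGroup.bracketXY, NilGroup.X_zero]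
    · ext j
      simp [latticePoint]
    · ext j
      simp [latticePoint]
  · intro m
    exact (hmeas.comp (measurable_add_const _)).aemeasurable

end Frames

/-! ### Fiberwise Hilbert-Schmidt norms -/

section FiberNorm

variable (e : AdaptedBasis 𝔫 r d)

/-- The squared Hilbert-Schmidt norms of the fibers of a field of integral kernels. -/
def fiberNormSq (G : L2Dual e) (l : Fin r → ℝ) : ℝ≥0∞ :=
  ∫⁻ p : (Fin d → ℝ) × (Fin d → ℝ), ‖G (l, p)‖ₑ ^ 2

/-- The density of the squared norm of a field of integral kernels with respect to Lebesgue
measure. -/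
def fiberWeight (G : L2Dual e) (l : Fin r → ℝ) : ℝ≥0∞ :=
  ENNReal.ofReal |(e.B l).det| * fiberNormSq e G l

theorem measurable_fiberNormSq (G : L2Dual e) : Measurable (fiberNormSq e G) :=
  ((Lp.stronglyMeasurable G).enorm.pow_const 2).lintegral_prod_right'

theorem measurable_fiberWeight (G : L2Dual e) : Measurable (fiberWeight e G) :=
  (continuous_det_B e).measurable.abs.ennreal_ofReal.mul (measurable_fiberNormSq e G)

theorem enorm_sq_eq_lintegral {α : Type*} [MeasurableSpace α] {μ : Measure α} (f : Lp ℂ 2 μ) :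
    ‖f‖ₑ ^ 2 = ∫⁻ x, ‖f x‖ₑ ^ 2 ∂μ := by
  rw [Lp.enorm_def, eLpNorm_two_sq]

theorem enorm_sq_eq_setLIntegral_fiberWeight {G G' : L2Dual e} {E : Set (Fin r → ℝ)}
    (hE : MeasurableSet E)
    (h : G' =ᵐ[(plancherelMeasure e).prod volume] (Prod.fst ⁻¹' E).indicator G) :
    ‖G'‖ₑ ^ 2 = ∫⁻ l in E, fiberWeight e G l := by
  classical
  have hm : Measurable fun p => ((Prod.fst ⁻¹' E).indicator G p : ℂ) :=
    (Lp.stronglyMeasurable G).measurable.indicator (measurable_fst hE)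
  have h1 : ∫⁻ p, ‖G' p‖ₑ ^ 2 ∂(plancherelMeasure e).prod volume =
      ∫⁻ p, ‖(Prod.fst ⁻¹' E).indicator G p‖ₑ ^ 2 ∂(plancherelMeasure e).prod volume := by
    refine lintegral_congr_ae ?_
    filter_upwards [h] with p hp
    rw [hp]
  rw [enorm_sq_eq_lintegral, h1, lintegral_prod _ (hm.enorm.pow_const 2).aemeasurable,
    lintegral_plancherelMeasure e (hm.enorm.pow_const 2).lintegral_prod_right',
    ← lintegral_indicator hE]
  refine lintegral_congr fun l => ?_
  by_cases hl : l ∈ E <;> simp [Set.indicator, hl, fiberWeight, fiberNormSq]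

theorem enorm_sq_eq_lintegral_fiberWeight (G : L2Dual e) :
    ‖G‖ₑ ^ 2 = ∫⁻ l, fiberWeight e G l := by
  rw [← setLIntegral_univ, enorm_sq_eq_setLIntegral_fiberWeight e (G := G) .univ]
  simp

/-- A central element acts by a phase depending on `l` alone and shifts nothing. The kernel
variables thus integrate out to the squared Hilbert-Schmidt norm, and the Plancherel density
completes it to the fiber weight. -/
theorem inner_leftRegular_central {f f' : L2N e} {E : Set (Fin r → ℝ)} (hE : MeasurableSet E)
    (h : plancherelCLM e f' =ᵐ[(plancherelMeasure e).prod volume]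
      (Prod.fst ⁻¹' E).indicator (plancherelCLM e f)) (z : Fin r → ℝ) :
    inner ℂ (leftRegular e (NilGroup.ofCoords e (z, 0, 0)) f) f' =
      ∫ l, expi (-(z ⬝ᵥ l)) *
        E.indicator (fun l => ((fiberWeight e (plancherelCLM e f) l).toReal : ℂ)) l := by
  classical
  set Φ := plancherelCLM e f with hΦ
  set k : Coords r d → ℂ := fun w => expi (-(z ⬝ᵥ w.1)) *
    (Prod.fst ⁻¹' E).indicator (fun w => ((‖Φ w‖ ^ 2 : ℝ) : ℂ)) w with hk
  have hkint : Integrable k ((plancherelMeasure e).prod volume) := by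
    have h1 : Integrable (fun w => ((‖Φ w‖ ^ 2 : ℝ) : ℂ)) ((plancherelMeasure e).prod volume) :=
      ((Lp.memLp Φ).integrable_norm_pow two_ne_zero).ofReal
    have hc : Continuous fun w : Coords r d => expi (-(z ⬝ᵥ w.1)) := by fun_prop
    exact (h1.indicator (measurable_fst hE)).bdd_mul hc.aestronglyMeasurable
      (Eventually.of_forall fun w => (norm_expi _).le)
  have h1 : inner ℂ (leftRegular e (NilGroup.ofCoords e (z, 0, 0)) f) f' =
      ∫ w, k w ∂(plancherelMeasure e).prod volume := by
    rw [inner_leftRegular_eq_integral]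
    refine integral_congr_ae ?_
    filter_upwards [h] with w hw
    have hs : dualShift 0 w = w := by simp [dualShift]
    have hp : dualPhase e (z, 0, 0) w = expi (z ⬝ᵥ w.1) := by
      simp [dualPhase, dotProduct_comm]
    simp only [hw, hp, hs, map_mul, conj_expi, hk, mul_assoc]
    congr 1
    by_cases hl : w.1 ∈ E
    · simp [Set.indicator, hl, ← hΦ, Complex.conj_mul']
    · simp [Set.indicator, hl]
  rw [h1, integral_prod _ hkint, plancherelMeasure, integral_withDensity_eq_integral_toReal_smul
    (continuous_det_B e).measurable.abs.ennreal_ofReal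
    (Eventually.of_forall fun l => ENNReal.ofReal_lt_top)]
  refine integral_congr_ae (Eventually.of_forall fun l => ?_)
  simp only [hk, integral_const_mul, Complex.real_smul]
  rw [mul_left_comm]
  congr 1
  by_cases hl : l ∈ E
  · simp only [Set.indicator, Set.mem_preimage, hl, if_true, fiberWeight, ENNReal.toReal_mul,
      Complex.ofReal_mul]
    congr 1
    rw [integral_complex_ofReal, integral_eq_lintegral_of_nonneg_ae]
    · congr 2
      refine lintegral_congr fun p => ?_
      rw [ENNReal.ofReal_pow (norm_nonneg _), ofReal_norm]
    · exact Eventually.of_forall fun p => sq_nonneg _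
    · exact ((Lp.stronglyMeasurable Φ).norm.pow 2).comp_measurable
        measurable_prodMk_left |>.aestronglyMeasurable
  · simp [Set.indicator, hl]

end FiberNorm

/-! ### The essential bound on the fiber weight -/

section WeightBound

variable (e : AdaptedBasis 𝔫 r d) {a : Fin r → ℝ} {q b : Fin d → ℝ}
  {K : Submodule ℂ (L2N e)} {φ : L2N e}
  {I : Set (Fin r → ℝ)} {P : (Fin r → ℝ) → L2 d →L[ℂ] L2 d}

theorem exists_mem_indicator (hK : plancherel e '' (K : Set (L2N e)) = directIntegral e I P)
    (hφ : φ ∈ K) {E : Set (Fin r → ℝ)} (hE : MeasurableSet E) :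
    ∃ ψ ∈ K, plancherelCLM e ψ =ᵐ[(plancherelMeasure e).prod volume]
      (Prod.fst ⁻¹' E).indicator (plancherelCLM e φ) := by
  have hm := (Lp.memLp (plancherelCLM e φ)).indicator
    (measurable_fst hE : MeasurableSet (Prod.fst ⁻¹' E))
  obtain ⟨ψ, hψ, hG⟩ := exists_mem_of_image_eq e hK (G := hm.toLp _)
    (indicator_mem_directIntegral e ((mem_iff_of_image_eq e hK φ).1 hφ) hm.coeFn_toLp)
  exact ⟨ψ, hψ, by rw [hG]; exact hm.coeFn_toLp⟩

/-- Test the central estimate on the `ψ` with transform `1_E Φ`: the left side becomes `∫_E w²` by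
Euclidean Plancherel and `‖ψ‖²` equals `∫_E w`. Finite measure and boundedness on `E` place `1_E w`
in `L¹ ∩ L²`. -/
theorem setLIntegral_fiberWeight_sq_le (ha : ∀ j, 0 < a j) (hq : ∀ j, 0 < q j)
    (hb : ∀ j, 0 < b j) (hK : plancherel e '' (K : Set (L2N e)) = directIntegral e I P)
    (hφ : φ ∈ K)
    (hframe : IsParsevalFrame K (fun γ : quasiLattice e a q b => leftRegular e γ.1 φ))
    {E : Set (Fin r → ℝ)} (hE : MeasurableSet E) (hEfin : volume E ≠ ∞) {M : ℝ≥0∞} (hM : M ≠ ∞)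
    (hEM : ∀ l ∈ E, fiberWeight e (plancherelCLM e φ) l ≤ M) :
    ∫⁻ l in E, fiberWeight e (plancherelCLM e φ) l ^ 2 ≤
      (∫⁻ l in E, fiberWeight e (plancherelCLM e φ) l) * ENNReal.ofReal (∏ j, a j)⁻¹ := by
  classical
  obtain ⟨ψ, hψ, hψE⟩ := exists_mem_indicator e hK hφ hE
  have hb := lintegral_central_le e ha hq hb hK hframe hψ
  have hn : ‖ψ‖ₑ ^ 2 = ∫⁻ l in E, fiberWeight e (plancherelCLM e φ) l := by
    rw [← enorm_sq_eq_setLIntegral_fiberWeight e hE hψE, ← ofReal_norm, ← ofReal_norm,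
      norm_plancherelCLM]
  set w := fiberWeight e (plancherelCLM e φ) with hw
  set h : (Fin r → ℝ) → ℂ := E.indicator fun l => ((w l).toReal : ℂ) with hh
  have hfin : IsFiniteMeasure (volume.restrict E) := ⟨by
    rw [Measure.restrict_apply_univ]; exact hEfin.lt_top⟩
  have hmem : ∀ p : ℝ≥0∞, MemLp h p := fun p => by
    refine (memLp_indicator_iff_restrict hE).2 (MemLp.of_bound (C := M.toReal) ?_ ?_)
    · exact (Complex.measurable_ofReal.comp
        (measurable_fiberWeight e _).ennreal_toReal).aestronglyMeasurable
    · filter_upwards [ae_restrict_mem hE] with l hl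
      rw [Complex.norm_real, Real.norm_of_nonneg ENNReal.toReal_nonneg]
      exact ENNReal.toReal_mono hM (hEM l hl)
  have hP := lintegral_enorm_sq_fourier_pi_neg (memLp_one_iff_integrable.1 (hmem 1)) (hmem 2)
  simp only [inner_leftRegular_central e hE hψE] at hb
  rw [hP, hn] at hb
  refine le_trans (le_of_eq ?_) hb
  rw [← lintegral_indicator hE]
  refine lintegral_congr fun l => ?_
  by_cases hl : l ∈ E
  · have hne : w l ≠ ∞ := ((hEM l hl).trans_lt hM.lt_top).ne
    simp only [hh, Set.indicator, hl, if_true]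
    rw [← ofReal_norm, Complex.norm_real, Real.norm_of_nonneg ENNReal.toReal_nonneg,
      ENNReal.ofReal_toReal hne]
  · simp [hh, Set.indicator, hl]

/-- On a bounded set where `c < w ≤ n`, the pointwise inequality `c w < w²` contradicts the
integrated estimate unless the set is null. Such sets exhaust `{c < w < ∞}`, and `w` is integrable,
hence almost everywhere finite. -/
theorem ae_fiberWeight_le (ha : ∀ j, 0 < a j) (hq : ∀ j, 0 < q j)
    (hb : ∀ j, 0 < b j) (hK : plancherel e '' (K : Set (L2N e)) = directIntegral e I P)
    (hφ : φ ∈ K)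
    (hframe : IsParsevalFrame K (fun γ : quasiLattice e a q b => leftRegular e γ.1 φ)) :
    ∀ᵐ l, fiberWeight e (plancherelCLM e φ) l ≤ ENNReal.ofReal (∏ j, a j)⁻¹ := by
  set w := fiberWeight e (plancherelCLM e φ) with hw
  have hwm : Measurable w := measurable_fiberWeight e _
  set c := ENNReal.ofReal (∏ j, a j)⁻¹ with hc
  have hwtot : ∫⁻ l, w l ≠ ∞ := by
    rw [hw, ← enorm_sq_eq_lintegral_fiberWeight]
    simp
  have hwfin : ∀ᵐ l, w l < ∞ := ae_lt_top hwm hwtot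
  have hnull : ∀ n : ℕ, volume {l | l ∈ Metric.closedBall 0 (n : ℝ) ∧ w l ≤ n ∧ c < w l} = 0 := by
    intro n
    set E := {l | l ∈ Metric.closedBall 0 (n : ℝ) ∧ w l ≤ n ∧ c < w l} with hEdef
    have hE : MeasurableSet E := by
      refine measurableSet_closedBall.inter (MeasurableSet.inter ?_ ?_)
      · exact measurableSet_le hwm measurable_const
      · exact measurableSet_lt measurable_const hwm
    have hEfin : volume E ≠ ∞ :=
      (measure_lt_top_of_subset (fun l hl => hl.1) measure_closedBall_lt_top.ne).ne
    by_contra hpos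
    have hle := setLIntegral_fiberWeight_sq_le e ha hq hb hK hφ hframe hE hEfin
      (ENNReal.natCast_ne_top n) fun l hl => hl.2.1
    rw [← lintegral_mul_const _ hwm] at hle
    refine absurd hle (not_le.2 ?_)
    refine setLIntegral_strict_mono hE hpos (hwm.pow_const 2) ?_ (Eventually.of_forall fun l hl => ?_)
    · rw [lintegral_mul_const _ hwm]
      exact ENNReal.mul_ne_top (ne_top_of_le_ne_top hwtot (setLIntegral_le_lintegral _ _))
        ENNReal.ofReal_ne_top
    · rw [sq]
      have h0 : w l ≠ 0 := (pos_of_gt hl.2.2).ne'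
      have ht : w l ≠ ∞ := (hl.2.1.trans_lt (ENNReal.natCast_lt_top n)).ne
      exact ENNReal.mul_lt_mul_right h0 ht hl.2.2
  have hall : ∀ᵐ l, ∀ n : ℕ, ¬ (l ∈ Metric.closedBall 0 (n : ℝ) ∧ w l ≤ n ∧ c < w l) :=
    ae_all_iff.2 fun n => measure_eq_zero_iff_ae_notMem.1 (hnull n)
  filter_upwards [hall, hwfin] with l hl hl'
  by_contra hlt
  obtain ⟨n, hn⟩ := exists_nat_ge ‖l‖
  obtain ⟨m, hm⟩ := ENNReal.exists_nat_gt hl'.ne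
  refine hl (max n m) ⟨?_, ?_, not_le.1 hlt⟩
  · rw [mem_closedBall_zero_iff]
    exact hn.trans (by exact_mod_cast le_max_left n m)
  · exact hm.le.trans (by exact_mod_cast le_max_right n m)

end WeightBound

/-! ### Square integrals of matrix coefficients -/

section MatrixCoefficients

variable (e : AdaptedBasis 𝔫 r d)

theorem measurable_vecMul_inv_B :
    Measurable fun p : (Fin r → ℝ) × (Fin d → ℝ) => p.2 ᵥ* (e.B p.1)⁻¹ := by
  have hadj : Continuous fun p : (Fin r → ℝ) × (Fin d → ℝ) => p.2 ᵥ* (e.B p.1).adjugate :=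
    continuous_snd.matrix_vecMul ((continuous_B e).comp continuous_fst).matrix_adjugate
  have hdet : Measurable fun p : (Fin r → ℝ) × (Fin d → ℝ) => ((e.B p.1).det)⁻¹ :=
    ((continuous_det_B e).comp continuous_fst).measurable.inv
  have h : (fun p : (Fin r → ℝ) × (Fin d → ℝ) => p.2 ᵥ* (e.B p.1)⁻¹) =
      fun p => ((e.B p.1).det)⁻¹ • (p.2 ᵥ* (e.B p.1).adjugate) := by
    ext1 p
    rw [Matrix.inv_def, Ring.inverse_eq_inv', Matrix.vecMul_smul]
  rw [h]
  exact hdet.smul hadj.measurable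

theorem measurePreserving_dualAssoc : MeasurePreserving
    (fun w : ((Fin r → ℝ) × (Fin d → ℝ)) × (Fin d → ℝ) => ((w.1.1, w.1.2, w.2) : Coords r d))
    (((plancherelMeasure e).prod volume).prod volume) ((plancherelMeasure e).prod volume) :=
  measurePreserving_prodAssoc (plancherelMeasure e) (volume : Measure (Fin d → ℝ))
      (volume : Measure (Fin d → ℝ))

theorem integral_mul_comp_fst {α β : Type*} [MeasurableSpace α] [MeasurableSpace β]
    {μ : Measure α} {ν : Measure β} [SFinite μ] [SFinite ν] {c : α → ℂ} (hc : Measurable c)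
    (hc1 : ∀ p, ‖c p‖ ≤ 1) {k : α × β → ℂ} (hk : Integrable k (μ.prod ν)) :
    ∫ w, c w.1 * k w ∂μ.prod ν = ∫ p, c p * ∫ s, k (p, s) ∂ν ∂μ := by
  have hint : Integrable (fun w : α × β => c w.1 * k w) (μ.prod ν) :=
    hk.bdd_mul (hc.comp measurable_fst).aestronglyMeasurable
      (Eventually.of_forall fun w => hc1 w.1)
  rw [integral_prod _ hint]
  simp only [integral_const_mul]

/-- The inequality `∫ |⟨ψ, L(n) φ⟩|² dn ≤ ∫ ‖ψ(l) φ(l)^*‖² dμ(l)`, in terms of integral kernels. -/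
theorem lintegral_enorm_inner_leftRegular_le (φ ψ : L2N e) {F : Coords r d → ℂ}
    (hF : StronglyMeasurable F)
    (hψ : plancherelCLM e ψ =ᵐ[(plancherelMeasure e).prod volume] F) :
    ∫⁻ n, ‖(inner ℂ (leftRegular e n φ) ψ : ℂ)‖ₑ ^ 2 ∂NilGroup.haar e ≤
      ∫⁻ x : Fin d → ℝ, ∫⁻ v : (Fin r → ℝ) × (Fin d → ℝ),
        ‖∫ s, conj (plancherelCLM e φ (v.1, v.2 - x, s)) * F (v.1, v.2, s)‖ₑ ^ 2
          ∂(plancherelMeasure e).prod volume := by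
  set Φ := plancherelCLM e φ with hΦ
  rw [lintegral_enorm_inner_leftRegular,
    ← lintegral_slices (measurable_enorm_inner_leftRegular e φ ψ).aemeasurable]
  refine lintegral_mono fun x => ?_
  -- For fixed `x`, pairing the kernels in `s` leaves a function of `(l, t)`. Transported by `t ↦ t
  -- B(l)`, it has the coefficient in `(z, y)` as its Fourier transform. As a pairing of two `L²`
  -- fields it is only known to be integrable, which is why an inequality results.
  set H : (Fin r → ℝ) × (Fin d → ℝ) → ℂ :=
    fun v => ∫ s, conj (Φ (v.1, v.2 - x, s)) * F (v.1, v.2, s) with hH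
  set k : ((Fin r → ℝ) × (Fin d → ℝ)) × (Fin d → ℝ) → ℂ :=
    fun w => conj (Φ (w.1.1, w.1.2 - x, w.2)) * F (w.1.1, w.1.2, w.2) with hk
  have hkm : StronglyMeasurable k := by
    refine StronglyMeasurable.mul (Complex.continuous_conj.comp_stronglyMeasurable
      ((Lp.stronglyMeasurable Φ).comp_measurable ?_)) (hF.comp_measurable ?_) <;> fun_prop
  have hkint : Integrable k (((plancherelMeasure e).prod volume).prod volume) := by
    have h1 : MemLp (fun w : Coords r d => conj (Φ (dualShift x w))) 2
        ((plancherelMeasure e).prod volume) :=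
      ((Lp.memLp Φ).comp_measurePreserving (measurePreserving_dualShift e x)).star
    have h2 : MemLp F 2 ((plancherelMeasure e).prod volume) :=
      (memLp_congr_ae hψ).1 (Lp.memLp _)
    exact (measurePreserving_dualAssoc e).integrable_comp_of_integrable (h1.integrable_mul h2)
  have hHm : StronglyMeasurable H := hkm.integral_prod_right'
  have hHint : Integrable H ((plancherelMeasure e).prod volume) := hkint.integral_prod_left
  set θ : (Fin r → ℝ) × (Fin d → ℝ) → (Fin r → ℝ) × (Fin d → ℝ) :=
    fun p => (p.1, p.2 ᵥ* e.B p.1) with hθ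
  have hθm : MeasurePreserving θ ((plancherelMeasure e).prod volume) volume :=
    measurePreserving_vecMul_B e
  -- This inverts `θ` off the null set where `det B` vanishes; its values there are irrelevant.
  set h : (Fin r → ℝ) × (Fin d → ℝ) → ℂ := fun p => H (p.1, p.2 ᵥ* (e.B p.1)⁻¹) with hh
  have hhm : StronglyMeasurable h :=
    hHm.comp_measurable (measurable_fst.prodMk (measurable_vecMul_inv_B e))
  have hdet : ∀ᵐ p ∂(plancherelMeasure e).prod (volume : Measure (Fin d → ℝ)),
      (e.B p.1).det ≠ 0 :=
    Measure.quasiMeasurePreserving_fst.ae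
      ((withDensity_absolutelyContinuous _ _).ae_le (ae_det_B_ne_zero e))
  have hhθ : ∀ᵐ p ∂(plancherelMeasure e).prod (volume : Measure (Fin d → ℝ)), h (θ p) = H p := by
    filter_upwards [hdet] with p hp
    simp only [hh, hθ, Matrix.vecMul_vecMul, Matrix.mul_nonsing_inv _ (Ne.isUnit hp),
      Matrix.vecMul_one]
  have hhint : Integrable h := by
    rw [← hθm.map_eq, integrable_map_measure hhm.aestronglyMeasurable hθm.measurable.aemeasurable]
    exact (integrable_congr hhθ).2 hHint
  have hnorm : ∫⁻ p, ‖h p‖ₑ ^ 2 = ∫⁻ p, ‖H p‖ₑ ^ 2 ∂(plancherelMeasure e).prod volume := by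
    rw [← hθm.map_eq, lintegral_map (hhm.enorm.pow_const 2) hθm.measurable]
    refine lintegral_congr_ae ?_
    filter_upwards [hhθ] with p hp
    rw [hp]
  have hcoef : ∀ v : (Fin r → ℝ) × (Fin d → ℝ),
      (inner ℂ (leftRegular e (NilGroup.ofCoords e (v.1, v.2, x)) φ) ψ : ℂ) =
      ∫ p : (Fin r → ℝ) × (Fin d → ℝ), expi (-(v.1 ⬝ᵥ p.1 + v.2 ⬝ᵥ p.2)) * h p := by
    intro v
    have hc : Continuous fun p : (Fin r → ℝ) × (Fin d → ℝ) =>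
        expi (-(v.1 ⬝ᵥ p.1 + v.2 ⬝ᵥ p.2)) := by fun_prop
    have h1 : (inner ℂ (leftRegular e (NilGroup.ofCoords e (v.1, v.2, x)) φ) ψ : ℂ) =
        ∫ w : Coords r d, expi (-(v.1 ⬝ᵥ w.1 + v.2 ⬝ᵥ (w.2.1 ᵥ* e.B w.1))) *
          (conj (Φ (dualShift x w)) * F w) ∂(plancherelMeasure e).prod volume := by
      rw [inner_leftRegular_eq_integral]
      refine integral_congr_ae ?_
      filter_upwards [hψ] with w hw
      rw [hw, map_mul, dualPhase, conj_expi, mul_assoc, Matrix.dotProduct_mulVec,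
        dotProduct_comm w.1, dotProduct_comm _ v.2]
    have hm : AEStronglyMeasurable (fun p : (Fin r → ℝ) × (Fin d → ℝ) =>
        expi (-(v.1 ⬝ᵥ p.1 + v.2 ⬝ᵥ p.2)) * h p)
        (((plancherelMeasure e).prod volume).map θ) :=
      (hc.stronglyMeasurable.mul hhm).aestronglyMeasurable
    have h2 := integral_map (μ := (plancherelMeasure e).prod volume) hθm.measurable.aemeasurable hm
    rw [hθm.map_eq] at h2
    have h3 := integral_mul_comp_fst (c := fun p : (Fin r → ℝ) × (Fin d → ℝ) =>
      expi (-(v.1 ⬝ᵥ (θ p).1 + v.2 ⬝ᵥ (θ p).2))) (hc.measurable.comp hθm.measurable)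
      (fun p => (norm_expi _).le) hkint
    have h4 := (measurePreserving_dualAssoc e).integral_comp
      MeasurableEquiv.prodAssoc.measurableEmbedding fun w : Coords r d =>
        expi (-(v.1 ⬝ᵥ w.1 + v.2 ⬝ᵥ (w.2.1 ᵥ* e.B w.1))) * (conj (Φ (dualShift x w)) * F w)
    rw [h1, h2, ← h4]
    refine h3.trans (integral_congr_ae ?_)
    filter_upwards [hhθ] with p hp
    rw [hp]
  simp only [hcoef]
  rw [← hnorm]
  exact lintegral_enorm_sq_fourier_prod_neg_le hhint

end MatrixCoefficients

/-! ### Jointly measurable representatives of `L²`-valued maps -/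

section JointMeasurability

instance : TopologicalSpace.SeparableSpace (L2 d) :=
  have : Fact ((2 : ℝ≥0∞) ≠ ∞) := ⟨ENNReal.ofNat_ne_top⟩
  inferInstance

/-- A measurable map into `L²` has a jointly measurable representative. -/
theorem exists_stronglyMeasurable_prod {X : Type*} [MeasurableSpace X] (T : X → L2 d)
    (hT : ∀ w : L2 d, Measurable fun x => ‖T x - w‖) :
    ∃ u : X × (Fin d → ℝ) → ℂ, StronglyMeasurable u ∧
      ∀ x, (fun s => u (x, s)) =ᵐ[volume] T x := by
  classical
  set D : ℕ → L2 d := TopologicalSpace.denseSeq (L2 d) with hD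
  have hex : ∀ (n : ℕ) (x : X), ∃ j, ‖T x - D j‖ < (1 / 2 : ℝ) ^ n := fun n x => by
    obtain ⟨j, hj⟩ := (TopologicalSpace.denseRange_denseSeq (L2 d)).exists_dist_lt (T x)
      (ε := (1 / 2 : ℝ) ^ n) (by positivity)
    exact ⟨j, by rwa [dist_eq_norm] at hj⟩
  -- Choosing the first element of a dense sequence within `2⁻ⁿ` of `T x` gives a measurable,
  -- countably valued approximation.
  have hN : ∀ n, Measurable fun x => Nat.find (hex n x) := fun n =>
    measurable_find (hex n) fun k => measurableSet_lt (hT _) measurable_const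
  set v : ℕ → X × (Fin d → ℝ) → ℂ := fun n p => D (Nat.find (hex n p.1)) p.2 with hv
  have hvm : ∀ n, Measurable (v n) := fun n => by
    have h1 : Measurable fun p : ℕ × (Fin d → ℝ) => D p.1 p.2 :=
      measurable_from_prod_countable_right fun j => (Lp.stronglyMeasurable (D j)).measurable
    exact h1.comp (((hN n).comp measurable_fst).prodMk measurable_snd)
  refine ⟨fun p => limUnder atTop fun n => v n p, ?_, fun x => ?_⟩
  · exact StronglyMeasurable.limUnder fun n => (hvm n).stronglyMeasurable
  · have h1 : ∀ n, ∫⁻ s, ‖v n (x, s) - T x s‖ₑ ^ 2 ≤ (ENNReal.ofReal (1 / 4)) ^ n := by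
      intro n
      have h2 : ∫⁻ s, ‖v n (x, s) - T x s‖ₑ ^ 2 = ‖D (Nat.find (hex n x)) - T x‖ₑ ^ 2 := by
        rw [enorm_sq_eq_lintegral]
        refine lintegral_congr_ae ?_
        filter_upwards [Lp.coeFn_sub (D (Nat.find (hex n x))) (T x)] with s hs
        rw [hs, Pi.sub_apply]
      rw [h2, ← ofReal_norm, ← ENNReal.ofReal_pow (norm_nonneg _),
        ← ENNReal.ofReal_pow (by norm_num), norm_sub_rev]
      refine ENNReal.ofReal_le_ofReal ?_
      calc ‖T x - D (Nat.find (hex n x))‖ ^ 2 ≤ ((1 / 2 : ℝ) ^ n) ^ 2 :=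
            pow_le_pow_left₀ (norm_nonneg _) (Nat.find_spec (hex n x)).le 2
        _ = (1 / 4 : ℝ) ^ n := by rw [← pow_mul, mul_comm, pow_mul]; norm_num
    have hmeas : ∀ n, Measurable fun s => ‖v n (x, s) - T x s‖ₑ ^ 2 := fun n =>
      (((hvm n).comp measurable_prodMk_left).sub
        (Lp.stronglyMeasurable (T x)).measurable).enorm.pow_const 2
    -- The squared errors are at most `4⁻ⁿ`, hence summable, so the approximations converge for
    -- almost every `s` without passing to a subsequence.
    have h3 : ∫⁻ s, ∑' n, ‖v n (x, s) - T x s‖ₑ ^ 2 ≠ ∞ := by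
      rw [lintegral_tsum fun n => (hmeas n).aemeasurable]
      refine ne_top_of_le_ne_top ?_ (ENNReal.tsum_le_tsum h1)
      rw [ENNReal.tsum_geometric]
      refine ENNReal.inv_ne_top.2 (tsub_pos_of_lt ?_).ne'
      rw [← ENNReal.ofReal_one]
      exact (ENNReal.ofReal_lt_ofReal_iff one_pos).2 (by norm_num)
    filter_upwards [ae_lt_top (Measurable.tsum hmeas) h3] with s hs
    have h4 := ENNReal.tendsto_atTop_zero_of_tsum_ne_top hs.ne
    refine Tendsto.limUnder_eq ?_
    rw [tendsto_iff_edist_tendsto_0]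
    have h5 := h4.ennrpow_const (1 / 2 : ℝ)
    simp only [edist_eq_enorm_sub]
    refine (h5.congr fun n => ?_).trans (by simp)
    rw [← ENNReal.rpow_natCast, ← ENNReal.rpow_mul]
    norm_num

end JointMeasurability

/-! ### Hilbert-Schmidt operators and the rank bound -/

section KernelOperators

/-- A square-integrable integral kernel, viewed as a function of its first variable with values
in `L²`. -/
theorem ae_exists_slice {k : (Fin d → ℝ) × (Fin d → ℝ) → ℂ} (hk : MemLp k 2) :
    ∀ᵐ t : Fin d → ℝ, ∃ c : L2 d, (∀ u : L2 d, ∫ s, k (t, s) * u s = inner ℂ c u) ∧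
      ‖c‖ₑ ^ 2 = ∫⁻ s, ‖k (t, s)‖ₑ ^ 2 := by
  filter_upwards [ae_memLp_two_of_prod hk] with t ht
  have hs : MemLp (fun s => conj (k (t, s))) 2 := ht.star
  refine ⟨hs.toLp _, fun u => ?_, ?_⟩
  · rw [inner_L2_eq_integral]
    refine integral_congr_ae ?_
    filter_upwards [hs.coeFn_toLp] with s h
    rw [h, Complex.conj_conj]
  · rw [enorm_sq_eq_lintegral]
    refine lintegral_congr_ae ?_
    filter_upwards [hs.coeFn_toLp] with s h
    rw [h, RCLike.enorm_conj]

theorem aestronglyMeasurable_kernel_apply {k : (Fin d → ℝ) × (Fin d → ℝ) → ℂ} (hk : MemLp k 2)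
    (u : L2 d) : AEStronglyMeasurable (fun t => ∫ s, k (t, s) * u s) volume :=
  (hk.1.mul (Lp.aestronglyMeasurable u).comp_snd).integral_prod_right'

theorem lintegral_kernel {k : (Fin d → ℝ) × (Fin d → ℝ) → ℂ} (hk : MemLp k 2) :
    ∫⁻ t : Fin d → ℝ, ∫⁻ s : Fin d → ℝ, ‖k (t, s)‖ₑ ^ 2 = ∫⁻ p, ‖k p‖ₑ ^ 2 :=
  (lintegral_prod _ (hk.1.enorm.pow_const 2)).symm

/-- Bessel's inequality in `s` for almost every `t`, integrated over `t`. -/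
theorem sum_lintegral_kernel_apply_le {k : (Fin d → ℝ) × (Fin d → ℝ) → ℂ} (hk : MemLp k 2)
    {ι : Type*} [Fintype ι] {u : ι → L2 d} (hu : Orthonormal ℂ u) :
    ∑ i, ∫⁻ t, ‖∫ s, k (t, s) * u i s‖ₑ ^ 2 ≤ ∫⁻ p, ‖k p‖ₑ ^ 2 := by
  rw [← lintegral_finsetSum' _ fun i _ =>
    (aestronglyMeasurable_kernel_apply hk (u i)).enorm.pow_const 2, ← lintegral_kernel hk]
  refine lintegral_mono_ae ?_
  filter_upwards [ae_exists_slice hk] with t ⟨c, hc, hc'⟩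
  rw [← hc', ← ofReal_norm, ← ENNReal.ofReal_pow (norm_nonneg _)]
  have h1 := hu.sum_inner_products_le c (s := Finset.univ)
  refine le_trans (le_of_eq ?_) (ENNReal.ofReal_le_ofReal h1)
  rw [ENNReal.ofReal_sum_of_nonneg fun i _ => sq_nonneg _]
  refine Finset.sum_congr rfl fun i _ => ?_
  rw [hc, ← ofReal_norm, ← ENNReal.ofReal_pow (norm_nonneg _), norm_inner_symm]

theorem lintegral_kernel_apply_le {k : (Fin d → ℝ) × (Fin d → ℝ) → ℂ} (hk : MemLp k 2)
    (u : L2 d) : ∫⁻ t, ‖∫ s, k (t, s) * u s‖ₑ ^ 2 ≤ (∫⁻ p, ‖k p‖ₑ ^ 2) * ‖u‖ₑ ^ 2 := by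
  have hfin : ‖u‖ₑ ^ 2 ≠ ∞ := by simp
  rw [← lintegral_kernel hk, ← lintegral_mul_const' _ _ hfin]
  refine lintegral_mono_ae ?_
  filter_upwards [ae_exists_slice hk] with t ⟨c, hc, hc'⟩
  rw [← hc', hc, ← mul_pow]
  gcongr
  rw [← ofReal_norm, ← ofReal_norm, ← ofReal_norm, ← ENNReal.ofReal_mul (norm_nonneg _)]
  exact ENNReal.ofReal_le_ofReal (norm_inner_le_norm c u)

theorem memLp_kernel_apply {k : (Fin d → ℝ) × (Fin d → ℝ) → ℂ} (hk : MemLp k 2)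
    (u : L2 d) : MemLp (fun t => ∫ s, k (t, s) * u s) 2 := by
  refine ⟨aestronglyMeasurable_kernel_apply hk u, ?_⟩
  have h1 : eLpNorm (fun t => ∫ s, k (t, s) * u s) 2 volume ^ 2 < ∞ := by
    rw [eLpNorm_two_sq]
    refine (lintegral_kernel_apply_le hk u).trans_lt (ENNReal.mul_lt_top ?_ (by simp))
    rw [← eLpNorm_two_sq]
    exact ENNReal.pow_lt_top hk.2
  by_contra h2
  rw [not_lt_top_iff.1 h2] at h1
  simp at h1

/-- The Hilbert-Schmidt operator with a given square-integrable integral kernel. -/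
def kernelOperator {k : (Fin d → ℝ) × (Fin d → ℝ) → ℂ} (hk : MemLp k 2) : L2 d →L[ℂ] L2 d :=
  LinearMap.mkContinuous
    { toFun := fun u => (memLp_kernel_apply hk u).toLp _
      map_add' := fun u v => by
        rw [← MemLp.toLp_add]
        refine (MemLp.toLp_eq_toLp_iff _ _).2 ?_
        filter_upwards [ae_exists_slice hk] with t ⟨c, hc, _⟩
        simp only [Pi.add_apply, hc, inner_add_right]
      map_smul' := fun a u => by
        rw [RingHom.id_apply, ← MemLp.toLp_const_smul]
        refine (MemLp.toLp_eq_toLp_iff _ _).2 ?_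
        filter_upwards [ae_exists_slice hk] with t ⟨c, hc, _⟩
        simp only [Pi.smul_apply, hc, inner_smul_right, smul_eq_mul] }
    (eLpNorm k 2 volume).toReal fun u => by
      have h := lintegral_kernel_apply_le hk u
      rw [← eLpNorm_two_sq, ← eLpNorm_two_sq, ← mul_pow] at h
      have h2 := (ENNReal.pow_right_strictMono two_ne_zero).le_iff_le.1 h
      have h3 := ENNReal.toReal_mono (ENNReal.mul_ne_top hk.2.ne enorm_ne_top) h2
      rw [ENNReal.toReal_mul, toReal_enorm] at h3
      simpa [Lp.norm_toLp] using h3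

theorem enorm_sq_kernelOperator {k : (Fin d → ℝ) × (Fin d → ℝ) → ℂ} (hk : MemLp k 2) (u : L2 d) :
    ‖kernelOperator hk u‖ₑ ^ 2 = ∫⁻ t, ‖∫ s, k (t, s) * u s‖ₑ ^ 2 := by
  rw [enorm_sq_eq_lintegral]
  refine lintegral_congr_ae ?_
  filter_upwards [(memLp_kernel_apply hk u).coeFn_toLp] with t ht
  rw [← ht]
  rfl

theorem exists_orthonormal_of_le_rank {H : Type*} [NormedAddCommGroup H] [InnerProductSpace ℂ H]
    (T : H →ₗ[ℂ] H) {n : ℕ} (hn : (n : ℕ∞) ≤ Cardinal.toENat T.rank) :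
    ∃ u : Fin n → H, Orthonormal ℂ u ∧ ∀ i, u i ∈ LinearMap.range T := by
  rw [Cardinal.natCast_le_toENat] at hn
  obtain ⟨s, hs, hli⟩ := le_rank_iff_exists_linearIndependent_finset.1 hn
  set W : Submodule ℂ (LinearMap.range T) := Submodule.span ℂ (s : Set (LinearMap.range T))
  have hfd : FiniteDimensional ℂ W := FiniteDimensional.span_finset ℂ s
  have hrank : Module.finrank ℂ W = n := by
    rw [finrank_span_finset_eq_card hli, hs]
  let ob := (stdOrthonormalBasis ℂ W).reindex (finCongr hrank)
  refine ⟨fun i => ((ob i : LinearMap.range T) : H), ?_, fun i => (ob i : LinearMap.range T).2⟩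
  have h := ob.orthonormal
  exact (h.comp_linearIsometry W.subtypeₗᵢ).comp_linearIsometry (LinearMap.range T).subtypeₗᵢ

/-- Boundedness of the kernel operator extends the hypothesis from the dense set to every vector.
Each orthonormal vector in the range of `P` then contributes at least one to the Bessel sum. -/
theorem rank_le_lintegral_kernel {k : (Fin d → ℝ) × (Fin d → ℝ) → ℂ} (hk : MemLp k 2)
    {P : L2 d →L[ℂ] L2 d} {D : Set (L2 d)} (hD : Dense D)
    (h : ∀ v ∈ D, ‖P v‖ₑ ^ 2 ≤ ∫⁻ t, ‖∫ s, k (t, s) * P v s‖ₑ ^ 2) :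
    ((Cardinal.toENat (LinearMap.rank (P : L2 d →ₗ[ℂ] L2 d)) : ℕ∞) : ℝ≥0∞) ≤
      ∫⁻ p, ‖k p‖ₑ ^ 2 := by
  have hall : ∀ v, ‖P v‖ ≤ ‖kernelOperator hk (P v)‖ := by
    intro v
    have hcl : IsClosed {v | ‖P v‖ ≤ ‖kernelOperator hk (P v)‖} :=
      isClosed_le (by fun_prop) (by fun_prop)
    refine hcl.closure_subset_iff.2 (fun v hv => ?_) (hD v)
    have h1 := h v hv
    rw [← enorm_sq_kernelOperator hk] at h1
    have h2 := (ENNReal.pow_right_strictMono two_ne_zero).le_iff_le.1 h1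
    simpa using ENNReal.toReal_mono enorm_ne_top h2
  have hnat : ∀ n : ℕ, (n : ℕ∞) ≤ Cardinal.toENat (LinearMap.rank (P : L2 d →ₗ[ℂ] L2 d)) →
      (n : ℝ≥0∞) ≤ ∫⁻ p, ‖k p‖ₑ ^ 2 := by
    intro n hn
    obtain ⟨u, hu, huP⟩ := exists_orthonormal_of_le_rank _ hn
    refine le_trans ?_ (sum_lintegral_kernel_apply_le hk hu)
    have h1 : ∀ i, (1 : ℝ≥0∞) ≤ ∫⁻ t, ‖∫ s, k (t, s) * u i s‖ₑ ^ 2 := by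
      intro i
      obtain ⟨v, hv⟩ := huP i
      have hPv : P v = u i := hv
      have h2 := hall v
      rw [hPv, hu.1 i] at h2
      rw [← enorm_sq_kernelOperator hk, ← ofReal_norm]
      exact one_le_pow₀ (ENNReal.one_le_ofReal.2 h2)
    calc (n : ℝ≥0∞) = ∑ _i : Fin n, (1 : ℝ≥0∞) := by simp
      _ ≤ _ := Finset.sum_le_sum fun i _ => h1 i
  -- Finite lower bounds for the rank suffice: an infinite rank forces the integral above every
  -- natural number.
  generalize Cardinal.toENat (LinearMap.rank (P : L2 d →ₗ[ℂ] L2 d)) = m at hnat ⊢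
  induction m using ENat.recTopCoe with
  | top =>
    rw [ENat.toENNReal_top, top_le_iff]
    exact ENNReal.eq_top_of_forall_nnreal_le fun x => by
      obtain ⟨n, hn⟩ := exists_nat_ge x
      exact le_trans (by exact_mod_cast hn) (hnat n le_top)
  | coe n => simpa using hnat n le_rfl

end KernelOperators

/-! ### Measurability of fields of projections -/

section ProjectionFields

variable {I : Set (Fin r → ℝ)} {P : (Fin r → ℝ) → L2 d →L[ℂ] L2 d}

theorem norm_sq_apply_of_isStarProjection {Q : L2 d →L[ℂ] L2 d} (hQ : IsStarProjection Q)
    (v : L2 d) : ‖Q v‖ ^ 2 = (inner ℂ v (Q v) : ℂ).re := by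
  have h1 : (inner ℂ (Q v) (Q v) : ℂ) = inner ℂ v (Q v) := by
    rw [← ContinuousLinearMap.adjoint_inner_right, ← ContinuousLinearMap.star_eq_adjoint,
      hQ.isSelfAdjoint.star_eq, ← mul_apply_eq_comp, hQ.isIdempotentElem.eq]
  rw [← h1]
  exact (inner_self_eq_norm_sq (𝕜 := ℂ) (Q v)).symm

theorem norm_apply_le_of_isStarProjection {Q : L2 d →L[ℂ] L2 d} (hQ : IsStarProjection Q)
    (v : L2 d) : ‖Q v‖ ≤ ‖v‖ := by
  have h1 : ‖Q v‖ ^ 2 ≤ ‖v‖ * ‖Q v‖ := by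
    rw [norm_sq_apply_of_isStarProjection hQ]
    exact (Complex.re_le_norm _).trans (norm_inner_le_norm _ _)
  rcases (norm_nonneg (Q v)).eq_or_lt with h | h
  · rw [← h]
    exact norm_nonneg v
  · exact le_of_mul_le_mul_right (by rwa [← sq]) h

/-- The field of vectors `l ↦ P_l v`, extended by zero outside of `I`. -/
def projectedField (I : Set (Fin r → ℝ)) (P : (Fin r → ℝ) → L2 d →L[ℂ] L2 d) (v : L2 d)
    (l : Fin r → ℝ) : L2 d :=
  I.indicator (fun l => P l v) l

theorem norm_projectedField_le (hP : IsProjectionField I P) (v : L2 d) (l : Fin r → ℝ) :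
    ‖projectedField I P v l‖ ≤ ‖v‖ := by
  by_cases hl : l ∈ I
  · rw [projectedField, Set.indicator_of_mem hl]
    exact norm_apply_le_of_isStarProjection (hP.isStarProjection l hl) v
  · rw [projectedField, Set.indicator_of_notMem hl, norm_zero]
    exact norm_nonneg v

/-- For a projection, `‖P v‖² = Re ⟨v, P v⟩`, so expanding the square expresses this distance
through weakly measurable inner products only. -/
theorem measurable_norm_projectedField_sub (hI : MeasurableSet I) (hP : IsProjectionField I P)
    (v w : L2 d) : Measurable fun l => ‖projectedField I P v l - w‖ := by
  have hin : ∀ u, Measurable fun l => (inner ℂ u (projectedField I P v l) : ℂ) := by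
    intro u
    refine measurable_of_restrict_of_restrict_compl hI ?_ ?_
    · convert hP.measurable u v using 1
      ext l
      simp [projectedField]
    · convert (measurable_const : Measurable fun _ : (Iᶜ : Set (Fin r → ℝ)) => (0 : ℂ)) using 1
      ext l
      have hl : (l : Fin r → ℝ) ∉ I := l.2
      simp [projectedField, hl]
  have hn : ∀ l, ‖projectedField I P v l‖ ^ 2 = (inner ℂ v (projectedField I P v l) : ℂ).re := by
    intro l
    by_cases hl : l ∈ I
    · simp only [projectedField, Set.indicator_of_mem hl]
      exact norm_sq_apply_of_isStarProjection (hP.isStarProjection l hl) v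
    · simp [projectedField, Set.indicator_of_notMem hl]
  have h : (fun l => ‖projectedField I P v l - w‖) = fun l =>
      √((inner ℂ v (projectedField I P v l) : ℂ).re -
        2 * (inner ℂ w (projectedField I P v l) : ℂ).re + ‖w‖ ^ 2) := by
    ext1 l
    have h1 := norm_sub_sq (𝕜 := ℂ) (projectedField I P v l) w
    rw [inner_re_symm, hn] at h1
    exact (Real.sqrt_sq (norm_nonneg _)).symm.trans (congrArg _ h1)
  rw [h]
  exact ((((Complex.measurable_re.comp (hin v)).sub
    ((Complex.measurable_re.comp (hin w)).const_mul 2)).add_const _)).sqrt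

theorem exists_projectedField_repr (hI : MeasurableSet I) (hP : IsProjectionField I P) (v : L2 d) :
    ∃ u : (Fin r → ℝ) × (Fin d → ℝ) → ℂ, StronglyMeasurable u ∧
      ∀ l, (fun s => u (l, s)) =ᵐ[volume] projectedField I P v l :=
  exists_stronglyMeasurable_prod _ (measurable_norm_projectedField_sub hI hP v)

end ProjectionFields

/-! ### The multiplicity is bounded by the fiber norm -/

section Multiplicity

variable (e : AdaptedBasis 𝔫 r d) {I : Set (Fin r → ℝ)} {P : (Fin r → ℝ) → L2 d →L[ℂ] L2 d}

theorem plancherelMeasure_lt_top_of_isBounded (hI : Bornology.IsBounded I) :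
    plancherelMeasure e I < ∞ := by
  obtain ⟨R, hR⟩ := hI.subset_closedBall 0
  refine (measure_mono hR).trans_lt ?_
  rw [plancherelMeasure, withDensity_apply _ Metric.isClosed_closedBall.measurableSet]
  obtain ⟨C, hC⟩ := (isCompact_closedBall (0 : Fin r → ℝ) R).exists_bound_of_continuousOn
    (continuous_det_B e).continuousOn
  calc ∫⁻ l in Metric.closedBall 0 R, ENNReal.ofReal |(e.B l).det|
      ≤ ∫⁻ _ in Metric.closedBall (0 : Fin r → ℝ) R, ENNReal.ofReal C :=
        setLIntegral_mono measurable_const fun l hl => ENNReal.ofReal_le_ofReal (hC l hl)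
    _ < ∞ := by
        rw [setLIntegral_const]
        exact ENNReal.mul_lt_top ENNReal.ofReal_lt_top
          (isCompact_closedBall (0 : Fin r → ℝ) R).measure_lt_top

/-- The kernel, over `E`, of the field of rank one operators `1_Q ⊗ u_l`, where `Q` is the unit
cube. -/
def cubeTensor (E : Set (Fin r → ℝ)) (u : (Fin r → ℝ) × (Fin d → ℝ) → ℂ) (w : Coords r d) : ℂ :=
  E.indicator 1 w.1 * ((box fun _ => 1).indicator 1 w.2.1 * conj (u (w.1, w.2.2)))

theorem stronglyMeasurable_cubeTensor {E : Set (Fin r → ℝ)} (hE : MeasurableSet E)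
    {u : (Fin r → ℝ) × (Fin d → ℝ) → ℂ} (hu : StronglyMeasurable u) :
    StronglyMeasurable (cubeTensor E u) := by
  have h1 : Measurable fun w : Coords r d => E.indicator (1 : (Fin r → ℝ) → ℂ) w.1 :=
    (measurable_one.indicator hE).comp measurable_fst
  have h2 : Measurable fun w : Coords r d =>
      (box fun _ => 1).indicator (1 : (Fin d → ℝ) → ℂ) w.2.1 :=
    (measurable_one.indicator (measurableSet_box _)).comp measurable_snd.fst
  have h3 : Measurable fun w : Coords r d => conj (u (w.1, w.2.2)) :=
    Complex.continuous_conj.measurable.comp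
      (hu.measurable.comp (measurable_fst.prodMk measurable_snd.snd))
  exact (h1.mul (h2.mul h3)).stronglyMeasurable

theorem enorm_indicator_one_sq {α : Type*} (s : Set α) (x : α) :
    ‖s.indicator (1 : α → ℂ) x‖ₑ ^ 2 = s.indicator 1 x := by
  by_cases h : x ∈ s <;> simp [h]

theorem volume_unit_box : volume (box (fun _ => 1) : Set (Fin d → ℝ)) = 1 := by
  rw [volume_box fun _ => one_pos]
  simp

theorem lintegral_enorm_sq_cubeTensor {E : Set (Fin r → ℝ)} (hE : MeasurableSet E)
    {u : (Fin r → ℝ) × (Fin d → ℝ) → ℂ} (hu : StronglyMeasurable u) :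
    ∫⁻ w, ‖cubeTensor E u w‖ₑ ^ 2 ∂(plancherelMeasure e).prod volume =
      ∫⁻ l in E, (∫⁻ s, ‖u (l, s)‖ₑ ^ 2) ∂plancherelMeasure e := by
  have h1 := lintegral_prod (μ := plancherelMeasure e) (ν := volume)
    (fun w : Coords r d => ‖cubeTensor E u w‖ₑ ^ 2)
    ((stronglyMeasurable_cubeTensor hE hu).enorm.pow_const 2).aemeasurable
  rw [h1, ← lintegral_indicator hE]
  refine lintegral_congr fun l => ?_
  have h2 : ∀ p : (Fin d → ℝ) × (Fin d → ℝ), ‖cubeTensor E u (l, p)‖ₑ ^ 2 =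
      E.indicator 1 l * ((box fun _ => 1).indicator 1 p.1 * ‖u (l, p.2)‖ₑ ^ 2) := by
    intro p
    simp only [cubeTensor, enorm_mul, mul_pow, enorm_indicator_one_sq, RCLike.enorm_conj]
  have hul : Measurable fun s => ‖u (l, s)‖ₑ ^ 2 :=
    (hu.comp_measurable measurable_prodMk_left).enorm.pow_const 2
  have hQ : Measurable ((box fun _ => 1).indicator (1 : (Fin d → ℝ) → ℝ≥0∞)) :=
    measurable_one.indicator (measurableSet_box _)
  have h3 : ∫⁻ p : (Fin d → ℝ) × (Fin d → ℝ),
      (box fun _ => 1).indicator 1 p.1 * ‖u (l, p.2)‖ₑ ^ 2 = ∫⁻ s, ‖u (l, s)‖ₑ ^ 2 := by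
    refine (lintegral_prod_mul hQ.aemeasurable hul.aemeasurable).trans ?_
    rw [lintegral_indicator_one (measurableSet_box _), volume_unit_box, one_mul]
  simp only [h2]
  have h4 : Measurable fun p : (Fin d → ℝ) × (Fin d → ℝ) =>
      (box fun _ => 1).indicator (1 : (Fin d → ℝ) → ℝ≥0∞) p.1 * ‖u (l, p.2)‖ₑ ^ 2 :=
    (hQ.comp measurable_fst).mul (hul.comp measurable_snd)
  rw [lintegral_const_mul _ h4, h3]
  by_cases hl : l ∈ E <;> simp [hl]

theorem lintegral_kernel_cubeTensor {Φ : Coords r d → ℂ} (hΦ : StronglyMeasurable Φ)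
    {E : Set (Fin r → ℝ)} (hE : MeasurableSet E)
    {u : (Fin r → ℝ) × (Fin d → ℝ) → ℂ} (hu : StronglyMeasurable u) :
    ∫⁻ x : Fin d → ℝ, ∫⁻ v : (Fin r → ℝ) × (Fin d → ℝ),
        ‖∫ s, conj (Φ (v.1, v.2 - x, s)) * cubeTensor E u (v.1, v.2, s)‖ₑ ^ 2
          ∂(plancherelMeasure e).prod volume =
      ∫⁻ l in E, (∫⁻ t, ‖∫ s, Φ (l, t, s) * u (l, s)‖ₑ ^ 2) ∂plancherelMeasure e := by
  set A : (Fin r → ℝ) × (Fin d → ℝ) → ℝ≥0∞ := fun p => ‖∫ s, Φ (p.1, p.2, s) * u (p.1, s)‖ₑ ^ 2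
    with hA
  have hAm : Measurable A := by
    have h1 : StronglyMeasurable fun w : ((Fin r → ℝ) × (Fin d → ℝ)) × (Fin d → ℝ) =>
        Φ (w.1.1, w.1.2, w.2) * u (w.1.1, w.2) :=
      (hΦ.comp_measurable (by fun_prop)).mul (hu.comp_measurable (by fun_prop))
    exact h1.integral_prod_right'.enorm.pow_const 2
  have hQ : Measurable ((box fun _ => 1).indicator (1 : (Fin d → ℝ) → ℝ≥0∞)) :=
    measurable_one.indicator (measurableSet_box _)
  have hEm : Measurable (E.indicator (1 : (Fin r → ℝ) → ℝ≥0∞)) := measurable_one.indicator hE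
  have h2 : ∀ (x : Fin d → ℝ) (v : (Fin r → ℝ) × (Fin d → ℝ)),
      ‖∫ s, conj (Φ (v.1, v.2 - x, s)) * cubeTensor E u (v.1, v.2, s)‖ₑ ^ 2 =
      E.indicator 1 v.1 * (box fun _ => 1).indicator 1 v.2 * A (v.1, v.2 - x) := by
    intro x v
    have h3 : ∀ s, conj (Φ (v.1, v.2 - x, s)) * cubeTensor E u (v.1, v.2, s) =
        (E.indicator 1 v.1 * (box fun _ => 1).indicator 1 v.2) *
          conj (Φ (v.1, v.2 - x, s) * u (v.1, s)) := by
      intro s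
      simp only [cubeTensor, map_mul]
      ring
    simp only [h3]
    rw [integral_const_mul, integral_conj, enorm_mul, enorm_mul, mul_pow, mul_pow,
      enorm_indicator_one_sq, enorm_indicator_one_sq, RCLike.enorm_conj]
  simp only [h2]
  -- Integrating over `x` first turns `t - x` into a free variable, decoupling it from the cube,
  -- whose indicator then integrates to one.
  rw [lintegral_lintegral_swap]
  swap
  · refine Measurable.aemeasurable ?_
    refine ((hEm.comp measurable_snd.fst).mul (hQ.comp measurable_snd.snd)).mul (hAm.comp ?_)
    exact measurable_snd.fst.prodMk (measurable_snd.snd.sub measurable_fst)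
  have h4 : ∀ v : (Fin r → ℝ) × (Fin d → ℝ),
      ∫⁻ x, E.indicator 1 v.1 * (box fun _ => 1).indicator 1 v.2 * A (v.1, v.2 - x) =
      E.indicator 1 v.1 * (∫⁻ t, A (v.1, t)) * (box fun _ => 1).indicator 1 v.2 := by
    intro v
    have h5 : Measurable fun t => A (v.1, t) := hAm.comp measurable_prodMk_left
    have h7 : Measurable fun x => A (v.1, v.2 - x) := h5.comp (measurable_const.sub measurable_id)
    rw [lintegral_const_mul _ h7,
      lintegral_sub_left_eq_self (fun t => A (v.1, t)) v.2]
    ring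
  simp only [h4]
  have h6 : Measurable fun l => E.indicator 1 l * ∫⁻ t, A (l, t) :=
    hEm.mul hAm.lintegral_prod_right'
  rw [lintegral_prod_mul h6.aemeasurable hQ.aemeasurable,
    lintegral_indicator_one (measurableSet_box _), volume_unit_box, mul_one,
    ← lintegral_indicator hE]
  refine lintegral_congr fun l => ?_
  by_cases hl : l ∈ E <;> simp [hl, hA]

variable {K : Submodule ℂ (L2N e)} {φ : L2N e}

theorem memLp_cubeTensor (hP : IsProjectionField I P) {E : Set (Fin r → ℝ)} (hE : MeasurableSet E)
    (hEfin : plancherelMeasure e E ≠ ∞) {v : L2 d} {u : (Fin r → ℝ) × (Fin d → ℝ) → ℂ}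
    (hu : StronglyMeasurable u) (huv : ∀ l, (fun s => u (l, s)) =ᵐ[volume] projectedField I P v l) :
    MemLp (cubeTensor E u) 2 ((plancherelMeasure e).prod volume) := by
  refine ⟨(stronglyMeasurable_cubeTensor hE hu).aestronglyMeasurable, ?_⟩
  have h1 : ∀ l, ∫⁻ s, ‖u (l, s)‖ₑ ^ 2 ≤ ‖v‖ₑ ^ 2 := by
    intro l
    have h0 : ∫⁻ s, ‖u (l, s)‖ₑ ^ 2 = ∫⁻ s, ‖projectedField I P v l s‖ₑ ^ 2 :=
      lintegral_congr_ae ((huv l).fun_comp fun z => ‖z‖ₑ ^ 2)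
    rw [h0, ← enorm_sq_eq_lintegral, ← ofReal_norm, ← ofReal_norm]
    gcongr
    exact norm_projectedField_le hP v l
  have h2 : eLpNorm (cubeTensor E u) 2 ((plancherelMeasure e).prod volume) ^ 2 < ∞ := by
    rw [eLpNorm_two_sq, lintegral_enorm_sq_cubeTensor e hE hu]
    refine (lintegral_mono fun l => h1 l).trans_lt ?_
    rw [setLIntegral_const]
    exact ENNReal.mul_lt_top (by simp) hEfin.lt_top
  by_contra h3
  rw [not_lt_top_iff.1 h3] at h2
  simp at h2

theorem cubeTensor_mem_directIntegral {E : Set (Fin r → ℝ)} (hEI : E ⊆ I) {v : L2 d}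
    {u : (Fin r → ℝ) × (Fin d → ℝ) → ℂ}
    (huv : ∀ l, (fun s => u (l, s)) =ᵐ[volume] projectedField I P v l) {G : L2Dual e}
    (hG : G =ᵐ[(plancherelMeasure e).prod volume] cubeTensor E u) : G ∈ directIntegral e I P := by
  refine mem_directIntegral_of_ae_eq e hG (Eventually.of_forall fun l => ⟨fun hl => ?_, fun hl => ?_⟩)
  · refine Eventually.of_forall fun t => ?_
    by_cases h : l ∈ E ∧ t ∈ box fun _ => 1
    · refine ⟨P l v, ⟨v, rfl⟩, ?_⟩
      filter_upwards [huv l] with s hs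
      rw [projectedField, Set.indicator_of_mem hl] at hs
      simp [cubeTensor, h.1, h.2, hs]
    · refine ⟨0, ⟨0, map_zero _⟩, ?_⟩
      filter_upwards [Lp.coeFn_zero ℂ 2 (volume : Measure (Fin d → ℝ))] with s hs
      rw [hs]
      rcases not_and_or.1 h with h | h <;> simp [cubeTensor, h]
  · have h : l ∉ E := fun h => hl (hEI h)
    exact Eventually.of_forall fun t => Eventually.of_forall fun s => by simp [cubeTensor, h]

theorem setLIntegral_projectedField_le (hP : IsProjectionField I P)
    (hK : plancherel e '' (K : Set (L2N e)) = directIntegral e I P)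
    (hφ : IsContinuousWavelet e K φ) {E : Set (Fin r → ℝ)} (hE : MeasurableSet E) (hEI : E ⊆ I)
    (hEfin : plancherelMeasure e E ≠ ∞) {v : L2 d} {u : (Fin r → ℝ) × (Fin d → ℝ) → ℂ}
    (hu : StronglyMeasurable u)
    (huv : ∀ l, (fun s => u (l, s)) =ᵐ[volume] projectedField I P v l) :
    ∫⁻ l in E, (∫⁻ s, ‖u (l, s)‖ₑ ^ 2) ∂plancherelMeasure e ≤
      ∫⁻ l in E, (∫⁻ t, ‖∫ s, plancherelCLM e φ (l, t, s) * u (l, s)‖ₑ ^ 2)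
        ∂plancherelMeasure e := by
  have hF := memLp_cubeTensor e hP hE hEfin hu huv
  obtain ⟨ψ, hψK, hψ⟩ := exists_mem_of_image_eq e hK
    (cubeTensor_mem_directIntegral e hEI huv hF.coeFn_toLp)
  have hψ' : plancherelCLM e ψ =ᵐ[(plancherelMeasure e).prod volume] cubeTensor E u := by
    rw [hψ]
    exact hF.coeFn_toLp
  have h1 : ‖ψ‖ₑ ^ 2 = ∫⁻ l in E, (∫⁻ s, ‖u (l, s)‖ₑ ^ 2) ∂plancherelMeasure e := by
    rw [← lintegral_enorm_sq_cubeTensor e hE hu, ← ofReal_norm, ← norm_plancherelCLM, ofReal_norm,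
      enorm_sq_eq_lintegral]
    exact lintegral_congr_ae (hψ'.fun_comp fun z => ‖z‖ₑ ^ 2)
  rw [← h1, ← hφ.2 ψ hψK,
    ← lintegral_kernel_cubeTensor e (Lp.stronglyMeasurable (plancherelCLM e φ)) hE hu]
  exact lintegral_enorm_inner_leftRegular_le e φ ψ (stronglyMeasurable_cubeTensor hE hu) hψ'

theorem ae_enorm_sq_apply_le (hImeas : MeasurableSet I) (hIbdd : Bornology.IsBounded I)
    (hP : IsProjectionField I P)
    (hK : plancherel e '' (K : Set (L2N e)) = directIntegral e I P)
    (hφ : IsContinuousWavelet e K φ) (v : L2 d) :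
    ∀ᵐ l ∂(plancherelMeasure e).restrict I,
      ‖P l v‖ₑ ^ 2 ≤ ∫⁻ t, ‖∫ s, plancherelCLM e φ (l, t, s) * P l v s‖ₑ ^ 2 := by
  obtain ⟨u, hu, huv⟩ := exists_projectedField_repr hImeas hP v
  have hfin : plancherelMeasure e I < ∞ := plancherelMeasure_lt_top_of_isBounded e hIbdd
  have : IsFiniteMeasure ((plancherelMeasure e).restrict I) :=
    ⟨by rwa [Measure.restrict_apply_univ]⟩
  have h1 : Measurable fun l => ∫⁻ s, ‖u (l, s)‖ₑ ^ 2 :=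
    (hu.enorm.pow_const 2).lintegral_prod_right'
  have h2 : (fun l => ∫⁻ s, ‖u (l, s)‖ₑ ^ 2) ≤ᵐ[(plancherelMeasure e).restrict I]
      fun l => ∫⁻ t, ‖∫ s, plancherelCLM e φ (l, t, s) * u (l, s)‖ₑ ^ 2 := by
    refine ae_le_of_forall_setLIntegral_le_of_sigmaFinite h1 fun E hE _ => ?_
    rw [Measure.restrict_restrict hE]
    exact setLIntegral_projectedField_le e hP hK hφ (hE.inter hImeas) Set.inter_subset_right
      ((measure_mono Set.inter_subset_right).trans_lt hfin).ne hu huv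
  filter_upwards [h2, ae_restrict_mem hImeas] with l hl hlI
  have h3 := huv l
  rw [projectedField, Set.indicator_of_mem hlI] at h3
  have h4 : ∫⁻ s, ‖u (l, s)‖ₑ ^ 2 = ∫⁻ s, ‖P l v s‖ₑ ^ 2 :=
    lintegral_congr_ae (h3.fun_comp fun z => ‖z‖ₑ ^ 2)
  rw [enorm_sq_eq_lintegral, ← h4]
  refine hl.trans (le_of_eq (lintegral_congr fun t => ?_))
  have h5 : ∫ s, plancherelCLM e φ (l, t, s) * u (l, s) =
      ∫ s, plancherelCLM e φ (l, t, s) * P l v s :=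
    integral_congr_ae (h3.mono fun s hs => congrArg _ hs)
  rw [h5]

/-- The exceptional null set of the vectorwise estimate depends on `v`; restricting to a dense
sequence gives one null set for all of them. -/
theorem ae_multiplicity_le_fiberNormSq (hImeas : MeasurableSet I) (hIbdd : Bornology.IsBounded I)
    (hP : IsProjectionField I P)
    (hK : plancherel e '' (K : Set (L2N e)) = directIntegral e I P)
    (hφ : IsContinuousWavelet e K φ) :
    ∀ᵐ l ∂(plancherelMeasure e).restrict I,
      ((multiplicity P l : ℕ∞) : ℝ≥0∞) ≤ fiberNormSq e (plancherelCLM e φ) l := by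
  have h1 := ae_all_iff.2 fun n => ae_enorm_sq_apply_le e hImeas hIbdd hP hK hφ
    (TopologicalSpace.denseSeq (L2 d) n)
  filter_upwards [h1, ae_restrict_of_ae (ae_memLp_two_of_prod (Lp.memLp (plancherelCLM e φ)))]
    with l hl hlp
  refine rank_le_lintegral_kernel hlp (TopologicalSpace.denseRange_denseSeq (L2 d)) ?_
  rintro _ ⟨n, rfl⟩
  exact hl n

end Multiplicity

/-! ### Assembling the two bounds -/

section Conclusion

variable (e : AdaptedBasis 𝔫 r d) {I : Set (Fin r → ℝ)} {P : (Fin r → ℝ) → L2 d →L[ℂ] L2 d}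
  {K : Submodule ℂ (L2N e)} {φ : L2N e} {a : Fin r → ℝ} {q b : Fin d → ℝ}

theorem ae_eq_indicator_of_mem_directIntegral {G : L2Dual e} (hI : MeasurableSet I)
    (hG : G ∈ directIntegral e I P) :
    G =ᵐ[(plancherelMeasure e).prod volume] (Prod.fst ⁻¹' I).indicator G := by
  refine ae_eq_of_ae_ae_eq (Lp.aestronglyMeasurable G)
    ((Lp.aestronglyMeasurable G).indicator (measurable_fst hI)) ?_
  filter_upwards [hG] with l hl
  by_cases h : l ∈ I
  · exact Eventually.of_forall fun p => (Set.indicator_of_mem (s := Prod.fst ⁻¹' I) h _).symm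
  · have h1 : (fun p : (Fin d → ℝ) × (Fin d → ℝ) => G (l, p)) =ᵐ[volume.prod volume] 0 :=
      ae_eq_of_ae_ae_eq
        ((Lp.stronglyMeasurable G).comp_measurable measurable_prodMk_left).aestronglyMeasurable
        aestronglyMeasurable_zero (hl.2 h)
    refine h1.mono fun p hp => ?_
    rw [Set.indicator_of_notMem (s := Prod.fst ⁻¹' I) h]
    exact hp

/-- The Plancherel density is positive almost everywhere, so its null sets are Lebesgue null. -/
theorem ae_restrict_of_ae_restrict_plancherelMeasure {p : (Fin r → ℝ) → Prop}
    (hI : MeasurableSet I) (h : ∀ᵐ l ∂(plancherelMeasure e).restrict I, p l) :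
    ∀ᵐ l ∂volume.restrict I, p l := by
  rw [ae_restrict_iff' hI] at h ⊢
  rw [plancherelMeasure,
    ae_withDensity_iff (continuous_det_B e).measurable.abs.ennreal_ofReal] at h
  filter_upwards [h, ae_det_B_ne_zero e] with l hl hdet
  exact hl (ENNReal.ofReal_pos.2 (abs_pos.2 hdet)).ne'

theorem ae_multiplicity_le (hImeas : MeasurableSet I) (hIbdd : Bornology.IsBounded I)
    (ha : ∀ j, 0 < a j) (hq : ∀ j, 0 < q j) (hb : ∀ j, 0 < b j) (hP : IsProjectionField I P)
    (hK : plancherel e '' (K : Set (L2N e)) = directIntegral e I P)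
    (hφ : IsContinuousWavelet e K φ)
    (hframe : IsParsevalFrame K (fun γ : quasiLattice e a q b => leftRegular e γ.1 φ)) :
    ∀ᵐ l ∂volume.restrict I, ((multiplicity P l : ℕ∞) : ℝ≥0∞) ≤
      ENNReal.ofReal (1 / ((∏ j, a j) * |(e.B l).det|)) := by
  filter_upwards [ae_restrict_of_ae_restrict_plancherelMeasure e hImeas
      (ae_multiplicity_le_fiberNormSq e hImeas hIbdd hP hK hφ),
    ae_restrict_of_ae (ae_fiberWeight_le e ha hq hb hK hφ.1 hframe),
    ae_restrict_of_ae (ae_det_B_ne_zero e)] with l h1 h2 h3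
  have hpos : 0 < |(e.B l).det| := abs_pos.2 h3
  refine h1.trans ?_
  rw [one_div, mul_inv, ← div_eq_mul_inv, ENNReal.ofReal_div_of_pos hpos,
    ENNReal.le_div_iff_mul_le (Or.inl (ENNReal.ofReal_pos.2 hpos).ne')
      (Or.inl ENNReal.ofReal_ne_top), mul_comm]
  exact h2

theorem norm_sq_le_setIntegral (hImeas : MeasurableSet I) (hIbdd : Bornology.IsBounded I)
    (ha : ∀ j, 0 < a j) (hq : ∀ j, 0 < q j) (hb : ∀ j, 0 < b j)
    (hK : plancherel e '' (K : Set (L2N e)) = directIntegral e I P)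
    (hφ : IsContinuousWavelet e K φ)
    (hframe : IsParsevalFrame K (fun γ : quasiLattice e a q b => leftRegular e γ.1 φ)) :
    ‖φ‖ ^ 2 ≤ ∫ _ in I, (∏ j, b j) * (∏ j, q j) := by
  have hA : 0 < ∏ j, a j := Finset.prod_pos fun j _ => ha j
  have hQ : 0 < ∏ j, q j := Finset.prod_pos fun j _ => hq j
  have hB : 0 < ∏ j, b j := Finset.prod_pos fun j _ => hb j
  have hvol : volume I ≠ ∞ := hIbdd.measure_lt_top.ne
  rw [setIntegral_const, smul_eq_mul, measureReal_def]
  -- The volume-one identity comes from cancelling `‖φ‖²`, so the zero vector is treated apart.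
  rcases eq_or_ne φ 0 with rfl | hφ0
  · rw [norm_zero, zero_pow two_ne_zero]
    positivity
  have h1 : ‖φ‖ₑ ^ 2 ≤ ENNReal.ofReal (∏ j, a j)⁻¹ * volume I := by
    rw [← ofReal_norm, ← norm_plancherelCLM, ofReal_norm,
      enorm_sq_eq_setLIntegral_fiberWeight e hImeas
        (ae_eq_indicator_of_mem_directIntegral e hImeas ((mem_iff_of_image_eq e hK φ).1 hφ.1)),
      ← setLIntegral_const]
    exact lintegral_mono_ae (ae_restrict_of_ae (ae_fiberWeight_le e ha hq hb hK hφ.1 hframe))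
  have h2 : ‖φ‖ ^ 2 ≤ (∏ j, a j)⁻¹ * (volume I).toReal := by
    have h := ENNReal.toReal_mono (ENNReal.mul_ne_top ENNReal.ofReal_ne_top hvol) h1
    rwa [ENNReal.toReal_pow, toReal_enorm, ENNReal.toReal_mul,
      ENNReal.toReal_ofReal (by positivity)] at h
  have h3 := congrArg ENNReal.toReal (volume_box_mul_enorm_sq e ha hq hb hK hφ hframe hφ.1)
  rw [ENNReal.toReal_mul, ENNReal.toReal_pow, toReal_enorm,
    ENNReal.toReal_ofReal (by positivity)] at h3
  have h4 : (∏ j, a j)⁻¹ * ((∏ j, q j)⁻¹ * (∏ j, b j)⁻¹) = 1 := by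
    have h5 : ‖φ‖ ^ 2 ≠ 0 := pow_ne_zero _ (norm_ne_zero_iff.2 hφ0)
    exact mul_left_cancel₀ h5 (by rw [mul_one]; exact h3.symm)
  have h6 : (∏ j, a j)⁻¹ = (∏ j, b j) * ∏ j, q j := by
    field_simp at h4 ⊢
    linarith
  rw [← h6, mul_comm]
  exact h2

end Conclusion

end TwoStep

end

theorem mainTheorem6 {𝔫 : Type*} [LieRing 𝔫] [LieAlgebra ℝ 𝔫] {r d : ℕ} (hd : 0 < d)
    (e : TwoStep.AdaptedBasis 𝔫 r d)
    (a : Fin r → ℝ) (q b : Fin d → ℝ) (ha : ∀ j, 0 < a j) (hq : ∀ j, 0 < q j) (hb : ∀ j, 0 < b j)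
    (I : Set (Fin r → ℝ)) (hImeas : MeasurableSet I) (hIbdd : Bornology.IsBounded I)
    (hI : I ⊆ e.crossSection)
    (P : (Fin r → ℝ) → TwoStep.L2 d →L[ℂ] TwoStep.L2 d) (hP : TwoStep.IsProjectionField I P)
    (K : Submodule ℂ (TwoStep.L2N e))
    (hK : TwoStep.plancherel e '' (K : Set (TwoStep.L2N e)) = TwoStep.directIntegral e I P)
    (φ : TwoStep.L2N e) (hφ : TwoStep.IsContinuousWavelet e K φ)
    (hframe : TwoStep.IsParsevalFrame K
      (fun γ : TwoStep.quasiLattice e a q b => TwoStep.leftRegular e (γ : TwoStep.NilGroup e) φ)) :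
    (∀ᵐ l ∂(volume.restrict I),
      ((TwoStep.multiplicity P l : ℕ∞) : ℝ≥0∞) ≤
        ENNReal.ofReal (1 / ((∏ j, a j) * |(e.B l).det|))) ∧
    ‖φ‖ ^ 2 ≤ ∫ _ in I, (∏ j, b j) * (∏ j, q j) :=
  ⟨TwoStep.ae_multiplicity_le e hImeas hIbdd ha hq hb hP hK hφ hframe,
    TwoStep.norm_sq_le_setIntegral e hImeas hIbdd ha hq hb hK hφ hframe⟩
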